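/- **Setting.** Let $\mathbb{R}_n$ ($n\ge 1$) be the real Clifford algebra generated by $e_1,\dots,e_n$ with $e_i^2=-1$, $e_ie_j=-e_je_i$ ($i\neq j$), with basis $e_\alpha$ ($\alpha\subseteq\{1,\dots,n\}$), conjugation $a\mapsto\bar a$ (the anti-automorphism with $\bar e_j=-e_j$), and $\mathrm{Re}\,a$ the coefficient of $1$; write $a\succeq 0$ if $a=b\bar b$ for some $b\in\mathbb{R}_n$. Identify $s\in\mathbb{R}^{n+1}$ with $s_0+\sum_i s_ie_i$, put $\mathrm{Re}(s)=s_0$ and $|s|^2=\sum_{i=0}^n s_i^2$, let $\mathbb{S}=\{\mathfrak I\in\mathbb{R}^{n+1}:\mathrm{Re}(\mathfrak I)=0,\ |\mathfrak I|=1\}$, and for $\mathfrak I\in\mathbb{S}$ put $\mathbb{C}_{\mathfrak I}=\mathbb{R}+\mathbb{R}\mathfrak I\cong\mathbb{C}$ and $\mathbb{C}_{\mathfrak I}^+=\{u+v\mathfrak I: v\ge 0\}$. Let $\mathcal H$ be a real Hilbert space and $\mathcal H_n=\mathcal H\otimes\mathbb{R}_n$ the Clifford module of vectors $x=\sum_\alpha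 x_\alpha e_\alpha$, with $\|x\|^2=\sum_\alpha\|x_\alpha\|^2$ and the $\mathbb{R}_n$-valued inner product $\langle x,y\rangle=\sum_{\alpha,\beta}\langle x_\alpha,y_\beta\rangle_{\mathcal H}\,\bar e_\beta e_\alpha$, so that $\langle xa,y\rangle=\langle x,y\rangle a$. Let $\mathcal B(\mathcal H_n)$ be the bounded right $\mathbb{R}_n$-linear operators; $T^*$ is defined by $\langle Tx,y\rangle=\langle x,T^*y\rangle$, $T$ is normal if $TT^*=T^*T$, and positive ($T\succeq0$) if $\langle Tx,x\rangle\succeq 0$ for all $x$. An operator $J$ is imaginary if $J^*=-J$ and $JJ^*=J^*J=1$. The $S$-spectrum $\sigma_S(T)$ is the set of $s\in\mathbb{R}^{n+1}$ for which $T^2-2\mathrm{Re}(s)T+|s|^2$ has no bounded inverse. A spectral measure on a measurable space is a map $E$ from the measurable sets to the self-adjoint idempotents of $\mathcal B(\mathcal H_n)$ that is countably additive in the strong operator topology and takes the value $1$ on the whole space; a property holds $E$-a.e. if it holds off a measurable set $N$ with $E(N)=0$. For a spectral measure $E$, an operator $J$ and a bounded measurable $\mathbb{C}_{\mathfrak I}$-valued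 $f$, the spectral integral $\mathbb I(f)$ is the norm limit of the operators $\sum_j\{\mathrm{Re}(c_j)E(M_j)+\mathrm{Im}(c_j)E(M_j)J\}$ over simple functions $\sum_jc_j\chi_{M_j}$ (with the $M_j$ disjoint) that converge uniformly to $f$; for real $f$ it does not depend on $J$ and is written $\int f\,dE$. For an $\mathbb{R}_n$-valued measure $\mu=\sum_\alpha\mu_\alpha e_\alpha$ and real $g$, $\int g\,d\mu=\sum_\alpha(\int g\,d\mu_\alpha)e_\alpha$, and for $\mathbb{C}_{\mathfrak I}$-valued $f$, $\int d\mu\, f=\int\mathrm{Re}f\,d\mu+\left(\int\mathrm{Im}f\,d\mu\right)\mathfrak I$. For a normal $T\in\mathcal B(\mathcal H_n)$, an imaginary operator $J$ is called *admissible for $T$* if $T=A+JB$ with $A$ self-adjoint, $B$ positive, and $A,B,J$ mutually commuting. A spectral measure $E$ on the Borel sets of $\sigma_S(T)\cap\mathbb{C}_{\mathfrak I}^+$ is called *the spectral measure of $T$* if, for an admissible $J$, $$T=\int\mathrm{Re}(\lambda)\,dE(\lambda)+\int\mathrm{Im}(\lambda)\,dE(\lambda)\,J.\qquad(*)$$ **Statement.**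 Let $T\in\mathcal B(\mathcal H_n)$ be normal, $J$ an imaginary operator admissible for $T$, $\mathfrak I\in\mathbb{S}$, $\Omega=\sigma_S(T)\cap\mathbb{C}_{\mathfrak I}^+$, and let $E$ be the spectral measure of $T$ on $\Omega$, so that $(*)$ holds for $E$ and $J$. Then for every bounded Borel function $f:\Omega\to\mathbb{C}_{\mathfrak I}$ the spectral integral $\mathbb I(f)\in\mathcal B(\mathcal H_n)$ is well defined and normal, and for all bounded Borel $f,g:\Omega\to\mathbb{C}_{\mathfrak I}$, $c\in\mathbb{C}_{\mathfrak I}$ and $x,y\in\mathcal H_n$: 1. $\mathbb I(\bar f)=\mathbb I(f)^*$. 2. $\mathbb I(fg)=\mathbb I(f)\mathbb I(g)$. 3. $\mathbb I(\mathfrak I)=J$ and $\mathbb I(cf+g)=(\mathrm{Re}(c)+\mathrm{Im}(c)J)\,\mathbb I(f)+\mathbb I(g)$. 4. $\langle\mathbb I(f)x,y\rangle=\int\mathrm{Re}f\,d\langle E(\lambda)x,y\rangle+\int\mathrm{Im}f\,d\langle JE(\lambda)x,y\rangle$. 5. $\|\mathbb I(f)x\|^2=\int|f|^2\,d\,\mathrm{Re}\langle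 E(\lambda)x,x\rangle$. 6. $\|\mathbb I(f)\|\le\sup_\Omega|f|$; moreover $f$ is $E$-essentially bounded and $\|\mathbb I(f)\|$ equals its $E$-essential supremum norm. 7. If bounded Borel functions $f_j$ converge to $f$ $E$-a.e. and $|f_j|\le\kappa$ on $\Omega$ for all $j$ and some $\kappa>0$, then $\mathbb I(f_j)\to\mathbb I(f)$ strongly. 8. If $\Pi_\pm$ are the orthogonal projections onto $\{x: Jx=x(\pm\mathfrak I)\}$, then $\langle\mathbb I(f)x,y\rangle=\int d\langle E(\lambda)\Pi_+x,y\rangle\,f(\lambda)+\int d\langle E(\lambda)\Pi_-x,y\rangle\,\overline{f(\lambda)}$. 9. If $f\ge 0$ $E$-a.e., then $\mathbb I(f)\succeq0$. 10. $\mathbb I(f)$ is invertible in $\mathcal B(\mathcal H_n)$ if and only if $f\ne0$ $E$-a.e. and $1/f$ is $E$-essentially bounded. In this case $\mathbb I(f)^{-1}=\mathbb I(1/f)$, i.e. $1/f$ is $E$-a.e. equal to a bounded Borel function, and $\mathbb I(f)^{-1}=\mathbb I(g)$ for every bounded Borel $g$ with $g=1/f$ $E$-a.e. 11. (a) If $f\in\mathbb{C}_{\mathfrak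 I}^+$ $E$-a.e., then $J$ is admissible for $\mathbb I(f)$, the spectral measure $E_{\mathbb I(f)}$ of $\mathbb I(f)$ on $\sigma_S(\mathbb I(f))\cap\mathbb{C}^+_{\mathfrak I}$ exists (with $J$), and, whichever operator admissible for $\mathbb I(f)$ is used to define it, $E_{\mathbb I(f)}(M\cap\sigma_S(\mathbb I(f))\cap\mathbb{C}_{\mathfrak I}^+)=E(f^{-1}(M))$ for every Borel $M\subseteq\mathbb{C}_{\mathfrak I}$. (b) For arbitrary $f$ and every $R$ with $|f|\le R$ on $\Omega$, there is a spectral measure $G$ on the Borel sets of $D_R=\{\lambda\in\mathbb{C}_{\mathfrak I}:|\lambda|\le R\}$ with $\mathbb I(f)=\int\mathrm{Re}(\lambda)\,dG+\int\mathrm{Im}(\lambda)\,dG\,J$, and every such $G$ satisfies $G(M\cap D_R)=E(f^{-1}(M))$ for every Borel $M\subseteq\mathbb{C}_{\mathfrak I}$. -/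

import Mathlib

open MeasureTheory Filter Topology

noncomputable section

namespace CliffordSpectral

/-! ### The Clifford algebra `ℝₙ` -/

/-- The quadratic form `v ↦ -(v₁² + ⋯ + vₙ²)` on `ℝⁿ`. -/
abbrev negForm (n : ℕ) : QuadraticForm ℝ (Fin n → ℝ) :=
  QuadraticMap.weightedSumSquares ℝ (fun _ : Fin n => (-1 : ℝ))

/-- The Clifford algebra `ℝₙ = ℝ₀,ₙ`, generated by `n` anticommuting units with square `-1`.
Clifford conjugation `a ↦ ā` is Mathlib's `star` (it reverses products and `star eⱼ = -eⱼ`). -/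
abbrev Cl (n : ℕ) : Type := CliffordAlgebra (negForm n)

/-- The imaginary units `e₁, …, eₙ`. -/
def gen (n : ℕ) (i : Fin n) : Cl n := CliffordAlgebra.ι (negForm n) (Pi.single i 1)

/-- The basis `(e_α)` of `ℝₙ`, indexed by the subsets `α` of `{1, …, n}`; by `clBasis_apply` its
members are the products `e_α = e_{i₁} ⋯ e_{iᵣ}`, `i₁ < ⋯ < iᵣ`. -/
def clBasis (n : ℕ) : Module.Basis (Finset (Fin n)) ℝ (Cl n) :=
  (Pi.basisFun ℝ (Fin n)).ExteriorAlgebra.map (CliffordAlgebra.equivExterior (negForm n)).symm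

theorem gen_mul_self (n : ℕ) (i : Fin n) : gen n i * gen n i = -1 := by
  have h : negForm n (Pi.single i 1) = -1 := by
    rw [QuadraticMap.weightedSumSquares_apply]
    simp [Pi.single_apply]
  rw [gen, CliffordAlgebra.ι_sq_scalar, h, map_neg, map_one]

theorem contractLeft_prod_eq_zero {M : Type*} [AddCommGroup M] [Module ℝ M]
    {Q : QuadraticForm ℝ M} (d : Module.Dual ℝ M) (l : List M) (h : ∀ v ∈ l, d v = 0) :
    CliffordAlgebra.contractLeft d (l.map (CliffordAlgebra.ι Q)).prod = 0 := by
  induction l with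
  | nil => simp
  | cons v l ih =>
    rw [List.map_cons, List.prod_cons, CliffordAlgebra.contractLeft_ι_mul,
      ih fun w hw => h w (List.mem_cons_of_mem _ hw), h v List.mem_cons_self]
    simp

theorem equivExterior_prod (n : ℕ) (l : List (Fin n)) (hl : l.Nodup) :
    CliffordAlgebra.equivExterior (negForm n) (l.map (gen n)).prod =
      (l.map fun i => ExteriorAlgebra.ι ℝ (Pi.single i 1 : Fin n → ℝ)).prod := by
  induction l with
  | nil =>
    exact CliffordAlgebra.changeForm_one CliffordAlgebra.changeForm.associated_neg_proof
  | cons i l ih =>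
    rw [List.nodup_cons] at hl
    have key := CliffordAlgebra.changeForm_ι_mul
      (CliffordAlgebra.changeForm.associated_neg_proof (Q := negForm n))
      (Pi.single i 1) (l.map (gen n)).prod
    have ih' : CliffordAlgebra.changeForm
        (CliffordAlgebra.changeForm.associated_neg_proof (Q := negForm n)) (l.map (gen n)).prod =
        (l.map fun i => ExteriorAlgebra.ι ℝ (Pi.single i 1 : Fin n → ℝ)).prod := ih hl.2
    rw [ih'] at key
    have hz := contractLeft_prod_eq_zero (Q := (0 : QuadraticForm ℝ (Fin n → ℝ)))
      (QuadraticMap.associated (R := ℝ) (-(negForm n)) (Pi.single i 1))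
      (l.map fun j => (Pi.single j 1 : Fin n → ℝ)) (by
        intro v hv
        obtain ⟨j, hj, rfl⟩ := List.mem_map.1 hv
        have hij : j ≠ i := fun h => hl.1 (h ▸ hj)
        simp only [QuadraticMap.associated_apply, neg_apply,
          QuadraticMap.weightedSumSquares_apply]
        have h1 : ∀ x : Fin n, (Pi.single i 1 + Pi.single j 1 : Fin n → ℝ) x *
            (Pi.single i 1 + Pi.single j 1 : Fin n → ℝ) x =
            (Pi.single i 1 : Fin n → ℝ) x * (Pi.single i 1 : Fin n → ℝ) x +
            (Pi.single j 1 : Fin n → ℝ) x * (Pi.single j 1 : Fin n → ℝ) x := by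
          intro x
          simp only [Pi.add_apply, Pi.single_apply]
          by_cases h2 : x = i
          · simp [h2, Ne.symm hij]
          · simp [h2]
        simp only [h1, smul_add, Finset.sum_add_distrib]
        ring_nf
        simp)
    rw [List.map_map] at hz
    have hz' : CliffordAlgebra.contractLeft
        (QuadraticMap.associated (R := ℝ) (-(negForm n)) (Pi.single i 1))
        (l.map fun i => ExteriorAlgebra.ι ℝ (Pi.single i 1 : Fin n → ℝ)).prod = 0 := hz
    rw [hz', sub_zero] at key
    rw [List.map_cons, List.prod_cons, List.map_cons, List.prod_cons]
    exact key

theorem clBasis_apply (n : ℕ) (α : Finset (Fin n)) :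
    clBasis n α = (α.sort.map (gen n)).prod := by
  rw [clBasis, Module.Basis.map_apply, LinearEquiv.symm_apply_eq,
    equivExterior_prod n _ (α.sort_nodup _), ExteriorAlgebra.basis_apply_ofCard _ rfl,
    ExteriorAlgebra.ιMulti_family, ExteriorAlgebra.ιMulti_apply,
    ← Finset.listMap_orderEmbOfFin_finRange α rfl, List.map_map, List.ofFn_eq_map]
  congr 1
  refine List.map_congr_left fun k _ => ?_
  simp [Set.powersetCard.ofFinEmbEquiv_symm_apply, Set.powersetCard.ofCard]

/-- The paravector `s₀ + s₁ e₁ + ⋯ + sₙ eₙ ∈ ℝₙ` attached to `s ∈ ℝⁿ⁺¹`. -/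
def toCl {n : ℕ} (s : EuclideanSpace ℝ (Fin (n + 1))) : Cl n :=
  s 0 • (1 : Cl n) + ∑ i : Fin n, s i.succ • gen n i

/-- The sphere `𝕊` of purely imaginary unit paravectors. -/
def unitSphere (n : ℕ) : Set (EuclideanSpace ℝ (Fin (n + 1))) :=
  {I | I 0 = 0 ∧ ‖I‖ = 1}

/-- The identification of `ℂ` with the plane `ℂ_I = ℝ + ℝ I ⊆ ℝⁿ⁺¹`, `u + i v ↦ u + v I`. Through
it, a `ℂ_I`-valued function is given by a function with values in `ℂ` (real and imaginary parts,
modulus, conjugate and product agree). -/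
def slice {n : ℕ} (I : EuclideanSpace ℝ (Fin (n + 1))) (z : ℂ) :
    EuclideanSpace ℝ (Fin (n + 1)) :=
  z.re • EuclideanSpace.single 0 (1 : ℝ) + z.im • I

/-- Positive semidefinite Clifford numbers. -/
def ClPosSemidef {n : ℕ} (a : Cl n) : Prop := ∃ b : Cl n, a = b * star b

/-! ### The Clifford module `ℋₙ` and its bounded operators -/

/-- The Clifford module `ℋₙ = ℋ ⊗ ℝₙ`: the vector `x = ∑_α x_α ⊗ e_α` is given by the family of its
components `x_α ∈ ℋ`, and `‖x‖ = (∑_α ‖x_α‖²)^(1/2)`. -/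
abbrev CModule (n : ℕ) (H : Type*) : Type _ := PiLp 2 (fun _ : Finset (Fin n) => H)

variable {n : ℕ} {H : Type*} [NormedAddCommGroup H] [InnerProductSpace ℝ H]

/-- Right multiplication `x ↦ x a = ∑_α x_α ⊗ (e_α a)`. -/
def rmul (a : Cl n) : CModule n H →L[ℝ] CModule n H :=
  ((PiLp.continuousLinearEquiv 2 ℝ (fun _ : Finset (Fin n) => H)).symm :
      (Finset (Fin n) → H) →L[ℝ] CModule n H).comp
    (ContinuousLinearMap.pi fun γ =>
      ∑ α, (clBasis n).repr (clBasis n α * a) γ • PiLp.proj 2 (fun _ : Finset (Fin n) => H) α)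

/-- The `ℝₙ`-valued inner product `⟨x, y⟩ = ∑_{α,β} ⟨x_α, y_β⟩_ℋ ē_β e_α`; it satisfies
`⟨x a, y⟩ = ⟨x, y⟩ a` and `⟨x, y a⟩ = ā ⟨x, y⟩`. -/
def cinner (x y : CModule n H) : Cl n :=
  ∑ α, ∑ β, (inner ℝ (x α) (y β) : ℝ) • (star (clBasis n β) * clBasis n α)

variable (n H) in
/-- `ℬ(ℋₙ)`: the bounded right `ℝₙ`-linear operators on `ℋₙ`, with the operator norm. -/
def BOp : Subalgebra ℝ (CModule n H →L[ℝ] CModule n H) where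
  carrier := {T | ∀ (a : Cl n) (x : CModule n H), T (rmul a x) = rmul a (T x)}
  mul_mem' := by
    intro S T hS hT a x
    change S (T (rmul a x)) = rmul a (S (T x))
    rw [hT a x, hS a]
  add_mem' := by
    intro S T hS hT a x
    change S (rmul a x) + T (rmul a x) = rmul a (S x + T x)
    rw [hT a x, hS a x, map_add]
  algebraMap_mem' := by
    intro r a x
    simp [Algebra.algebraMap_eq_smul_one]

/-- `S = T*`, i.e. `⟨T x, y⟩ = ⟨x, S y⟩` for all `x, y`. -/
def IsAdjointOf (S T : BOp n H) : Prop :=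
  ∀ x y : CModule n H, cinner (T.1 x) y = cinner x (S.1 y)

def IsSelfAdj (T : BOp n H) : Prop := IsAdjointOf T T

/-- `T` is normal: `T T* = T* T`. -/
def IsNormalOp (T : BOp n H) : Prop := ∃ S : BOp n H, IsAdjointOf S T ∧ T * S = S * T

/-- `T` is positive: `⟨T x, x⟩ ⪰ 0` for all `x`. -/
def IsPositiveOp (T : BOp n H) : Prop := ∀ x : CModule n H, ClPosSemidef (cinner (T.1 x) x)

/-- An imaginary operator: `J* = -J` and `J` is unitary. -/
def IsImaginary (J : BOp n H) : Prop := IsAdjointOf (-J) J ∧ J * (-J) = 1 ∧ (-J) * J = 1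

/-- `J` is an imaginary operator for which `T = A + J B` with `A` self-adjoint, `B` positive and
`A`, `B`, `J` mutually commuting. -/
def IsImaginaryFor (J T : BOp n H) : Prop :=
  IsImaginary J ∧ ∃ A B : BOp n H, IsSelfAdj A ∧ IsPositiveOp B ∧
    A * B = B * A ∧ A * J = J * A ∧ B * J = J * B ∧ T = A + J * B

/-- The subspace `ℋ₊(J, I) = {x | J x = x I}`. -/
abbrev plusSpace (J : BOp n H) (I : EuclideanSpace ℝ (Fin (n + 1))) :
    Submodule ℝ (CModule n H) :=
  J.1.toLinearMap.eqLocus (rmul (H := H) (toCl I)).toLinearMap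

/-- The subspace `ℋ₋(J, I) = {x | J x = x (-I)}`. -/
abbrev minusSpace (J : BOp n H) (I : EuclideanSpace ℝ (Fin (n + 1))) :
    Submodule ℝ (CModule n H) :=
  J.1.toLinearMap.eqLocus (rmul (H := H) (-toCl I)).toLinearMap

/-! ### The `S`-spectrum -/

/-- `𝒬_s(T) = T² - 2 Re(s) T + |s|²`. -/
def Qop (T : BOp n H) (s : EuclideanSpace ℝ (Fin (n + 1))) : BOp n H :=
  T ^ 2 - (2 * s 0) • T + (‖s‖ ^ 2) • (1 : BOp n H)

/-- The `S`-resolvent set: `𝒬_s(T)` has trivial kernel and dense range, and its inverse, defined on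
the range, is bounded. -/
def sResolventSet (T : BOp n H) : Set (EuclideanSpace ℝ (Fin (n + 1))) :=
  {s | (∀ x, (Qop T s).1 x = 0 → x = 0) ∧ DenseRange (Qop T s).1 ∧
    ∃ C : ℝ, ∀ x, ‖x‖ ≤ C * ‖(Qop T s).1 x‖}

/-- The `S`-spectrum `σ_S(T) ⊆ ℝⁿ⁺¹`. -/
def sSpectrum (T : BOp n H) : Set (EuclideanSpace ℝ (Fin (n + 1))) := (sResolventSet T)ᶜ

/-- The set `Ω_I⁺ = σ_S(T) ∩ ℂ_I⁺`, with `ℂ_I⁺` identified with the closed upper half plane. -/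
def specPlus (T : BOp n H) (I : EuclideanSpace ℝ (Fin (n + 1))) : Set ℂ :=
  {z | 0 ≤ z.im ∧ slice I z ∈ sSpectrum T}

/-! ### Spectral measures -/

variable (n H) in
/-- A spectral measure on `Ω`: its values on measurable sets are orthogonal projections, it is
countably additive in the strong operator topology, and `E(Ω) = 1`. (The values on non-measurable
sets play no role.) -/
structure SpectralMeasure (Ω : Type*) [MeasurableSpace Ω] where
  toFun : Set Ω → BOp n H
  selfAdj : ∀ M, MeasurableSet M → IsSelfAdj (toFun M)
  idem : ∀ M, MeasurableSet M → toFun M * toFun M = toFun M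
  univ : toFun Set.univ = 1
  iUnion : ∀ M : ℕ → Set Ω, (∀ i, MeasurableSet (M i)) → Pairwise (Function.onFun Disjoint M) →
    ∀ x : CModule n H, HasSum (fun i => (toFun (M i)).1 x) ((toFun (⋃ i, M i)).1 x)

variable {Ω : Type*} [MeasurableSpace Ω]

instance : CoeFun (SpectralMeasure n H Ω) (fun _ => Set Ω → BOp n H) := ⟨SpectralMeasure.toFun⟩

/-- `p` holds `E`-almost everywhere. -/
def SpectralMeasure.AE (E : SpectralMeasure n H Ω) (p : Ω → Prop) : Prop :=
  ∃ N : Set Ω, MeasurableSet N ∧ E N = 0 ∧ ∀ z, z ∉ N → p z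

theorem SpectralMeasure.apply_empty (E : SpectralMeasure n H Ω) (x : CModule n H) :
    (E ∅).1 x = 0 := by
  have h := E.iUnion (fun _ => ∅) (fun _ => MeasurableSet.empty)
    (fun _ _ _ => by simp [Function.onFun]) x
  exact (summable_const_iff _).1 h.summable

/-- The map `x ↦ ⟨x, y⟩_γ`, the `γ`-component of the `ℝₙ`-valued inner product. -/
def compInner (y : CModule n H) (γ : Finset (Fin n)) : CModule n H →L[ℝ] ℝ :=
  ∑ α, ∑ β, (clBasis n).repr (star (clBasis n β) * clBasis n α) γ •
    (innerSL ℝ (y β)).comp (PiLp.proj 2 (fun _ : Finset (Fin n) => H) α)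

theorem compInner_apply (x y : CModule n H) (γ : Finset (Fin n)) :
    compInner y γ x = (clBasis n).repr (cinner x y) γ := by
  simp [compInner, cinner, map_sum, Finsupp.finsetSum_apply,
    real_inner_comm, mul_comm]

open Classical in
/-- The components (with respect to `(e_γ)`) of the `ℝₙ`-valued measure `M ↦ ⟨W E(M) x, y⟩`. -/
def SpectralMeasure.innerMeasure (E : SpectralMeasure n H Ω) (W : BOp n H) (x y : CModule n H)
    (γ : Finset (Fin n)) : SignedMeasure Ω where
  measureOf' M := if MeasurableSet M then (clBasis n).repr (cinner (W.1 ((E M).1 x)) y) γ else 0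
  empty' := by
    rw [if_pos MeasurableSet.empty, E.apply_empty, ← compInner_apply, map_zero, map_zero]
  not_measurable' _ h := if_neg h
  m_iUnion' := by
    intro M hM hd
    simp only [hM, MeasurableSet.iUnion hM, if_true, ← compInner_apply]
    exact ((E.iUnion M hM hd x).mapL W.1).mapL (compInner y γ)

/-- The integral of a real function against a signed measure, through the Jordan decomposition. -/
def signedIntegral (g : Ω → ℝ) (μ : SignedMeasure Ω) : ℝ :=
  ∫ z, g z ∂μ.toJordanDecomposition.posPart - ∫ z, g z ∂μ.toJordanDecomposition.negPart

/-- The integral `∫ g dμ ∈ ℝₙ` of a real function against the `ℝₙ`-valued measure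
`μ = ∑_γ μ_γ e_γ`. -/
def clIntegral (g : Ω → ℝ) (μ : Finset (Fin n) → SignedMeasure Ω) : Cl n :=
  ∑ γ, signedIntegral g (μ γ) • clBasis n γ

/-- The integral `∫ dμ f = ∫ Re f dμ + (∫ Im f dμ) I ∈ ℝₙ` of a `ℂ_I`-valued function against the
`ℝₙ`-valued measure `μ`, with the function on the right. -/
def clIntegralRight (I : EuclideanSpace ℝ (Fin (n + 1))) (μ : Finset (Fin n) → SignedMeasure Ω)
    (f : Ω → ℂ) : Cl n :=
  clIntegral (fun z => (f z).re) μ + clIntegral (fun z => (f z).im) μ * toCl I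

/-! ### Spectral integrals -/

/-- Bounded measurable functions. -/
def IsBddMeas (f : Ω → ℂ) : Prop := Measurable f ∧ ∃ C : ℝ, ∀ z, ‖f z‖ ≤ C

/-- The supremum norm. -/
def supNorm (f : Ω → ℂ) : ℝ := ⨆ z, ‖f z‖

/-- `f` is essentially bounded with respect to `E`. -/
def SpectralMeasure.EssBdd (E : SpectralMeasure n H Ω) (f : Ω → ℂ) : Prop :=
  ∃ C : ℝ, E.AE fun z => ‖f z‖ ≤ C

/-- The essential supremum norm of `f` with respect to `E`. -/
def SpectralMeasure.essNorm (E : SpectralMeasure n H Ω) (f : Ω → ℂ) : ℝ :=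
  sInf {C : ℝ | 0 ≤ C ∧ E.AE fun z => ‖f z‖ ≤ C}

/-- The spectral integral `∑_c (Re c) E({s = c}) + (Im c) E({s = c}) J` of a simple function. -/
def SpectralMeasure.simpleIntegral (E : SpectralMeasure n H Ω) (J : BOp n H)
    (s : SimpleFunc Ω ℂ) : BOp n H :=
  ∑ c ∈ s.range, (c.re • E (s ⁻¹' {c}) + c.im • (E (s ⁻¹' {c}) * J))

/-- `L` is the spectral integral of `f`: the limit, in operator norm, of the spectral integrals of
the simple functions that approximate `f` uniformly. -/
def SpectralMeasure.IsIntegral (E : SpectralMeasure n H Ω) (J : BOp n H) (f : Ω → ℂ)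
    (L : BOp n H) : Prop :=
  ∀ s : ℕ → SimpleFunc Ω ℂ, TendstoUniformly (fun k z => s k z) f atTop →
    Tendsto (fun k => E.simpleIntegral J (s k)) atTop (𝓝 L)

open Classical in
/-- The spectral integral `𝕀(f)` of a bounded measurable function. -/
def SpectralMeasure.integral (E : SpectralMeasure n H Ω) (J : BOp n H) (f : Ω → ℂ) : BOp n H :=
  if h : ∃ L, E.IsIntegral J f L then h.choose else 0

/-- `T = ∫ Re(λ) dE(λ) + ∫ Im(λ) dE(λ) J`, for a spectral measure `E` on a subset of the plane. -/
def Represents {S : Set ℂ} (E : SpectralMeasure n H S) (T J : BOp n H) : Prop :=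
  T = E.integral J (fun z => (((z : ℂ).re : ℝ) : ℂ)) +
    E.integral J (fun z => (((z : ℂ).im : ℝ) : ℂ)) * J

end CliffordSpectral

end

open CliffordSpectral

noncomputable section

namespace CliffordSpectral

/-! ### Products of basis elements of the Clifford algebra -/

section Clifford

variable {n : ℕ}

/-! The Clifford structure is first removed. The components of `cinner x y` are the real inner
products of `x` with the vectors `y e_γ` (`repr_cinner`), so for right linear operators the Clifford
adjoint is the adjoint on the underlying real Hilbert space (`isAdjointOf_iff_star`). A spectral
measure thus becomes a projection-valued measure `P` on a real Hilbert space (`toProj`), and `J`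
becomes a skew operator with `J² = -1`. The spectral integral is `∫ Re f dP + (∫ Im f dP) J`
(`cintegral`).

The decisive point is that `J` commutes with `P`, which the representation of `T` does not contain.
It gives `A + J B = A' + B' J` with `A'`, `B'` the integrals of the coordinates. Taking adjoints and
using that `A'` and `B'` commute forces `A' = A` and `B' = B` (`cartesian_unique`), so `J` commutes
with both coordinate integrals. By Stone–Weierstrass and bounded convergence it commutes with all
projections (`intertwine`). Here `B` has to be self-adjoint; positivity implies this as soon as `n ≠
0` (`IsPositiveOp.isSelfAdj`).

Once `J` commutes with `P`, the integral is a *-homomorphism on bounded measurable functions, with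
`J` in the role of `i`. The identity `𝕀(f)* 𝕀(f) = ∫ |f|² dP` yields the norm formulas, and testing
bounds on ranges of projections yields the essential norm and the criterion for invertibility
(`apply_setOf_lt_eq_zero`).

Measures for `𝕀(f)` are images of `E` under `f`. To place the image on the `S`-spectrum, `𝒬_w(𝕀(f))`
is written as the integral of `(f - w)(f - w̄)`: if `w` is off the spectrum, this function is
bounded away from zero almost everywhere, so `f` avoids a neighbourhood of `w`. For uniqueness on
the half plane, `L + L*` and `(L - L*)²` determine the integrals of `Re` and `Im²` whatever the
imaginary operator, and `Im ≥ 0` recovers the measure (`apply_preimage_eq_of_sq`). On the disc the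
sign of `Im` is free, but `J` is fixed and `cartesian_unique` applies again. -/

theorem gen_mul_gen_of_ne {i j : Fin n} (h : i ≠ j) : gen n i * gen n j = -(gen n j * gen n i) := by
  refine CliffordAlgebra.ι_mul_ι_comm_of_isOrtho ?_
  rw [QuadraticMap.isOrtho_def]
  simp only [QuadraticMap.weightedSumSquares_apply, ← Finset.sum_add_distrib]
  refine Finset.sum_congr rfl fun k _ => ?_
  simp only [Pi.add_apply, Pi.single_apply]
  by_cases h1 : k = i
  · have : k ≠ j := fun h2 => h (h1 ▸ h2)
    simp [h1, h]
  · simp [h1]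

theorem star_gen (i : Fin n) : star (gen n i) = -gen n i := CliffordAlgebra.star_ι _

theorem eq_or_eq_neg_trans {a b c : Cl n} (h : a = b ∨ a = -b) (h' : b = c ∨ b = -c) :
    a = c ∨ a = -c := by
  rcases h with rfl | rfl <;> rcases h' with rfl | rfl <;> simp

theorem eq_or_eq_neg_mul_left {a b : Cl n} (c : Cl n) (h : a = b ∨ a = -b) :
    c * a = c * b ∨ c * a = -(c * b) := by
  rcases h with rfl | rfl <;> simp

theorem prod_gen_perm {l l' : List (Fin n)} (h : l.Perm l') :
    (l.map (gen n)).prod = (l'.map (gen n)).prod ∨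
      (l.map (gen n)).prod = -(l'.map (gen n)).prod := by
  induction h with
  | nil => simp
  | cons i _ ih => simpa using eq_or_eq_neg_mul_left (gen n i) ih
  | swap i j l =>
    by_cases hij : j = i
    · simp [hij]
    · right
      simp only [List.map_cons, List.prod_cons, ← mul_assoc, gen_mul_gen_of_ne hij, neg_mul]
  | trans _ _ ih ih' => exact eq_or_eq_neg_trans ih ih'

theorem prod_gen_of_nodup {l : List (Fin n)} (hl : l.Nodup) :
    (l.map (gen n)).prod = clBasis n l.toFinset ∨ (l.map (gen n)).prod = -clBasis n l.toFinset := by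
  rw [clBasis_apply]
  refine prod_gen_perm ?_
  rw [List.perm_ext_iff_of_nodup hl (Finset.sort_nodup _ _)]
  simp

/-- Multiplying by `e_i` either inserts `i` or cancels it through `e_i² = -1`. Signs are left
undetermined, here and below, because only the index of the resulting basis element matters for the
coefficient of `1`. -/
theorem gen_mul_clBasis (i : Fin n) (α : Finset (Fin n)) :
    gen n i * clBasis n α = clBasis n (symmDiff {i} α) ∨
      gen n i * clBasis n α = -clBasis n (symmDiff {i} α) := by
  have key : ∀ β : Finset (Fin n), i ∉ β →
      gen n i * clBasis n β = clBasis n (insert i β) ∨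
        gen n i * clBasis n β = -clBasis n (insert i β) := by
    intro β hβ
    have := prod_gen_of_nodup (l := i :: β.sort) (by simp [hβ])
    simpa [clBasis_apply n β] using this
  by_cases hi : i ∈ α
  · have h1 := key (α.erase i) (Finset.notMem_erase i α)
    rw [Finset.insert_erase hi] at h1
    have h2 : symmDiff {i} α = α.erase i := by
      ext j; simp only [Finset.mem_symmDiff, Finset.mem_singleton, Finset.mem_erase]; grind
    rw [h2]
    have h3 : gen n i * (gen n i * clBasis n (α.erase i)) = -clBasis n (α.erase i) := by
      rw [← mul_assoc, gen_mul_self, neg_one_mul]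
    rcases h1 with h1 | h1
    · right; rw [← h1, h3]
    · left
      rw [h1, mul_neg, neg_eq_iff_eq_neg] at h3
      simpa using h3
  · have h2 : symmDiff {i} α = insert i α := by
      ext j; simp only [Finset.mem_symmDiff, Finset.mem_singleton, Finset.mem_insert]; grind
    rw [h2]
    exact key α hi

theorem prod_gen_mul_clBasis (l : List (Fin n)) (α : Finset (Fin n)) (hl : l.Nodup) :
    (l.map (gen n)).prod * clBasis n α = clBasis n (symmDiff l.toFinset α) ∨
      (l.map (gen n)).prod * clBasis n α = -clBasis n (symmDiff l.toFinset α) := by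
  induction l with
  | nil =>
    left
    rw [List.map_nil, List.prod_nil, one_mul, List.toFinset_nil, ← Finset.bot_eq_empty,
      bot_symmDiff]
  | cons i l ih =>
    rw [List.nodup_cons] at hl
    have h2 : symmDiff (i :: l).toFinset α = symmDiff {i} (symmDiff l.toFinset α) := by
      rw [← symmDiff_assoc]
      congr 1
      ext j
      simp only [Finset.mem_symmDiff, List.mem_toFinset, List.mem_cons, Finset.mem_singleton]
      have := hl.1
      grind
    rw [List.map_cons, List.prod_cons, mul_assoc, h2]
    exact eq_or_eq_neg_trans (eq_or_eq_neg_mul_left _ (ih hl.2)) (gen_mul_clBasis i _)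

theorem clBasis_mul_clBasis (α β : Finset (Fin n)) :
    clBasis n α * clBasis n β = clBasis n (symmDiff α β) ∨
      clBasis n α * clBasis n β = -clBasis n (symmDiff α β) := by
  have := prod_gen_mul_clBasis α.sort β (α.sort_nodup _)
  rwa [← clBasis_apply, Finset.sort_toFinset] at this

theorem star_prod_gen (l : List (Fin n)) :
    star (l.map (gen n)).prod = (l.reverse.map (gen n)).prod ∨
      star (l.map (gen n)).prod = -(l.reverse.map (gen n)).prod := by
  induction l with
  | nil => simp
  | cons i l ih =>
    rw [List.map_cons, List.prod_cons, star_mul, star_gen, List.reverse_cons, List.map_append,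
      List.prod_append]
    rcases ih with ih | ih <;> simp [ih]

theorem star_clBasis (α : Finset (Fin n)) :
    star (clBasis n α) = clBasis n α ∨ star (clBasis n α) = -clBasis n α := by
  rw [clBasis_apply]
  exact eq_or_eq_neg_trans (star_prod_gen _) (prod_gen_perm (List.reverse_perm _))

theorem star_prod_gen_mul_self (l : List (Fin n)) :
    star (l.map (gen n)).prod * (l.map (gen n)).prod = 1 := by
  induction l with
  | nil => simp
  | cons i l ih =>
    rw [List.map_cons, List.prod_cons, star_mul, star_gen, mul_assoc, ← mul_assoc (-gen n i),
      neg_mul, gen_mul_self, neg_neg, one_mul, ih]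

theorem star_clBasis_mul_self (α : Finset (Fin n)) : star (clBasis n α) * clBasis n α = 1 := by
  rw [clBasis_apply, star_prod_gen_mul_self]

theorem clBasis_empty : clBasis n ∅ = 1 := by simp [clBasis_apply]

/-- The coefficient of `1`. -/
def clRe : Cl n →ₗ[ℝ] ℝ := (clBasis n).coord ∅

theorem clRe_apply (a : Cl n) : clRe a = (clBasis n).repr a ∅ := rfl

theorem clRe_clBasis (α : Finset (Fin n)) : clRe (clBasis n α) = if α = ∅ then 1 else 0 := by
  simp [clRe, Finsupp.single_apply]

/-- For `α ≠ β` the product is, up to sign, a basis element with nonempty index. Hence the `e_α` are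
orthonormal for the form `Re(b̄ a)`, and coefficients can be read off with `clRe`. -/
theorem clRe_star_clBasis_mul (α β : Finset (Fin n)) :
    clRe (star (clBasis n β) * clBasis n α) = if α = β then 1 else 0 := by
  by_cases h : α = β
  · rw [h, star_clBasis_mul_self, ← clBasis_empty, clRe_clBasis]; simp
  · have h0 : symmDiff β α ≠ ∅ := fun h' => h (symmDiff_eq_bot.1 h').symm
    rw [if_neg h]
    rcases star_clBasis β with h1 | h1 <;> rcases clBasis_mul_clBasis β α with h2 | h2 <;>
      simp [h1, h2, clRe_clBasis, h0]

theorem clRe_mul_star_clBasis (α β : Finset (Fin n)) :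
    clRe (clBasis n α * star (clBasis n β)) = if α = β then 1 else 0 := by
  rw [← clRe_star_clBasis_mul]
  have h0 : clRe (clBasis n α * clBasis n β) = clRe (clBasis n β * clBasis n α) := by
    by_cases h : α = β
    · rw [h]
    · have h0 : symmDiff β α ≠ ∅ := fun h' => h (symmDiff_eq_bot.1 h').symm
      have h0' : symmDiff α β ≠ ∅ := fun h' => h (symmDiff_eq_bot.1 h')
      rcases clBasis_mul_clBasis β α with h2 | h2 <;> rcases clBasis_mul_clBasis α β with h3 | h3 <;>
        simp [h3, h2, clRe_clBasis, h0, h0']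
  rcases star_clBasis β with h1 | h1 <;> simp [h1, h0]

/-- The conjugation as a linear map. -/
def clStar : Cl n →ₗ[ℝ] Cl n where
  toFun := star
  map_add' := star_add
  map_smul' r a := CliffordAlgebra.star_smul r a

theorem clStar_apply (a : Cl n) : clStar a = star a := rfl

theorem clRe_mul_star (a : Cl n) (β : Finset (Fin n)) :
    clRe (a * star (clBasis n β)) = (clBasis n).repr a β := by
  have : clRe ∘ₗ LinearMap.mulRight ℝ (star (clBasis n β)) = (clBasis n).coord β :=
    (clBasis n).ext fun α => by
      simp [clRe_mul_star_clBasis, Finsupp.single_apply]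
  exact LinearMap.congr_fun this a

theorem clRe_star_mul (a : Cl n) (β : Finset (Fin n)) :
    clRe (star (clBasis n β) * a) = (clBasis n).repr a β := by
  have : clRe ∘ₗ LinearMap.mulLeft ℝ (star (clBasis n β)) = (clBasis n).coord β :=
    (clBasis n).ext fun α => by
      simp [clRe_star_clBasis_mul, Finsupp.single_apply]
  exact LinearMap.congr_fun this a

/-- The coefficient at `β` is extracted by `ē_β` from either side, and `ē_β = ± e_β`. So `clRe` is a
trace, which is what makes right multiplication by `ā` the real adjoint of right multiplication by
`a`. -/
theorem clRe_mul_comm (a b : Cl n) : clRe (a * b) = clRe (b * a) := by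
  have key : ∀ β, clRe ∘ₗ LinearMap.mulRight ℝ (clBasis n β) =
      clRe ∘ₗ LinearMap.mulLeft ℝ (clBasis n β) := by
    intro β
    refine LinearMap.ext fun a => ?_
    have h := (clRe_mul_star a β).trans (clRe_star_mul a β).symm
    rcases star_clBasis β with h1 | h1 <;> simpa [h1] using h
  have : clRe ∘ₗ LinearMap.mulLeft ℝ a = clRe ∘ₗ LinearMap.mulRight ℝ a :=
    (clBasis n).ext fun β => LinearMap.congr_fun (key β) a
  exact LinearMap.congr_fun this b

theorem clRe_star (a : Cl n) : clRe (star a) = clRe a := by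
  have : clRe ∘ₗ clStar = (clRe : Cl n →ₗ[ℝ] ℝ) := (clBasis n).ext fun β => by
    have h1 := clRe_star_clBasis_mul ∅ β
    have h2 := clRe_clBasis β
    rw [clBasis_empty, mul_one] at h1
    rw [LinearMap.comp_apply, clStar_apply, h1, h2]
    simp only [eq_comm]
  exact LinearMap.congr_fun this a

/-- A self-adjoint Clifford number that is positive for the trace form is of the form `b b̄`. -/
theorem clPosSemidef_of_nonneg {a : Cl n} (ha : star a = a)
    (h : ∀ b : Cl n, 0 ≤ clRe (star b * a * b)) : ClPosSemidef a := by
  set L := Algebra.leftMulMatrix (clBasis n) with hL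
  have hform : ∀ b c : Cl n, clRe (star b * c) =
      ∑ α, (clBasis n).repr b α * (clBasis n).repr c α := by
    intro b c
    have hb : star b = ∑ α, (clBasis n).repr b α • star (clBasis n α) := by
      conv_lhs => rw [← (clBasis n).sum_repr b]
      rw [← clStar_apply, map_sum]
      simp [clStar_apply]
    rw [hb, Finset.sum_mul, map_sum]
    simp [clRe_star_mul]
  have hherm : (L a).IsHermitian := by
    ext α β
    have h1 : L a β α = clRe (star (clBasis n β) * (a * clBasis n α)) := by
      rw [hL, Algebra.leftMulMatrix_eq_repr_mul, clRe_star_mul]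
    have h2 : L a α β = clRe (star (clBasis n α) * (a * clBasis n β)) := by
      rw [hL, Algebra.leftMulMatrix_eq_repr_mul, clRe_star_mul]
    rw [Matrix.conjTranspose_apply, star_trivial, h1, h2, ← clRe_star]
    simp [star_mul, ha, mul_assoc]
  have hpos : (L a).PosSemidef := by
    refine Matrix.PosSemidef.of_dotProduct_mulVec_nonneg hherm fun v => ?_
    have hv := h ((clBasis n).equivFun.symm v)
    rw [mul_assoc, hform] at hv
    set b := (clBasis n).equivFun.symm v with hb
    have e1 : ⇑((clBasis n).repr b) = v := (clBasis n).equivFun.apply_symm_apply v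
    have e2 : dotProduct (star v) ((L a).mulVec v) =
        ∑ α, (clBasis n).repr b α * (clBasis n).repr (a * b) α := by
      rw [← e1, hL, Algebra.leftMulMatrix_mulVec_repr]
      rfl
    exact e2 ▸ hv
  have hsa : IsSelfAdjoint (L a) := hherm
  have hfin : (spectrum ℝ (L a)).Finite := Matrix.finite_real_spectrum
  set p := Lagrange.interpolate hfin.toFinset id Real.sqrt with hp
  have hpe : ∀ x ∈ spectrum ℝ (L a), p.eval x * p.eval x = x := by
    intro x hx
    have h1 : p.eval x = Real.sqrt x :=
      Lagrange.eval_interpolate_at_node (v := id) _ Function.injective_id.injOn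
        (hfin.mem_toFinset.2 hx)
    have h2 : 0 ≤ x := by
      obtain ⟨i, rfl⟩ := (hherm.spectrum_real_eq_range_eigenvalues ▸ hx :
        x ∈ Set.range hherm.eigenvalues)
      exact hpos.eigenvalues_nonneg i
    rw [h1, Real.mul_self_sqrt h2]
  have hsq : Polynomial.aeval (L a) (p * p) = L a := by
    rw [← cfc_polynomial (p * p) (L a) hsa]
    conv_rhs => rw [← cfc_id ℝ (L a) hsa]
    refine cfc_congr fun x hx => ?_
    simp [hpe x hx]
  refine ⟨Polynomial.aeval a p, ?_⟩
  have hstar : star (Polynomial.aeval a p) = Polynomial.aeval a p := by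
    rw [Polynomial.aeval_eq_sum_range, ← clStar_apply, map_sum]
    simp [clStar_apply, star_pow, ha]
  rw [hstar, ← map_mul]
  apply Algebra.leftMulMatrix_injective (clBasis n)
  rw [← hL, ← Polynomial.aeval_algHom_apply, hsq]

end Clifford

/-! ### The Clifford-valued inner product -/

section Inner

variable {n : ℕ} {H : Type*} [NormedAddCommGroup H] [InnerProductSpace ℝ H]

theorem rmul_apply (a : Cl n) (x : CModule n H) (γ : Finset (Fin n)) :
    rmul a x γ = ∑ α, (clBasis n).repr (clBasis n α * a) γ • x α := by
  simp [rmul]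

theorem cinner_add_left (x y z : CModule n H) : cinner (x + y) z = cinner x z + cinner y z := by
  simp [cinner, inner_add_left, add_smul, Finset.sum_add_distrib]

theorem star_cinner (x y : CModule n H) : star (cinner x y) = cinner y x := by
  simp only [cinner, ← clStar_apply, map_sum, map_smul]
  rw [Finset.sum_comm]
  simp only [clStar_apply, star_mul, star_star, real_inner_comm]

theorem cinner_add_right (x y z : CModule n H) : cinner x (y + z) = cinner x y + cinner x z := by
  rw [← star_cinner, cinner_add_left, star_add, star_cinner, star_cinner]

theorem cinner_neg_left (x y : CModule n H) : cinner (-x) y = -cinner x y := by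
  simp [cinner]

theorem cinner_rmul_left (a : Cl n) (x y : CModule n H) :
    cinner (rmul a x) y = cinner x y * a := by
  have h : ∀ β, ∑ α, (inner ℝ (rmul a x α) (y β) : ℝ) • (star (clBasis n β) * clBasis n α) =
      ∑ α, (inner ℝ (x α) (y β) : ℝ) • (star (clBasis n β) * clBasis n α * a) := by
    intro β
    simp only [rmul_apply, sum_inner, inner_smul_left, Finset.sum_smul]
    rw [Finset.sum_comm]
    refine Finset.sum_congr rfl fun α _ => ?_
    rw [mul_assoc]
    conv_rhs => rw [← (clBasis n).sum_repr (clBasis n α * a), Finset.mul_sum, Finset.smul_sum]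
    refine Finset.sum_congr rfl fun γ _ => ?_
    rw [mul_smul_comm, smul_smul, mul_comm]
    rfl
  simp only [cinner]
  rw [Finset.sum_comm]
  simp only [h, Finset.sum_mul, smul_mul_assoc]
  rw [Finset.sum_comm]

theorem cinner_rmul_right (a : Cl n) (x y : CModule n H) :
    cinner x (rmul a y) = star a * cinner x y := by
  rw [← star_cinner, cinner_rmul_left, star_mul, star_cinner]

theorem clRe_cinner (x y : CModule n H) : clRe (cinner x y) = inner ℝ x y := by
  simp [cinner, map_sum, clRe_star_clBasis_mul, PiLp.inner_apply]

/-- This turns each statement about the Clifford-valued inner product into statements about the real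
one. -/
theorem repr_cinner (x y : CModule n H) (γ : Finset (Fin n)) :
    (clBasis n).repr (cinner x y) γ = inner ℝ x (rmul (clBasis n γ) y) := by
  rw [← clRe_cinner, cinner_rmul_right, clRe_star_mul]

theorem inner_rmul_left (a : Cl n) (x y : CModule n H) :
    (inner ℝ (rmul a x) y : ℝ) = inner ℝ x (rmul (star a) y) := by
  rw [← clRe_cinner, ← clRe_cinner, cinner_rmul_left, cinner_rmul_right, star_star, clRe_mul_comm]

theorem clPosSemidef_cinner_self (x : CModule n H) : ClPosSemidef (cinner x x) := by
  refine clPosSemidef_of_nonneg (star_cinner x x) fun b => ?_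
  rw [mul_assoc, ← cinner_rmul_left, ← cinner_rmul_right, clRe_cinner]
  exact real_inner_self_nonneg

theorem rmul_rmul (a b : Cl n) (x : CModule n H) : rmul a (rmul b x) = rmul (b * a) x := by
  refine ext_inner_right ℝ fun y => ?_
  rw [← clRe_cinner, ← clRe_cinner, cinner_rmul_left, cinner_rmul_left, cinner_rmul_left, mul_assoc]

theorem rmul_neg (a : Cl n) (x : CModule n H) : rmul (-a) x = -rmul a x := by
  refine ext_inner_right ℝ fun y => ?_
  rw [← clRe_cinner, ← clRe_cinner, cinner_neg_left, cinner_rmul_left, cinner_rmul_left, mul_neg]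

theorem rmul_one (x : CModule n H) : rmul (1 : Cl n) x = x := by
  refine ext_inner_right ℝ fun y => ?_
  rw [← clRe_cinner, ← clRe_cinner, cinner_rmul_left, mul_one]

/-! ### Adjoints -/

/-- The real relation, applied to `y e_γ` in place of `y`, gives the component at `γ`, since `S` is
right linear. -/
theorem isAdjointOf_iff {S T : BOp n H} :
    IsAdjointOf S T ↔ ∀ x y : CModule n H, (inner ℝ (T.1 x) y : ℝ) = inner ℝ x (S.1 y) := by
  constructor
  · intro h x y
    rw [← clRe_cinner, ← clRe_cinner, h]
  · intro h x y
    refine (clBasis n).ext_elem fun γ => ?_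
    rw [repr_cinner, repr_cinner, h, S.2]

theorem isAdjointOf_iff_star [CompleteSpace H] {S T : BOp n H} :
    IsAdjointOf S T ↔ S.1 = star T.1 := by
  rw [isAdjointOf_iff, ContinuousLinearMap.star_eq_adjoint, ContinuousLinearMap.eq_adjoint_iff]
  constructor
  · intro h x y
    rw [real_inner_comm, ← h, real_inner_comm]
  · intro h x y
    rw [real_inner_comm, ← h, real_inner_comm]

theorem isSelfAdj_iff [CompleteSpace H] {T : BOp n H} : IsSelfAdj T ↔ IsSelfAdjoint T.1 :=
  isAdjointOf_iff_star.trans eq_comm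

theorem isPositiveOp_of_eq_mul_self {T S : BOp n H} (hS : IsSelfAdj S) (h : T = S * S) :
    IsPositiveOp T := by
  intro x
  have : cinner (T.1 x) x = cinner (S.1 x) (S.1 x) := by rw [h]; exact hS _ _
  rw [this]
  exact clPosSemidef_cinner_self _

/-- The hypothesis makes `q` annihilate all commutators. For `n ≥ 2`, the commutator of two distinct
units is an invertible multiple of their product; for `n = 1` the algebra is commutative and `ē =
-e` gives `2 q e = 0`. -/
theorem eq_zero_of_star_mul_eq {n : ℕ} (hn : n ≠ 0) {q : Cl n}
    (h : ∀ a : Cl n, star a * q = q * a) : q = 0 := by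
  have hcancel : ∀ i : Fin n, q * gen n i = 0 → q = 0 := by
    intro i hi
    have h1 : q * gen n i * gen n i = 0 := by rw [hi, zero_mul]
    rw [mul_assoc, gen_mul_self, mul_neg_one, neg_eq_zero] at h1
    exact h1
  have hcomm : ∀ a b : Cl n, q * (a * b) = q * (b * a) := by
    intro a b
    rw [← h, star_mul, mul_assoc, h a, ← mul_assoc, h b, mul_assoc]
  have i0 : Fin n := ⟨0, Nat.pos_of_ne_zero hn⟩
  by_cases hs : ∃ j, j ≠ i0
  · obtain ⟨j, hj⟩ := hs
    have h1 := hcomm (gen n j) (gen n i0)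
    rw [gen_mul_gen_of_ne hj, mul_neg, neg_eq_iff_add_eq_zero, ← two_smul ℝ] at h1
    have h2 := (smul_eq_zero.1 h1).resolve_left two_ne_zero
    rw [← mul_assoc] at h2
    have h3 : q * gen n i0 * gen n j * gen n j = 0 := by rw [h2, zero_mul]
    rw [mul_assoc, gen_mul_self, mul_neg_one, neg_eq_zero] at h3
    exact hcancel i0 h3
  · push Not at hs
    have hc : ∀ a : Cl n, a * gen n i0 = gen n i0 * a := by
      have : LinearMap.mulRight ℝ (gen n i0) = LinearMap.mulLeft ℝ (gen n i0) := by
        refine (clBasis n).ext fun α => ?_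
        rw [clBasis_apply]
        refine (Commute.list_prod_right _ _ fun y hy => ?_).eq.symm
        obtain ⟨j, -, rfl⟩ := List.mem_map.1 hy
        rw [hs j]
        exact Commute.refl _
      exact LinearMap.congr_fun this
    have h1 := h (gen n i0)
    rw [star_gen, hc, neg_mul, neg_eq_iff_add_eq_zero, ← two_smul ℝ] at h1
    have h2 := (smul_eq_zero.1 h1).resolve_left two_ne_zero
    exact hcancel i0 (by rw [hc, h2])

theorem sub_eq_neg_sub_of_add_eq {G : Type*} [AddCommGroup G] {a b c d e f : G}
    (h : a + b + (c + d) = a + e + (f + d)) : b - e = -(c - f) := by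
  rw [← sub_eq_zero] at h ⊢
  rw [← h]
  abel

/-- The defect `q(x, y) = ⟨T x, y⟩ - ⟨x, T y⟩` vanishes on the diagonal because `b b̄` is
self-conjugate, so it is skew. Comparing `q(x, y a) = ā q(x, y)` with `q(y a, x) = q(y, x) a` gives
`ā q = q a` for all `a`, and hence `q = 0`. In the real case `n = 0`, a nonzero skew operator is
positive without being self-adjoint. -/
theorem IsPositiveOp.isSelfAdj (hn : n ≠ 0) {T : BOp n H} (h : IsPositiveOp T) :
    IsSelfAdj T := by
  have hdiag : ∀ x, cinner (T.1 x) x = cinner x (T.1 x) := by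
    intro x
    obtain ⟨b, hb⟩ := h x
    rw [← star_cinner (T.1 x), hb, star_mul, star_star]
  have hskew : ∀ x y, cinner (T.1 x) y - cinner x (T.1 y) =
      -(cinner (T.1 y) x - cinner y (T.1 x)) := by
    intro x y
    have h1 := hdiag (x + y)
    rw [map_add, cinner_add_left, cinner_add_right, cinner_add_left, cinner_add_right,
      cinner_add_right x, cinner_add_right y, hdiag x, hdiag y] at h1
    exact sub_eq_neg_sub_of_add_eq h1
  intro x y
  refine sub_eq_zero.1 (eq_zero_of_star_mul_eq hn fun a => ?_)
  have h1 := hskew x (rmul a y)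
  rw [T.2, cinner_rmul_right, cinner_rmul_right, cinner_rmul_left, cinner_rmul_left, ← mul_sub,
    ← sub_mul] at h1
  rw [h1, hskew x y, neg_mul]

/-! ### The eigenspaces of an imaginary operator -/

/-- For `n = 0` there are no imaginary directions, so the mere presence of `I` excludes the real
case. -/
theorem ne_zero_of_mem_unitSphere {I : EuclideanSpace ℝ (Fin (n + 1))} (hI : I ∈ unitSphere n) :
    n ≠ 0 := by
  rintro rfl
  have h0 : I = 0 := by
    ext i
    rw [Fin.fin_one_eq_zero i]
    exact hI.1
  have := hI.2
  simp [h0] at this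

theorem toCl_of_mem_unitSphere {I : EuclideanSpace ℝ (Fin (n + 1))} (hI : I ∈ unitSphere n) :
    toCl I = CliffordAlgebra.ι (negForm n) fun i => I i.succ := by
  have h1 : (fun i : Fin n => I i.succ) =
      ∑ i, I i.succ • (Pi.single i 1 : Fin n → ℝ) := by
    ext j
    simp [Pi.single_apply]
  rw [toCl, hI.1, h1, map_sum]
  simp [gen]

theorem star_toCl {I : EuclideanSpace ℝ (Fin (n + 1))} (hI : I ∈ unitSphere n) :
    star (toCl I) = -toCl I := by
  rw [toCl_of_mem_unitSphere hI, CliffordAlgebra.star_ι]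

theorem toCl_mul_self {I : EuclideanSpace ℝ (Fin (n + 1))} (hI : I ∈ unitSphere n) :
    toCl I * toCl I = -1 := by
  have h1 : negForm n (fun i => I i.succ) = -1 := by
    have h2 := EuclideanSpace.real_norm_sq_eq I
    rw [hI.2, Fin.sum_univ_succ, hI.1] at h2
    rw [QuadraticMap.weightedSumSquares_apply]
    simp only [smul_eq_mul, neg_one_mul, Finset.sum_neg_distrib, ← pow_two]
    linarith
  rw [toCl_of_mem_unitSphere hI, CliffordAlgebra.ι_sq_scalar, h1, map_neg, map_one]

theorem norm_sq_slice {I : EuclideanSpace ℝ (Fin (n + 1))} (hI : I ∈ unitSphere n) (z : ℂ) :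
    ‖slice I z‖ ^ 2 = z.re ^ 2 + z.im ^ 2 := by
  have h2 := EuclideanSpace.real_norm_sq_eq I
  rw [hI.2, Fin.sum_univ_succ, hI.1] at h2
  rw [EuclideanSpace.real_norm_sq_eq, Fin.sum_univ_succ]
  simp [slice, hI.1, mul_pow, ← Finset.mul_sum]
  nlinarith

theorem slice_zero {I : EuclideanSpace ℝ (Fin (n + 1))} (hI : I ∈ unitSphere n) (z : ℂ) :
    slice I z 0 = z.re := by
  simp [slice, hI.1]

/-- The orthogonal projections onto the spaces `ℋ_±(J, I)` add up to the identity. -/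
theorem starProjection_add_starProjection [CompleteSpace H] {J : BOp n H} (hJ : IsImaginary J)
    {I : EuclideanSpace ℝ (Fin (n + 1))} (hI : I ∈ unitSphere n) (x : CModule n H) :
    (plusSpace J I).starProjection x + (minusSpace J I).starProjection x = x := by
  set R : CModule n H →L[ℝ] CModule n H := rmul (toCl I) with hR
  have hRR : ∀ x, R (R x) = -x := by
    intro x; rw [hR, rmul_rmul, toCl_mul_self hI, rmul_neg, rmul_one]
  have hJJ : ∀ x, J.1 (J.1 x) = -x := by
    intro x
    have h1 : -(J.1 (J.1 x)) = x := congrArg (fun S : BOp n H => S.1 x) hJ.2.2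
    rw [← neg_eq_iff_eq_neg, h1]
  have hJR : ∀ x, J.1 (R x) = R (J.1 x) := fun x => J.2 _ _
  have hJa : ∀ x y, inner ℝ (J.1 x) y = -inner ℝ x (J.1 y) := by
    intro x y
    rw [isAdjointOf_iff.1 hJ.1, ← inner_neg_right]; rfl
  have hRa : ∀ x y, inner ℝ (R x) y = -inner ℝ x (R y) := by
    intro x y
    rw [hR, inner_rmul_left, star_toCl hI, rmul_neg, inner_neg_right]
  have hplus : ∀ y, y ∈ plusSpace J I ↔ J.1 y = R y := fun y => Iff.rfl
  have hminus : ∀ y, y ∈ minusSpace J I ↔ J.1 y = -R y := fun y => by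
    rw [hR, ← rmul_neg]; rfl
  -- Both `J` and `R` are isometric. Replacing `J y` by `R y` and `J z` by `-R z` therefore gives
  -- `⟨y, z⟩ = -⟨y, z⟩`.
  have horth : ∀ y ∈ plusSpace J I, ∀ z ∈ minusSpace J I, inner ℝ y z = (0 : ℝ) := by
    intro y hy z hz
    have h1 := hJa y (J.1 z)
    have h2 := hRa y (R z)
    rw [hplus] at hy
    rw [hminus] at hz
    rw [hJJ, inner_neg_right, neg_neg] at h1
    rw [hRR, inner_neg_right, neg_neg, ← hy] at h2
    rw [hz, inner_neg_right, h2] at h1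
    linarith
  -- Since `J` and `R` commute and both square to `-1`, `J R` is an involution. The plus and minus
  -- spaces are its eigenspaces for `-1` and `1`, with projections `(1 ∓ J R)/2`.
  have hp : (plusSpace J I).starProjection x = (2⁻¹ : ℝ) • (x - J.1 (R x)) := by
    refine Submodule.eq_starProjection_of_mem_of_inner_eq_zero ?_ ?_
    · rw [hplus, map_smul, map_smul, map_sub, map_sub, hJJ, ← hJR, hRR, map_neg]
      congr 1
      abel
    · intro w hw
      have : x - (2⁻¹ : ℝ) • (x - J.1 (R x)) ∈ minusSpace J I := by
        rw [hminus]
        simp only [map_sub, map_smul, hJJ, ← hJR, hRR, map_neg]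
        module
      rw [real_inner_comm]
      exact horth w hw _ this
  have hm : (minusSpace J I).starProjection x = (2⁻¹ : ℝ) • (x + J.1 (R x)) := by
    refine Submodule.eq_starProjection_of_mem_of_inner_eq_zero ?_ ?_
    · rw [hminus]
      simp only [map_add, map_smul, hJJ, ← hJR, hRR, map_neg]
      module
    · intro w hw
      have : x - (2⁻¹ : ℝ) • (x + J.1 (R x)) ∈ plusSpace J I := by
        rw [hplus]
        simp only [map_sub, map_add, map_smul, hJJ, ← hJR, hRR, map_neg]
        module
      exact horth _ this w hw
  rw [hp, hm]
  module

theorem map_starProjection_plusSpace [CompleteSpace H] (J : BOp n H)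
    (I : EuclideanSpace ℝ (Fin (n + 1))) (x : CModule n H) :
    J.1 ((plusSpace J I).starProjection x) =
      rmul (toCl I) ((plusSpace J I).starProjection x) :=
  Submodule.starProjection_apply_mem (plusSpace J I) x

theorem map_starProjection_minusSpace [CompleteSpace H] (J : BOp n H)
    (I : EuclideanSpace ℝ (Fin (n + 1))) (x : CModule n H) :
    J.1 ((minusSpace J I).starProjection x) =
      rmul (-toCl I) ((minusSpace J I).starProjection x) :=
  Submodule.starProjection_apply_mem (minusSpace J I) x

end Inner

/-! ### Bounded measurable real functions -/

theorem tendstoUniformly_of_abs_sub_le {Ω : Type*} {g : Ω → ℝ} {s : ℕ → Ω → ℝ} {c : ℝ}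
    (h : ∀ k z, |s k z - g z| ≤ c * (1 / ((k : ℝ) + 1))) : TendstoUniformly s g atTop := by
  rw [Metric.tendstoUniformly_iff]
  intro ε hε
  have h0 := (tendsto_one_div_add_atTop_nhds_zero_nat (𝕜 := ℝ)).const_mul c
  rw [mul_zero] at h0
  filter_upwards [h0.eventually (gt_mem_nhds hε)] with k hk z
  rw [dist_comm, Real.dist_eq]
  exact (h k z).trans_lt hk

section BddMeas

variable {Ω : Type*} [MeasurableSpace Ω]

/-- Bounded measurable real functions. -/
def RealBddMeas (g : Ω → ℝ) : Prop := Measurable g ∧ ∃ C : ℝ, ∀ z, |g z| ≤ C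

namespace RealBddMeas

variable {f g : Ω → ℝ}

theorem exists_bound (hf : RealBddMeas f) : ∃ C : ℝ, 0 ≤ C ∧ ∀ z, |f z| ≤ C := by
  obtain ⟨-, C, hC⟩ := hf
  exact ⟨|C|, abs_nonneg C, fun z => (hC z).trans (le_abs_self C)⟩

theorem const (c : ℝ) : RealBddMeas fun _ : Ω => c := ⟨measurable_const, |c|, fun _ => le_rfl⟩

theorem add (hf : RealBddMeas f) (hg : RealBddMeas g) : RealBddMeas fun z => f z + g z := by
  obtain ⟨hfm, C, hC⟩ := hf
  obtain ⟨hgm, D, hD⟩ := hg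
  exact ⟨hfm.add hgm, C + D, fun z => (abs_add_le _ _).trans (add_le_add (hC z) (hD z))⟩

theorem mul (hf : RealBddMeas f) (hg : RealBddMeas g) : RealBddMeas fun z => f z * g z := by
  obtain ⟨C, hC0, hC⟩ := hf.exists_bound
  obtain ⟨hgm, D, hD⟩ := hg
  exact ⟨hf.1.mul hgm, C * D, fun z => (abs_mul _ _).trans_le
    (mul_le_mul (hC z) (hD z) (abs_nonneg _) hC0)⟩

theorem neg (hf : RealBddMeas f) : RealBddMeas fun z => -f z := by
  simpa using (const (-1)).mul hf

theorem sub (hf : RealBddMeas f) (hg : RealBddMeas g) : RealBddMeas fun z => f z - g z := by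
  simpa only [sub_eq_add_neg] using hf.add hg.neg

theorem indicator_one {M : Set Ω} (hM : MeasurableSet M) :
    RealBddMeas (M.indicator fun _ => (1 : ℝ)) := by
  refine ⟨measurable_const.indicator hM, 1, fun z => ?_⟩
  by_cases hz : z ∈ M <;> simp [hz]

theorem simpleFunc (s : SimpleFunc Ω ℝ) : RealBddMeas s := by
  obtain ⟨C, hC⟩ := s.exists_forall_norm_le
  exact ⟨s.measurable, C, hC⟩

theorem sqrt (hf : RealBddMeas f) : RealBddMeas fun z => √(f z) := by
  obtain ⟨hfm, C, hC⟩ := hf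
  refine ⟨hfm.sqrt, √C, fun z => ?_⟩
  rw [abs_of_nonneg (Real.sqrt_nonneg _)]
  exact Real.sqrt_le_sqrt ((le_abs_self _).trans (hC z))

/-- A bounded measurable function is the uniform limit of simple functions. -/
theorem exists_simpleFunc (hg : RealBddMeas g) :
    ∃ s : ℕ → SimpleFunc Ω ℝ, ∀ k z, |s k z - g z| ≤ 1 / ((k : ℝ) + 1) := by
  obtain ⟨hgm, C, hC⟩ := hg
  have key : ∀ k : ℕ, ∃ s : SimpleFunc Ω ℝ, ∀ z, |s z - g z| ≤ 1 / ((k : ℝ) + 1) := by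
    intro k
    have hk : (0 : ℝ) < (k : ℝ) + 1 := by positivity
    -- Rounding down to the grid of mesh `1/(k+1)` costs at most the mesh; boundedness leaves only
    -- finitely many grid points.
    have hm : Measurable fun z => (⌊((k : ℝ) + 1) * g z⌋ : ℝ) / ((k : ℝ) + 1) :=
      ((measurable_from_top (f := fun i : ℤ => (i : ℝ))).comp
        (hgm.const_mul _).floor).div_const _
    refine ⟨⟨fun z => (⌊((k : ℝ) + 1) * g z⌋ : ℝ) / ((k : ℝ) + 1),
      fun x => hm (measurableSet_singleton x), ?_⟩, fun z => ?_⟩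
    · refine ((Set.finite_Icc ⌊((k : ℝ) + 1) * -C⌋ ⌊((k : ℝ) + 1) * C⌋).image
        (fun i : ℤ => (i : ℝ) / ((k : ℝ) + 1))).subset ?_
      rintro _ ⟨z, rfl⟩
      have := abs_le.1 (hC z)
      exact ⟨⌊((k : ℝ) + 1) * g z⌋, ⟨Int.floor_mono (by gcongr; exact this.1),
        Int.floor_mono (by gcongr; exact this.2)⟩, rfl⟩
    · change |(⌊((k : ℝ) + 1) * g z⌋ : ℝ) / ((k : ℝ) + 1) - g z| ≤ _
      have h1 := Int.floor_le (((k : ℝ) + 1) * g z)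
      have h2 := (Int.lt_floor_add_one (((k : ℝ) + 1) * g z)).le
      rw [div_sub' hk.ne', abs_div, abs_of_pos hk]
      gcongr
      rw [abs_le]
      constructor <;> linarith
  choose s hs using key
  exact ⟨s, hs⟩

end RealBddMeas

end BddMeas

/-! ### Spectral measures and real integrals in a real Hilbert space -/

/-- A projection-valued measure on `Ω` with values in the operators on `K`. -/
structure ProjMeasure (Ω K : Type*) [MeasurableSpace Ω] [NormedAddCommGroup K]
    [InnerProductSpace ℝ K] [CompleteSpace K] where
  toFun : Set Ω → K →L[ℝ] K
  selfAdj : ∀ M, MeasurableSet M → IsSelfAdjoint (toFun M)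
  idem : ∀ M, MeasurableSet M → toFun M * toFun M = toFun M
  univ : toFun Set.univ = 1
  iUnion : ∀ M : ℕ → Set Ω, (∀ i, MeasurableSet (M i)) → Pairwise (Function.onFun Disjoint M) →
    ∀ x : K, HasSum (fun i => toFun (M i) x) (toFun (⋃ i, M i) x)

section ProjMeasure

variable {Ω K : Type*} [MeasurableSpace Ω] [NormedAddCommGroup K] [InnerProductSpace ℝ K]
  [CompleteSpace K]

theorem inner_eq_of_isSelfAdjoint {S : K →L[ℝ] K} (hS : IsSelfAdjoint S) (x y : K) :
    (inner ℝ (S x) y : ℝ) = inner ℝ x (S y) := by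
  have h : ContinuousLinearMap.adjoint S = S := hS
  conv_lhs => rw [← h]
  exact ContinuousLinearMap.adjoint_inner_left S y x

theorem norm_sq_apply_of_isSelfAdjoint {S : K →L[ℝ] K} (hS : IsSelfAdjoint S) (x : K) :
    ‖S x‖ ^ 2 = inner ℝ ((S * S) x) x := by
  rw [← real_inner_self_eq_norm_sq, inner_eq_of_isSelfAdjoint hS, real_inner_comm]
  rfl

namespace ProjMeasure

instance : CoeFun (ProjMeasure Ω K) (fun _ => Set Ω → K →L[ℝ] K) := ⟨ProjMeasure.toFun⟩

variable (P : ProjMeasure Ω K)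

theorem apply_empty : P ∅ = 0 := by
  ext x
  have h := P.iUnion (fun _ => ∅) (fun _ => MeasurableSet.empty)
    (fun _ _ _ => by simp [Function.onFun]) x
  exact (summable_const_iff _).1 h.summable

open Classical in
/-- The signed measure `M ↦ φ (P(M) x)`. -/
def signedMeasure (φ : K →L[ℝ] ℝ) (x : K) : SignedMeasure Ω where
  measureOf' M := if MeasurableSet M then φ (P M x) else 0
  empty' := by simp [P.apply_empty]
  not_measurable' _ h := if_neg h
  m_iUnion' := by
    intro M hM hd
    simp only [hM, MeasurableSet.iUnion hM, if_true]
    exact (P.iUnion M hM hd x).mapL φ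

theorem signedMeasure_apply (φ : K →L[ℝ] ℝ) (x : K) {M : Set Ω} (hM : MeasurableSet M) :
    P.signedMeasure φ x M = φ (P M x) := if_pos hM

theorem apply_union {M N : Set Ω} (hM : MeasurableSet M) (hN : MeasurableSet N)
    (h : Disjoint M N) : P (M ∪ N) = P M + P N := by
  ext x
  refine ext_inner_left ℝ fun y => ?_
  have := VectorMeasure.of_union (v := P.signedMeasure (innerSL ℝ y) x) h hM hN
  rwa [signedMeasure_apply _ _ _ (hM.union hN), signedMeasure_apply _ _ _ hM,
    signedMeasure_apply _ _ _ hN, ← map_add] at this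

/-- Idempotence of the sum gives `pq + qp = 0`. Multiplying by `p` on the left and on the right
gives `pq = -pqp = qp`, so `2pq = 0`. -/
theorem mul_eq_zero_of_disjoint {M N : Set Ω} (hM : MeasurableSet M) (hN : MeasurableSet N)
    (h : Disjoint M N) : P M * P N = 0 := by
  have h1 := P.idem _ (hM.union hN)
  rw [P.apply_union hM hN h, add_mul, mul_add, mul_add, P.idem M hM, P.idem N hN] at h1
  have h2 : P M * P N + P N * P M = 0 := by
    have := sub_eq_zero.2 h1
    rw [← this]; abel
  have h3 : P M * P N + P M * P N * P M = 0 := by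
    have := congrArg (P M * ·) h2
    simpa only [mul_add, ← mul_assoc, P.idem M hM, mul_zero] using this
  have h4 : P M * P N * P M + P N * P M = 0 := by
    have := congrArg (· * P M) h2
    simpa only [add_mul, mul_assoc, P.idem M hM, zero_mul] using this
  have h5 : P M * P N = P N * P M := by
    have := h3.trans h4.symm
    rw [add_comm] at this
    exact add_left_cancel this
  rw [← h5, ← two_smul ℝ] at h2
  exact (smul_eq_zero.1 h2).resolve_left two_ne_zero

theorem apply_inter {M N : Set Ω} (hM : MeasurableSet M) (hN : MeasurableSet N) :
    P (M ∩ N) = P M * P N := by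
  have h1 : P M = P (M ∩ N) + P (M \ N) := by
    rw [← P.apply_union (hM.inter hN) (hM.diff hN) Set.disjoint_sdiff_inter.symm,
      Set.inter_union_sdiff]
  have h2 : P N = P (M ∩ N) + P (N \ M) := by
    rw [← P.apply_union (hM.inter hN) (hN.diff hM)
      (Set.inter_comm M N ▸ Set.disjoint_sdiff_inter.symm), Set.inter_comm, Set.inter_union_sdiff]
  rw [h1, h2, add_mul, mul_add, mul_add, P.idem _ (hM.inter hN),
    P.mul_eq_zero_of_disjoint (hM.inter hN) (hN.diff hM)
      (Set.disjoint_sdiff_right.mono_left Set.inter_subset_left),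
    P.mul_eq_zero_of_disjoint (hM.diff hN) (hM.inter hN) Set.disjoint_sdiff_inter,
    P.mul_eq_zero_of_disjoint (hM.diff hN) (hN.diff hM)
      (Set.disjoint_sdiff_left.mono_right Set.sdiff_subset)]
  simp

/-! #### Simple functions -/

theorem apply_preimage_finset {G : Type*} (f : SimpleFunc Ω G) (S : Finset G) :
    P (f ⁻¹' S) = ∑ c ∈ S, P (f ⁻¹' {c}) := by
  classical
  induction S using Finset.induction_on with
  | empty => simp [P.apply_empty]
  | insert c S hc ih =>
    rw [Finset.sum_insert hc, ← ih, Finset.coe_insert, Set.insert_eq, Set.preimage_union,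
      P.apply_union (f.measurableSet_preimage _) (f.measurableSet_preimage _)]
    exact Disjoint.preimage _ (by simpa using hc)

/-- The integral of a real simple function. -/
def simple (s : SimpleFunc Ω ℝ) : K →L[ℝ] K := ∑ c ∈ s.range, c • P (s ⁻¹' {c})

/-- The integral of a composite may be computed on the level sets of the inner function. With a pair
as inner function this is the common refinement, and sums and products are then compared piece by
piece. -/
theorem simple_map {G : Type*} (f : SimpleFunc Ω G) (g : G → ℝ) :
    P.simple (f.map g) = ∑ c ∈ f.range, g c • P (f ⁻¹' {c}) := by
  classical
  rw [simple, SimpleFunc.range_map]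
  refine Finset.sum_image' _ fun c _ => ?_
  rw [SimpleFunc.map_preimage_singleton, P.apply_preimage_finset, Finset.smul_sum]
  refine Finset.sum_congr rfl fun d hd => ?_
  rw [(Finset.mem_filter.1 hd).2]

theorem simple_const (c : ℝ) : P.simple (SimpleFunc.const Ω c) = c • 1 := by
  have h := P.simple_map (SimpleFunc.const Ω c) (fun _ => c)
  rw [← Finset.smul_sum, ← P.apply_preimage_finset] at h
  have h1 : (SimpleFunc.const Ω c) ⁻¹' ((SimpleFunc.const Ω c).range : Set ℝ) = Set.univ := by
    rw [SimpleFunc.coe_range, Set.preimage_range]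
  rwa [h1, P.univ] at h

theorem simple_add (f g : SimpleFunc Ω ℝ) : P.simple (f + g) = P.simple f + P.simple g := by
  have h1 := P.simple_map (f.pair g) Prod.fst
  have h2 := P.simple_map (f.pair g) Prod.snd
  rw [SimpleFunc.map_fst_pair] at h1
  rw [SimpleFunc.map_snd_pair] at h2
  have h3 : f + g = (f.pair g).map fun p => p.1 + p.2 := rfl
  rw [h3, h1, h2, P.simple_map, ← Finset.sum_add_distrib]
  simp only [add_smul]

theorem simple_mul (f g : SimpleFunc Ω ℝ) : P.simple (f * g) = P.simple f * P.simple g := by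
  have h1 := P.simple_map (f.pair g) Prod.fst
  have h2 := P.simple_map (f.pair g) Prod.snd
  rw [SimpleFunc.map_fst_pair] at h1
  rw [SimpleFunc.map_snd_pair] at h2
  have h3 : f * g = (f.pair g).map fun p => p.1 * p.2 := rfl
  rw [h3, h1, h2, P.simple_map, Finset.sum_mul_sum]
  refine Finset.sum_congr rfl fun p hp => ?_
  rw [Finset.sum_eq_single p]
  · rw [smul_mul_smul_comm, P.idem _ ((f.pair g).measurableSet_preimage _)]
  · intro q _ hq
    rw [smul_mul_smul_comm, P.mul_eq_zero_of_disjoint ((f.pair g).measurableSet_preimage _)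
      ((f.pair g).measurableSet_preimage _) (Disjoint.preimage _ (by simpa using hq.symm)),
      smul_zero]
  · exact fun h => absurd hp h

theorem isSelfAdjoint_simple (s : SimpleFunc Ω ℝ) : IsSelfAdjoint (P.simple s) := by
  rw [IsSelfAdjoint, simple, star_sum]
  refine Finset.sum_congr rfl fun c _ => ?_
  rw [star_smul, star_trivial, (P.selfAdj _ (s.measurableSet_preimage _)).star_eq]

theorem norm_simple_le (s : SimpleFunc Ω ℝ) {C : ℝ} (hC : 0 ≤ C) (h : ∀ z, |s z| ≤ C) :
    ‖P.simple s‖ ≤ C := by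
  refine ContinuousLinearMap.opNorm_le_bound _ hC fun x => ?_
  -- The complementary function satisfies `s² + t² = C²`, so `‖s x‖² + ‖t x‖² = C² ‖x‖²`, and the
  -- bound follows by dropping the second term.
  set t := s.map fun c => √(C ^ 2 - c ^ 2) with ht
  have h1 : s * s + t * t = SimpleFunc.const Ω (C ^ 2) := by
    ext z
    have h2 : s z ^ 2 ≤ C ^ 2 := sq_le_sq' (abs_le.1 (h z)).1 (abs_le.1 (h z)).2
    change s z * s z + √(C ^ 2 - s z ^ 2) * √(C ^ 2 - s z ^ 2) = C ^ 2
    rw [Real.mul_self_sqrt (by linarith)]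
    ring
  have h2 : P.simple s * P.simple s + P.simple t * P.simple t = C ^ 2 • 1 := by
    rw [← simple_mul, ← simple_mul, ← simple_add, h1, simple_const]
  have h3 : ‖P.simple s x‖ ^ 2 + ‖P.simple t x‖ ^ 2 = (C * ‖x‖) ^ 2 := by
    rw [norm_sq_apply_of_isSelfAdjoint (P.isSelfAdjoint_simple s),
      norm_sq_apply_of_isSelfAdjoint (P.isSelfAdjoint_simple t), ← inner_add_left,
      ← add_apply, h2, smul_apply, inner_smul_left,
      one_apply_eq_self, real_inner_self_eq_norm_sq]
    simp [mul_pow]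
  refine le_of_sq_le_sq ?_ (by positivity)
  nlinarith [sq_nonneg ‖P.simple t x‖]

theorem simple_sub (f g : SimpleFunc Ω ℝ) : P.simple (f - g) = P.simple f - P.simple g := by
  rw [eq_sub_iff_add_eq, ← simple_add, sub_add_cancel]

/-! #### Bounded functions -/

/-- A uniform error estimate against every simple function is stronger than convergence along one
sequence: the integral is then independent of the approximation. -/
theorem exists_integral {g : Ω → ℝ} (hg : RealBddMeas g) :
    ∃ L : K →L[ℝ] K, ∀ (s : SimpleFunc Ω ℝ) (ε : ℝ), 0 ≤ ε → (∀ z, |s z - g z| ≤ ε) →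
      ‖P.simple s - L‖ ≤ ε := by
  obtain ⟨s, hs⟩ := hg.exists_simpleFunc
  have hnn : ∀ k : ℕ, (0 : ℝ) ≤ 1 / ((k : ℝ) + 1) := fun k => by positivity
  have key : ∀ (t : SimpleFunc Ω ℝ) (ε : ℝ), 0 ≤ ε → (∀ z, |t z - g z| ≤ ε) → ∀ k,
      ‖P.simple t - P.simple (s k)‖ ≤ ε + 1 / ((k : ℝ) + 1) := by
    intro t ε hε ht k
    rw [← simple_sub]
    refine P.norm_simple_le _ (add_nonneg hε (hnn k)) fun z => ?_
    have e : (t - s k) z = (t z - g z) - (s k z - g z) := by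
      rw [SimpleFunc.coe_sub, Pi.sub_apply]; ring
    rw [e]
    exact (abs_sub _ _).trans (add_le_add (ht z) (hs k z))
  have hlim := tendsto_one_div_add_atTop_nhds_zero_nat (𝕜 := ℝ)
  have hc : CauchySeq fun k => P.simple (s k) := by
    refine cauchySeq_of_le_tendsto_0 (fun k : ℕ => 1 / ((k : ℝ) + 1) + 1 / ((k : ℝ) + 1))
      (fun k l N hk hl => ?_) (by simpa using hlim.add hlim)
    rw [dist_eq_norm]
    refine (key (s k) _ (hnn k) (hs k) l).trans (add_le_add ?_ ?_)
    · exact one_div_le_one_div_of_le (by positivity) (by exact_mod_cast Nat.succ_le_succ hk)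
    · exact one_div_le_one_div_of_le (by positivity) (by exact_mod_cast Nat.succ_le_succ hl)
  obtain ⟨L, hL⟩ := cauchySeq_tendsto_of_complete hc
  refine ⟨L, fun t ε hε ht => ?_⟩
  refine le_of_tendsto_of_tendsto (tendsto_const_nhds.sub hL).norm
    (by simpa using tendsto_const_nhds.add hlim) (Eventually.of_forall (key t ε hε ht))

open Classical in
/-- The integral `∫ g dP` of a bounded measurable real function. -/
def integral (g : Ω → ℝ) : K →L[ℝ] K :=
  if h : RealBddMeas g then (P.exists_integral h).choose else 0

variable {P} {f g : Ω → ℝ}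

theorem norm_simple_sub_integral_le (hg : RealBddMeas g) (s : SimpleFunc Ω ℝ) {ε : ℝ} (hε : 0 ≤ ε)
    (h : ∀ z, |s z - g z| ≤ ε) : ‖P.simple s - P.integral g‖ ≤ ε := by
  rw [integral, dif_pos hg]
  exact (P.exists_integral hg).choose_spec s ε hε h

theorem tendsto_simple_integral (hg : RealBddMeas g) {s : ℕ → SimpleFunc Ω ℝ}
    (h : TendstoUniformly (fun k z => s k z) g atTop) :
    Tendsto (fun k => P.simple (s k)) atTop (𝓝 (P.integral g)) := by
  rw [Metric.tendsto_atTop]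
  intro ε hε
  rw [Metric.tendstoUniformly_iff] at h
  obtain ⟨N, hN⟩ := eventually_atTop.1 (h (ε / 2) (half_pos hε))
  refine ⟨N, fun k hk => ?_⟩
  rw [dist_eq_norm]
  refine (norm_simple_sub_integral_le hg (s k) (half_pos hε).le fun z => ?_).trans_lt
    (half_lt_self hε)
  have := hN k hk z
  rw [dist_comm, Real.dist_eq] at this
  exact this.le

theorem exists_tendsto_simple (P : ProjMeasure Ω K) (hg : RealBddMeas g) :
    ∃ s : ℕ → SimpleFunc Ω ℝ, (∀ k z, |s k z - g z| ≤ 1 / ((k : ℝ) + 1)) ∧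
      Tendsto (fun k => P.simple (s k)) atTop (𝓝 (P.integral g)) := by
  obtain ⟨s, hs⟩ := hg.exists_simpleFunc
  exact ⟨s, hs, tendsto_simple_integral hg
    (tendstoUniformly_of_abs_sub_le (c := 1) (by simpa using hs))⟩

theorem integral_simpleFunc (s : SimpleFunc Ω ℝ) : P.integral s = P.simple s := by
  have := norm_simple_sub_integral_le (P := P) (RealBddMeas.simpleFunc s) s le_rfl (by simp)
  exact (sub_eq_zero.1 (norm_le_zero_iff.1 this)).symm

theorem integral_const (c : ℝ) : P.integral (fun _ => c) = c • 1 := by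
  rw [← P.simple_const, ← integral_simpleFunc]; rfl

theorem integral_indicator {M : Set Ω} (hM : MeasurableSet M) :
    P.integral (M.indicator fun _ => 1) = P M := by
  classical
  let s : SimpleFunc Ω Prop := ⟨fun z => z ∈ M, fun p => by
    have : MeasurableSet {z | z ∈ M} := hM
    by_cases hp : p
    · convert this using 1; ext z; simp [hp]
    · convert this.compl using 1; ext z; simp [hp], Set.toFinite _⟩
  have h : (M.indicator fun _ => (1 : ℝ)) = s.map fun p => if p then 1 else 0 := by
    ext z; simp [Set.indicator_apply, s]
  rw [h, integral_simpleFunc, P.simple_map]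
  have h2 : s ⁻¹' {True} = M := by ext z; simp [s]
  rw [Finset.sum_eq_single True]
  · simp [h2]
  · intro p _ hp
    have hp' : ¬p := fun h' => hp (eq_true h')
    simp [hp']
  · intro h3
    have h4 : M = ∅ := by
      rw [Set.eq_empty_iff_forall_notMem]
      intro z hz
      exact h3 (SimpleFunc.mem_range.2 ⟨z, by simpa [s] using hz⟩)
    rw [h2, h4, P.apply_empty, smul_zero]

theorem integral_add (hf : RealBddMeas f) (hg : RealBddMeas g) :
    P.integral (fun z => f z + g z) = P.integral f + P.integral g := by
  obtain ⟨s, hs, hs'⟩ := exists_tendsto_simple P hf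
  obtain ⟨t, ht, ht'⟩ := exists_tendsto_simple P hg
  refine tendsto_nhds_unique (tendsto_simple_integral (hf.add hg) (s := fun k => s k + t k)
    (tendstoUniformly_of_abs_sub_le (c := 2) fun k z => ?_)) ?_
  · have e : (s k + t k) z - (f z + g z) = (s k z - f z) + (t k z - g z) := by
      rw [SimpleFunc.coe_add, Pi.add_apply]; ring
    rw [e]
    have := hs k z
    have := ht k z
    exact (abs_add_le _ _).trans (by linarith)
  · simpa only [simple_add] using hs'.add ht'

theorem integral_mul (hf : RealBddMeas f) (hg : RealBddMeas g) :
    P.integral (fun z => f z * g z) = P.integral f * P.integral g := by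
  obtain ⟨s, hs, hs'⟩ := exists_tendsto_simple P hf
  obtain ⟨t, ht, ht'⟩ := exists_tendsto_simple P hg
  obtain ⟨C, hC0, hC⟩ := hf.exists_bound
  obtain ⟨D, hD0, hD⟩ := hg.exists_bound
  refine tendsto_nhds_unique (tendsto_simple_integral (hf.mul hg) (s := fun k => s k * t k)
    (tendstoUniformly_of_abs_sub_le (c := C + 1 + D) fun k z => ?_)) ?_
  -- The factor `s k` is bounded by `C + 1` because its error is at most `1`; this explains the
  -- constant `C + 1 + D`.
  · have e : (s k * t k) z - f z * g z = s k z * (t k z - g z) + (s k z - f z) * g z := by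
      rw [SimpleFunc.coe_mul, Pi.mul_apply]; ring
    have hk : (0 : ℝ) ≤ 1 / ((k : ℝ) + 1) := by positivity
    have hk1 : 1 / ((k : ℝ) + 1) ≤ 1 := by
      rw [div_le_one (by positivity)]; linarith [Nat.cast_nonneg (α := ℝ) k]
    have h1 : |s k z| ≤ C + 1 := by
      have e1 : s k z = f z + (s k z - f z) := by ring
      rw [e1]
      exact (abs_add_le _ _).trans (add_le_add (hC z) ((hs k z).trans hk1))
    rw [e, add_mul]
    refine (abs_add_le _ _).trans (add_le_add ?_ ?_)
    · rw [abs_mul]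
      exact mul_le_mul h1 (ht k z) (abs_nonneg _) (by linarith)
    · rw [abs_mul, mul_comm]
      exact mul_le_mul (hD z) (hs k z) (abs_nonneg _) hD0
  · simpa only [simple_mul] using hs'.mul ht'

theorem integral_smul (c : ℝ) (hf : RealBddMeas f) :
    P.integral (fun z => c * f z) = c • P.integral f := by
  rw [integral_mul (RealBddMeas.const c) hf, integral_const, smul_mul_assoc, one_mul]

theorem integral_neg (hf : RealBddMeas f) : P.integral (fun z => -f z) = -P.integral f := by
  simpa using integral_smul (P := P) (-1) hf

theorem integral_sub (hf : RealBddMeas f) (hg : RealBddMeas g) :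
    P.integral (fun z => f z - g z) = P.integral f - P.integral g := by
  simp only [sub_eq_add_neg]
  rw [integral_add hf hg.neg, integral_neg hg]

theorem isSelfAdjoint_integral (hf : RealBddMeas f) : IsSelfAdjoint (P.integral f) := by
  obtain ⟨s, -, hs⟩ := exists_tendsto_simple P hf
  refine tendsto_nhds_unique ?_ hs
  simpa only [(P.isSelfAdjoint_simple _).star_eq] using hs.star

theorem norm_integral_le (hf : RealBddMeas f) {C : ℝ} (hC : 0 ≤ C) (h : ∀ z, |f z| ≤ C) :
    ‖P.integral f‖ ≤ C := by
  obtain ⟨s, hs, hs'⟩ := exists_tendsto_simple P hf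
  have hlim : Tendsto (fun k : ℕ => C + 1 / ((k : ℝ) + 1)) atTop (𝓝 C) := by
    simpa using tendsto_const_nhds.add (tendsto_one_div_add_atTop_nhds_zero_nat (𝕜 := ℝ))
  refine le_of_tendsto_of_tendsto hs'.norm hlim (Eventually.of_forall fun k => ?_)
  refine P.norm_simple_le _ (by positivity) fun z => ?_
  have e1 : s k z = f z + (s k z - f z) := by ring
  rw [e1]
  exact (abs_add_le _ _).trans (add_le_add (h z) (hs k z))

theorem integral_commute (hf : RealBddMeas f) (hg : RealBddMeas g) :
    P.integral f * P.integral g = P.integral g * P.integral f := by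
  rw [← integral_mul hf hg, ← integral_mul hg hf]
  simp only [mul_comm]

theorem mul_integral_comm {W : K →L[ℝ] K} (hW : ∀ M, MeasurableSet M → W * P M = P M * W)
    (hf : RealBddMeas f) : W * P.integral f = P.integral f * W := by
  obtain ⟨s, -, hs⟩ := exists_tendsto_simple P hf
  refine tendsto_nhds_unique (hs.const_mul W) ?_
  have : ∀ k, W * P.simple (s k) = P.simple (s k) * W := fun k => by
    simp only [simple, Finset.mul_sum, Finset.sum_mul, mul_smul_comm, smul_mul_assoc,
      hW _ ((s k).measurableSet_preimage _)]
  simpa only [this] using hs.mul_const W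

theorem norm_sq_integral_apply (hf : RealBddMeas f) (x : K) :
    ‖P.integral f x‖ ^ 2 = inner ℝ (P.integral (fun z => f z * f z) x) x := by
  rw [norm_sq_apply_of_isSelfAdjoint (isSelfAdjoint_integral hf), integral_mul hf hf]

theorem integral_eq_mul_self (hf : RealBddMeas f) (h : ∀ z, 0 ≤ f z) :
    P.integral f = P.integral (fun z => √(f z)) * P.integral fun z => √(f z) := by
  rw [← integral_mul hf.sqrt hf.sqrt]
  congr 1
  ext z
  rw [Real.mul_self_sqrt (h z)]

/-- A nonnegative integrand is a square, and its integral is the square of a self-adjoint operator.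
-/
theorem inner_integral_nonneg (hf : RealBddMeas f) (h : ∀ z, 0 ≤ f z) (x : K) :
    0 ≤ (inner ℝ (P.integral f x) x : ℝ) := by
  rw [integral_eq_mul_self hf h, ← norm_sq_apply_of_isSelfAdjoint (isSelfAdjoint_integral hf.sqrt)]
  positivity

theorem inner_integral_mono (hf : RealBddMeas f) (hg : RealBddMeas g) (h : ∀ z, f z ≤ g z) (x : K) :
    (inner ℝ (P.integral f x) x : ℝ) ≤ inner ℝ (P.integral g x) x := by
  have := inner_integral_nonneg (P := P) (hg.sub hf) (fun z => sub_nonneg.2 (h z)) x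
  rw [integral_sub hg hf, sub_apply, inner_sub_left] at this
  linarith

end ProjMeasure

end ProjMeasure

/-! ### Integrals against signed measures -/

section Signed

variable {Ω : Type*} [MeasurableSpace Ω]

theorem RealBddMeas.integrable {g : Ω → ℝ} (hg : RealBddMeas g) (μ : Measure Ω)
    [IsFiniteMeasure μ] : Integrable g μ := by
  obtain ⟨hgm, C, hC⟩ := hg
  exact Integrable.of_bound hgm.aestronglyMeasurable C (Eventually.of_forall hC)

theorem signedIntegral_add {f g : Ω → ℝ} (hf : RealBddMeas f) (hg : RealBddMeas g)
    (μ : SignedMeasure Ω) :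
    signedIntegral (fun z => f z + g z) μ = signedIntegral f μ + signedIntegral g μ := by
  rw [signedIntegral, integral_add (hf.integrable _) (hg.integrable _),
    integral_add (hf.integrable _) (hg.integrable _), signedIntegral, signedIntegral]
  ring

theorem signedIntegral_indicator {M : Set Ω} (hM : MeasurableSet M) (c : ℝ) (μ : SignedMeasure Ω) :
    signedIntegral (M.indicator fun _ => c) μ = c * μ M := by
  rw [signedIntegral, integral_indicator_const _ hM, integral_indicator_const _ hM, smul_eq_mul,
    smul_eq_mul, ← sub_mul, mul_comm]
  conv_rhs => rw [← μ.toSignedMeasure_toJordanDecomposition]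
  rw [JordanDecomposition.toSignedMeasure, sub_apply,
    Measure.toSignedMeasure_apply_measurable hM, Measure.toSignedMeasure_apply_measurable hM]

theorem tendsto_signedIntegral {F : ℕ → Ω → ℝ} {f : Ω → ℝ} (hF : ∀ j, Measurable (F j)) {C : ℝ}
    (hC : ∀ j z, |F j z| ≤ C) (h : ∀ z, Tendsto (fun j => F j z) atTop (𝓝 (f z)))
    (μ : SignedMeasure Ω) :
    Tendsto (fun j => signedIntegral (F j) μ) atTop (𝓝 (signedIntegral f μ)) := by
  have key : ∀ ν : Measure Ω, IsFiniteMeasure ν →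
      Tendsto (fun j => ∫ z, F j z ∂ν) atTop (𝓝 (∫ z, f z ∂ν)) := fun ν _ =>
    tendsto_integral_of_dominated_convergence (fun _ => C)
      (fun j => (hF j).aestronglyMeasurable) (integrable_const C)
      (fun j => Eventually.of_forall (hC j)) (Eventually.of_forall h)
  exact (key _ inferInstance).sub (key _ inferInstance)

end Signed

/-- The indicator of an open set is a bounded limit of continuous functions. -/
theorem exists_continuous_tendsto_indicator {X : Type*} [PseudoMetricSpace X] {U : Set X}
    (hU : IsOpen U) : ∃ φ : ℕ → X → ℝ, (∀ k, Continuous (φ k)) ∧ (∀ k w, |φ k w| ≤ 1) ∧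
      ∀ w, Tendsto (fun k => φ k w) atTop (𝓝 (U.indicator (fun _ => (1 : ℝ)) w)) := by
  -- The whole space is separate because `Metric.infDist` to the empty set is `0` by convention.
  by_cases hU' : U = Set.univ
  · exact ⟨fun _ _ => 1, fun _ => continuous_const, by simp, by simp [hU']⟩
  have hne : Uᶜ.Nonempty := Set.nonempty_compl.2 hU'
  refine ⟨fun k w => min 1 (k * Metric.infDist w Uᶜ), fun k =>
    continuous_const.min (continuous_const.mul (Metric.continuous_infDist_pt _)),
    fun k w => ?_, fun w => ?_⟩
  · rw [abs_of_nonneg (le_min zero_le_one (mul_nonneg k.cast_nonneg Metric.infDist_nonneg))]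
    exact min_le_left _ _
  · by_cases hw : w ∈ U
    · have h0 : 0 < Metric.infDist w Uᶜ :=
        (hU.isClosed_compl.notMem_iff_infDist_pos hne).1 (by simpa using hw)
      rw [Set.indicator_of_mem hw]
      refine tendsto_const_nhds.congr' ?_
      filter_upwards [(tendsto_natCast_atTop_atTop.atTop_mul_const h0).eventually_ge_atTop 1]
        with k hk
      exact (min_eq_left hk).symm
    · have h0 : Metric.infDist w Uᶜ = 0 := Metric.infDist_zero_of_mem hw
      simp [h0, hw]

/-! ### Convergence, null sets and intertwining for projection-valued measures -/

section ProjMeasure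

variable {Ω K : Type*} [MeasurableSpace Ω] [NormedAddCommGroup K] [InnerProductSpace ℝ K]
  [CompleteSpace K]

namespace ProjMeasure

variable {P : ProjMeasure Ω K} {f g : Ω → ℝ}

theorem signedIntegral_simpleFunc (φ : K →L[ℝ] ℝ) (x : K) (s : SimpleFunc Ω ℝ) :
    signedIntegral s (P.signedMeasure φ x) = φ (P.integral s x) := by
  induction s using SimpleFunc.induction with
  | const c hM =>
    rename_i M
    have e : ⇑((SimpleFunc.const Ω c).piecewise M hM (SimpleFunc.const Ω 0)) =
        M.indicator fun _ => c := by
      ext z; by_cases hz : z ∈ M <;> simp [hz]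
    have e' : M.indicator (fun _ => c) = fun z => c * M.indicator (fun _ => (1 : ℝ)) z := by
      ext z; by_cases hz : z ∈ M <;> simp [hz]
    rw [e, signedIntegral_indicator hM, signedMeasure_apply _ _ _ hM, e',
      integral_smul c (RealBddMeas.indicator_one hM), integral_indicator hM]
    simp
  | add hd hf hg =>
    rename_i f g
    rw [SimpleFunc.coe_add]
    change signedIntegral (fun z => f z + g z) _ = φ (P.integral (fun z => f z + g z) x)
    rw [signedIntegral_add (.simpleFunc f) (.simpleFunc g),
      integral_add (.simpleFunc f) (.simpleFunc g), hf, hg]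
    simp

/-- Scalar form of the integral, through which dominated convergence becomes available. The
functional is arbitrary, so that it can later be a component of the Clifford-valued inner product.
-/
theorem signedIntegral_eq (hg : RealBddMeas g) (φ : K →L[ℝ] ℝ) (x : K) :
    signedIntegral g (P.signedMeasure φ x) = φ (P.integral g x) := by
  obtain ⟨s, hs, hs'⟩ := exists_tendsto_simple P hg
  obtain ⟨C, -, hC⟩ := hg.exists_bound
  have hk1 : ∀ k : ℕ, 1 / ((k : ℝ) + 1) ≤ 1 := fun k => by
    rw [div_le_one (by positivity)]; linarith [Nat.cast_nonneg (α := ℝ) k]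
  have h1 := tendsto_signedIntegral (F := fun k => s k) (f := g) (fun k => (s k).measurable)
    (C := C + 1) (fun k z => by
      have e1 : s k z = g z + (s k z - g z) := by ring
      rw [e1]
      exact (abs_add_le _ _).trans (add_le_add (hC z) ((hs k z).trans (hk1 k))))
    (fun z => (tendstoUniformly_of_abs_sub_le (c := 1) (by simpa using hs)).tendsto_at z)
    (P.signedMeasure φ x)
  refine tendsto_nhds_unique h1 ?_
  simp only [signedIntegral_simpleFunc, integral_simpleFunc]
  exact (φ.continuous.tendsto _).comp
    (((ContinuousLinearMap.apply ℝ K x).continuous.tendsto _).comp hs')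

theorem inner_integral_eq (hg : RealBddMeas g) (x : K) :
    (inner ℝ (P.integral g x) x : ℝ) = signedIntegral g (P.signedMeasure (innerSL ℝ x) x) := by
  rw [signedIntegral_eq hg, innerSL_apply_apply, real_inner_comm]

/-- Bounded pointwise convergence implies strong convergence of the integrals. -/
theorem tendsto_integral {F : ℕ → Ω → ℝ} (hF : ∀ j, Measurable (F j)) {C : ℝ}
    (hC : ∀ j z, |F j z| ≤ C) (h : ∀ z, Tendsto (fun j => F j z) atTop (𝓝 (f z))) (x : K) :
    Tendsto (fun j => P.integral (F j) x) atTop (𝓝 (P.integral f x)) := by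
  have hf : RealBddMeas f := ⟨measurable_of_tendsto_metrizable hF (tendsto_pi_nhds.2 h), C,
    fun z => le_of_tendsto (h z).abs (Eventually.of_forall fun j => hC j z)⟩
  have hFb : ∀ j, RealBddMeas (F j) := fun j => ⟨hF j, C, hC j⟩
  rw [tendsto_iff_norm_sub_tendsto_zero]
  -- Strong convergence reduces to a scalar limit, because the squared norm of the difference is the
  -- integral of `(F j - f)²` against one fixed signed measure.
  have h1 : Tendsto (fun j => signedIntegral (fun z => (F j z - f z) * (F j z - f z))
      (P.signedMeasure (innerSL ℝ x) x)) atTop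
      (𝓝 (signedIntegral (fun z => (0 : ℝ)) (P.signedMeasure (innerSL ℝ x) x))) := by
    refine tendsto_signedIntegral (fun j => ((hF j).sub hf.1).mul ((hF j).sub hf.1))
      (C := (C + C) * (C + C)) (fun j z => ?_) (fun z => ?_) _
    · have h2 : |F j z - f z| ≤ C + C := (abs_sub _ _).trans (add_le_add (hC j z)
        (le_of_tendsto (h z).abs (Eventually.of_forall fun j => hC j z)))
      change |(F j z - f z) * (F j z - f z)| ≤ _
      rw [abs_mul]
      exact mul_le_mul h2 h2 (abs_nonneg _) ((abs_nonneg _).trans h2)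
    · have := (h z).sub_const (f z)
      simpa using this.mul this
  have h2 : ∀ j, signedIntegral (fun z => (F j z - f z) * (F j z - f z))
      (P.signedMeasure (innerSL ℝ x) x) = ‖P.integral (F j) x - P.integral f x‖ ^ 2 := by
    intro j
    have hb := (hFb j).sub hf
    rw [← inner_integral_eq (hb.mul hb), ← norm_sq_integral_apply hb, integral_sub (hFb j) hf,
      sub_apply]
  have h3 : signedIntegral (fun z => (0 : ℝ)) (P.signedMeasure (innerSL ℝ x) x) = 0 := by
    simp [signedIntegral]
  simp only [h2, h3] at h1
  have h4 := h1.sqrt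
  simpa [Real.sqrt_sq (norm_nonneg _)] using h4

/-- The integral does not see modifications on a null set. -/
theorem integral_congr {N : Set Ω} (hN : MeasurableSet N) (hN0 : P N = 0) (hf : RealBddMeas f)
    (hg : RealBddMeas g) (h : ∀ z, z ∉ N → f z = g z) : P.integral f = P.integral g := by
  -- The difference equals itself times the indicator of `N`, and by multiplicativity its integral
  -- contains the factor `P N = 0`.
  have h1 : (fun z => f z - g z) =
      fun z => (f z - g z) * N.indicator (fun _ => (1 : ℝ)) z := by
    ext z
    by_cases hz : z ∈ N <;> simp [hz, h]
  have h2 := integral_sub (P := P) hf hg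
  rw [h1, integral_mul (hf.sub hg) (.indicator_one hN), integral_indicator hN, hN0, mul_zero] at h2
  exact (sub_eq_zero.1 h2.symm)

/-- A countable union of null sets is a null set. -/
theorem apply_mono_null {M N : Set Ω} (hM : MeasurableSet M) (hN : MeasurableSet N)
    (h : M ⊆ N) (hN0 : P N = 0) : P M = 0 := by
  rw [← Set.inter_eq_self_of_subset_left h, P.apply_inter hM hN, hN0, mul_zero]

theorem apply_iUnion_null {ι : Type*} [Countable ι] {M : ι → Set Ω} (hM : ∀ i, MeasurableSet (M i))
    (h : ∀ i, P (M i) = 0) : P (⋃ i, M i) = 0 := by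
  cases isEmpty_or_nonempty ι
  · rw [Set.iUnion_of_empty, apply_empty]
  obtain ⟨e, he⟩ := exists_surjective_nat ι
  -- Countable additivity only speaks of disjoint families, so the union is made disjoint first.
  rw [← he.iUnion_comp, ← iUnion_disjointed]
  ext x
  have h1 := P.iUnion (disjointed fun k => M (e k)) (fun k => MeasurableSet.disjointed
    (fun k => hM (e k)) k) (disjoint_disjointed _) x
  have h2 : ∀ k, P (disjointed (fun k => M (e k)) k) = 0 := fun k =>
    apply_mono_null (MeasurableSet.disjointed (fun k => hM (e k)) k) (hM _)
      (disjointed_subset _ _) (h _)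
  simp only [h2, zero_apply] at h1
  exact h1.unique hasSum_zero

theorem apply_compl {M : Set Ω} (hM : MeasurableSet M) : P Mᶜ = 1 - P M := by
  rw [eq_sub_iff_add_eq, ← P.apply_union hM.compl hM disjoint_compl_left, Set.compl_union_self,
    P.univ]

/-- A lower bound for the quadratic form is a lower bound for the integrand almost everywhere:
vectors in the range of the projection of `{f ≤ c - δ}` satisfy both `c ‖x‖² ≤ ⟨·⟩` and `⟨·⟩ ≤ (c -
δ) ‖x‖²`. The strict inequality is exhausted by countably many gaps `δ`. -/
theorem apply_setOf_lt_eq_zero (hf : RealBddMeas f) {c : ℝ}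
    (h : ∀ x, c * ‖x‖ ^ 2 ≤ inner ℝ (P.integral f x) x) : P {z | f z < c} = 0 := by
  have hN : ∀ k : ℕ, MeasurableSet {z | f z ≤ c - 1 / ((k : ℝ) + 1)} := fun k =>
    hf.1 measurableSet_Iic
  have hU : {z | f z < c} = ⋃ k : ℕ, {z | f z ≤ c - 1 / ((k : ℝ) + 1)} := by
    ext z
    simp only [Set.mem_ofPred_eq, Set.mem_iUnion]
    constructor
    · intro hz
      obtain ⟨k, hk⟩ := exists_nat_one_div_lt (sub_pos.2 hz)
      exact ⟨k, by linarith⟩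
    · rintro ⟨k, hk⟩
      have : (0 : ℝ) < 1 / ((k : ℝ) + 1) := by positivity
      linarith
  rw [hU]
  refine apply_iUnion_null hN fun k => ?_
  set δ : ℝ := 1 / ((k : ℝ) + 1) with hδ
  have hδ0 : 0 < δ := by positivity
  set N := {z | f z ≤ c - δ} with hNdef
  have hNm : MeasurableSet N := hN k
  have h1N := RealBddMeas.indicator_one hNm
  ext y
  set x := P N y with hx
  have e1 : P.integral f x = P.integral (fun z => f z * N.indicator (fun _ => (1 : ℝ)) z) y := by
    rw [integral_mul hf h1N, integral_indicator hNm]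
    rfl
  have e2 : (inner ℝ (P.integral f x) x : ℝ) =
      inner ℝ (P.integral (fun z => N.indicator (fun _ => (1 : ℝ)) z *
        (f z * N.indicator (fun _ => (1 : ℝ)) z)) y) y := by
    rw [integral_mul h1N (hf.mul h1N), integral_indicator hNm, e1, hx,
      ← inner_eq_of_isSelfAdjoint (P.selfAdj N hNm)]
    rfl
  have e3 : ‖x‖ ^ 2 = inner ℝ (P.integral (N.indicator fun _ => (1 : ℝ)) y) y := by
    rw [hx, norm_sq_apply_of_isSelfAdjoint (P.selfAdj N hNm), P.idem N hNm, integral_indicator hNm]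
  have e4 := inner_integral_mono (P := P) (h1N.mul (hf.mul h1N))
    ((RealBddMeas.const (c - δ)).mul h1N) (fun z => by
      by_cases hz : z ∈ N
      · have : f z ≤ c - δ := hz
        simpa [hz] using this
      · simp [hz]) y
  rw [integral_smul _ h1N, smul_apply, inner_smul_left, ← e2, ← e3] at e4
  have e5 := h x
  have e6 : δ * ‖x‖ ^ 2 ≤ 0 := by
    change _ ≤ (c - δ) * ‖x‖ ^ 2 at e4
    linarith
  have e7 : ‖x‖ ^ 2 ≤ 0 := by
    by_contra hcon
    push Not at hcon
    linarith [mul_pos hδ0 hcon]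
  have e8 : ‖x‖ = 0 := pow_eq_zero_iff two_ne_zero |>.1 (le_antisymm e7 (by positivity))
  simpa using e8

/-! #### Intertwining operators -/

section Intertwine

variable {Ω₁ Ω₂ : Type*} [MeasurableSpace Ω₁] [MeasurableSpace Ω₂] {P₁ : ProjMeasure Ω₁ K}
  {P₂ : ProjMeasure Ω₂ K} {W : K →L[ℝ] K}

theorem _root_.CliffordSpectral.RealBddMeas.of_continuousMap {X : Type*} [TopologicalSpace X]
    [CompactSpace X] [MeasurableSpace X] [OpensMeasurableSpace X] (φ : C(X, ℝ)) {F : Ω → X}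
    (hF : Measurable F) : RealBddMeas fun z => φ (F z) :=
  ⟨φ.continuous.measurable.comp hF, ‖φ‖, fun z => φ.norm_coe_le_norm (F z)⟩

/-- By linearity and the sup norm bound the map is 1-Lipschitz. Hence the intertwining relation is a
closed condition on the continuous function. -/
theorem continuous_integral_comp {X : Type*} [TopologicalSpace X]
    [CompactSpace X] [MeasurableSpace X] [OpensMeasurableSpace X] (P : ProjMeasure Ω K) {F : Ω → X}
    (hF : Measurable F) : Continuous fun φ : C(X, ℝ) => P.integral fun z => φ (F z) := by
  refine (LipschitzWith.of_dist_le_mul (K := 1) fun φ ψ => ?_).continuous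
  rw [NNReal.coe_one, one_mul, dist_eq_norm, dist_eq_norm,
    ← integral_sub (.of_continuousMap φ hF) (.of_continuousMap ψ hF)]
  exact norm_integral_le (.of_continuousMap (φ - ψ) hF) (norm_nonneg _)
    fun z => (φ - ψ).norm_coe_le_norm (F z)

/-- Operators that intertwine the integrals of the coordinate functions intertwine the integrals
of all continuous functions. -/
theorem intertwine_continuousMap {R : ℝ} {F₁ : Ω₁ → Metric.closedBall (0 : ℂ) R}
    {F₂ : Ω₂ → Metric.closedBall (0 : ℂ) R} (hF₁ : Measurable F₁) (hF₂ : Measurable F₂)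
    (hre : W * P₁.integral (fun z => (F₁ z : ℂ).re) = P₂.integral (fun z => (F₂ z : ℂ).re) * W)
    (him : W * P₁.integral (fun z => (F₁ z : ℂ).im) = P₂.integral (fun z => (F₂ z : ℂ).im) * W)
    (φ : C(Metric.closedBall (0 : ℂ) R, ℝ)) :
    W * P₁.integral (fun z => φ (F₁ z)) = P₂.integral (fun z => φ (F₂ z)) * W := by
  have : CompactSpace (Metric.closedBall (0 : ℂ) R) :=
    isCompact_iff_compactSpace.1 (isCompact_closedBall _ _)
  -- The functions for which the relation holds form a closed subalgebra that contains the
  -- coordinates `re` and `im`. These separate points, so Stone–Weierstrass on the compact disc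
  -- applies.
  let A : Subalgebra ℝ C(Metric.closedBall (0 : ℂ) R, ℝ) :=
    { carrier := {φ | W * P₁.integral (fun z => φ (F₁ z)) = P₂.integral (fun z => φ (F₂ z)) * W}
      mul_mem' := by
        intro φ ψ hφ hψ
        have h1 := integral_mul (P := P₁) (.of_continuousMap φ hF₁) (.of_continuousMap ψ hF₁)
        have h2 := integral_mul (P := P₂) (.of_continuousMap φ hF₂) (.of_continuousMap ψ hF₂)
        change W * P₁.integral (fun z => φ (F₁ z) * ψ (F₁ z)) =
          P₂.integral (fun z => φ (F₂ z) * ψ (F₂ z)) * W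
        rw [h1, h2, ← mul_assoc, hφ, mul_assoc, hψ, mul_assoc]
      add_mem' := by
        intro φ ψ hφ hψ
        have h1 := integral_add (P := P₁) (.of_continuousMap φ hF₁) (.of_continuousMap ψ hF₁)
        have h2 := integral_add (P := P₂) (.of_continuousMap φ hF₂) (.of_continuousMap ψ hF₂)
        change W * P₁.integral (fun z => φ (F₁ z) + ψ (F₁ z)) =
          P₂.integral (fun z => φ (F₂ z) + ψ (F₂ z)) * W
        rw [h1, h2, mul_add, add_mul, hφ, hψ]
      algebraMap_mem' := by
        intro c
        change W * P₁.integral (fun _ => c) = P₂.integral (fun _ => c) * W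
        rw [integral_const, integral_const]
        simp }
  have hA : A.topologicalClosure = ⊤ := by
    refine ContinuousMap.subalgebra_topologicalClosure_eq_top_of_separatesPoints A ?_
    intro x y hxy
    by_cases h : (x : ℂ).re = (y : ℂ).re
    · exact ⟨fun x => (x : ℂ).im, ⟨⟨fun x => (x : ℂ).im, by fun_prop⟩, him, rfl⟩, fun h' =>
        hxy (Subtype.ext (Complex.ext h h'))⟩
    · exact ⟨fun x => (x : ℂ).re, ⟨⟨fun x => (x : ℂ).re, by fun_prop⟩, hre, rfl⟩, h⟩
  have hcl : IsClosed (A : Set C(Metric.closedBall (0 : ℂ) R, ℝ)) :=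
    isClosed_eq (continuous_const.mul (continuous_integral_comp P₁ hF₁))
      ((continuous_integral_comp P₂ hF₂).mul continuous_const)
  have h1 : φ ∈ A.topologicalClosure := hA ▸ Algebra.mem_top
  rw [← SetLike.mem_coe, Subalgebra.topologicalClosure_coe, hcl.closure_eq] at h1
  exact h1

/-- Operators that intertwine the integrals of the coordinate functions intertwine the
projection-valued measures. -/
theorem intertwine {R : ℝ} {f₁ : Ω₁ → ℂ} {f₂ : Ω₂ → ℂ} (hf₁ : Measurable f₁) (hf₂ : Measurable f₂)
    (hR₁ : ∀ z, ‖f₁ z‖ ≤ R) (hR₂ : ∀ z, ‖f₂ z‖ ≤ R)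
    (hre : W * P₁.integral (fun z => (f₁ z).re) = P₂.integral (fun z => (f₂ z).re) * W)
    (him : W * P₁.integral (fun z => (f₁ z).im) = P₂.integral (fun z => (f₂ z).im) * W)
    {M : Set ℂ} (hM : MeasurableSet M) : W * P₁ (f₁ ⁻¹' M) = P₂ (f₂ ⁻¹' M) * W := by
  have hB₁ : ∀ z, f₁ z ∈ Metric.closedBall (0 : ℂ) R := fun z => by simpa using hR₁ z
  have hB₂ : ∀ z, f₂ z ∈ Metric.closedBall (0 : ℂ) R := fun z => by simpa using hR₂ z
  have hcont : ∀ φ : ℂ → ℝ, Continuous φ → W * P₁.integral (fun z => φ (f₁ z)) =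
      P₂.integral (fun z => φ (f₂ z)) * W := fun φ hφ =>
    intertwine_continuousMap (F₁ := fun z => ⟨f₁ z, hB₁ z⟩) (F₂ := fun z => ⟨f₂ z, hB₂ z⟩)
      (hf₁.subtype_mk) (hf₂.subtype_mk) hre him ⟨fun x => φ x, hφ.comp continuous_subtype_val⟩
  induction M, hM using MeasurableSet.induction_on_open with
  | isOpen U hU =>
    -- Open sets are reached as bounded pointwise limits of continuous functions; complements and
    -- disjoint unions then give all Borel sets.
    obtain ⟨φ, hφc, hφb, hlim⟩ := exists_continuous_tendsto_indicator hU
    ext x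
    have h1 := tendsto_integral (P := P₁) (C := 1)
      (F := fun k z => φ k (f₁ z))
      (f := (f₁ ⁻¹' U).indicator fun _ => (1 : ℝ)) (fun k => (hφc k).measurable.comp hf₁)
      (fun k z => hφb k (f₁ z)) (fun z => hlim (f₁ z)) x
    have h2 := tendsto_integral (P := P₂) (C := 1)
      (F := fun k z => φ k (f₂ z))
      (f := (f₂ ⁻¹' U).indicator fun _ => (1 : ℝ)) (fun k => (hφc k).measurable.comp hf₂)
      (fun k z => hφb k (f₂ z)) (fun z => hlim (f₂ z)) (W x)
    have e1 := integral_indicator (P := P₁) (hf₁ hU.measurableSet)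
    have e2 := integral_indicator (P := P₂) (hf₂ hU.measurableSet)
    rw [← e1, ← e2]
    refine tendsto_nhds_unique ((W.continuous.tendsto _).comp h1) (h2.congr fun k => ?_)
    exact (congrArg (fun S : K →L[ℝ] K => S x) (hcont _ (hφc k))).symm
  | compl M hM ih =>
    rw [Set.preimage_compl, Set.preimage_compl, apply_compl (hf₁ hM), apply_compl (hf₂ hM),
      mul_sub, sub_mul, ih, mul_one, one_mul]
  | iUnion M hd hM ih =>
    ext x
    have h1 := (P₁.iUnion (fun i => f₁ ⁻¹' M i) (fun i => hf₁ (hM i))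
      (fun i j hij => (hd hij).preimage _) x).mapL W
    have h2 := P₂.iUnion (fun i => f₂ ⁻¹' M i) (fun i => hf₂ (hM i))
      (fun i j hij => (hd hij).preimage _) (W x)
    have h3 : (fun i => W (P₁ (f₁ ⁻¹' M i) x)) = fun i => P₂ (f₂ ⁻¹' M i) (W x) := by
      ext i
      exact congrArg (fun S : K →L[ℝ] K => S x) (ih i)
    rw [h3] at h1
    rw [Set.preimage_iUnion, Set.preimage_iUnion]
    exact h1.unique h2

end Intertwine

end ProjMeasure

end ProjMeasure

/-! ### Complex integrals with respect to an imaginary operator -/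

section Complex

variable {Ω : Type*} [MeasurableSpace Ω] {f g : Ω → ℂ}

namespace IsBddMeas

theorem re (hf : IsBddMeas f) : RealBddMeas fun z => (f z).re := by
  obtain ⟨hm, C, hC⟩ := hf
  exact ⟨Complex.measurable_re.comp hm, C, fun z => (Complex.abs_re_le_norm _).trans (hC z)⟩

theorem im (hf : IsBddMeas f) : RealBddMeas fun z => (f z).im := by
  obtain ⟨hm, C, hC⟩ := hf
  exact ⟨Complex.measurable_im.comp hm, C, fun z => (Complex.abs_im_le_norm _).trans (hC z)⟩

theorem norm_sq (hf : IsBddMeas f) : RealBddMeas fun z => ‖f z‖ ^ 2 := by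
  have h : RealBddMeas fun z => ‖f z‖ := by
    obtain ⟨hm, C, hC⟩ := hf
    exact ⟨hm.norm, C, fun z => by simpa using hC z⟩
  simpa only [pow_two] using h.mul h

theorem star (hf : IsBddMeas f) : IsBddMeas fun z => star (f z) := by
  obtain ⟨hm, C, hC⟩ := hf
  exact ⟨continuous_star.measurable.comp hm, C, fun z => by simpa using hC z⟩

theorem mul (hf : IsBddMeas f) (hg : IsBddMeas g) : IsBddMeas fun z => f z * g z := by
  obtain ⟨hm, C, hC⟩ := hf
  obtain ⟨hm', D, hD⟩ := hg
  exact ⟨hm.mul hm', C * D, fun z => by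
    rw [norm_mul]
    exact mul_le_mul (hC z) (hD z) (norm_nonneg _) ((norm_nonneg _).trans (hC z))⟩

theorem add (hf : IsBddMeas f) (hg : IsBddMeas g) : IsBddMeas fun z => f z + g z := by
  obtain ⟨hm, C, hC⟩ := hf
  obtain ⟨hm', D, hD⟩ := hg
  exact ⟨hm.add hm', C + D, fun z => (norm_add_le _ _).trans (add_le_add (hC z) (hD z))⟩

theorem const (c : ℂ) : IsBddMeas fun _ : Ω => c := ⟨measurable_const, ‖c‖, fun _ => le_rfl⟩

theorem ofReal {h : Ω → ℝ} (hh : RealBddMeas h) : IsBddMeas fun z => (h z : ℂ) := by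
  obtain ⟨hm, C, hC⟩ := hh
  exact ⟨Complex.measurable_ofReal.comp hm, C, fun z => by simpa using hC z⟩

theorem exists_bound (hf : IsBddMeas f) : ∃ C : ℝ, 0 ≤ C ∧ ∀ z, ‖f z‖ ≤ C := by
  obtain ⟨-, C, hC⟩ := hf
  exact ⟨|C|, abs_nonneg C, fun z => (hC z).trans (le_abs_self C)⟩

theorem indicator (hf : IsBddMeas f) {M : Set Ω} (hM : MeasurableSet M) :
    IsBddMeas (M.indicator f) := by
  obtain ⟨C, hC0, hC⟩ := hf.exists_bound
  refine ⟨hf.1.indicator hM, C, fun z => ?_⟩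
  by_cases hz : z ∈ M <;> simp [hz, hC, hC0]

end IsBddMeas

variable {K : Type*} [NormedAddCommGroup K] [InnerProductSpace ℝ K] [CompleteSpace K]

namespace ProjMeasure

/-- `∫ Re f dP + (∫ Im f dP) J`. -/
def cintegral (P : ProjMeasure Ω K) (J : K →L[ℝ] K) (f : Ω → ℂ) : K →L[ℝ] K :=
  P.integral (fun z => (f z).re) + P.integral (fun z => (f z).im) * J

/-- `J` is an imaginary operator that commutes with `P`. -/
structure IsImaginaryUnit (P : ProjMeasure Ω K) (J : K →L[ℝ] K) : Prop where
  star_eq : star J = -J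
  mul_self : J * J = -1
  comm : ∀ M, MeasurableSet M → J * P M = P M * J

variable {P : ProjMeasure Ω K} {J : K →L[ℝ] K}

theorem cintegral_ofReal (h : Ω → ℝ) : P.cintegral J (fun z => (h z : ℂ)) = P.integral h := by
  have h0 : P.integral (fun _ => (0 : ℝ)) = 0 := by rw [integral_const, zero_smul]
  simp [cintegral, h0]

theorem apply_congr {N M M' : Set Ω} (hN : MeasurableSet N) (hN0 : P N = 0)
    (hM : MeasurableSet M) (hM' : MeasurableSet M') (h : ∀ z, z ∉ N → (z ∈ M ↔ z ∈ M')) :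
    P M = P M' := by
  rw [← integral_indicator hM, ← integral_indicator hM']
  refine integral_congr hN hN0 (.indicator_one hM) (.indicator_one hM') fun z hz => ?_
  by_cases hz' : z ∈ M
  · rw [Set.indicator_of_mem hz', Set.indicator_of_mem ((h z hz).1 hz')]
  · rw [Set.indicator_of_notMem hz', Set.indicator_of_notMem fun h' => hz' ((h z hz).2 h')]

theorem cintegral_congr {N : Set Ω} (hN : MeasurableSet N) (hN0 : P N = 0) (hf : IsBddMeas f)
    (hg : IsBddMeas g) (h : ∀ z, z ∉ N → f z = g z) : P.cintegral J f = P.cintegral J g := by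
  rw [cintegral, cintegral, integral_congr hN hN0 hf.re hg.re fun z hz => by rw [h z hz],
    integral_congr hN hN0 hf.im hg.im fun z hz => by rw [h z hz]]

theorem cintegral_add (hf : IsBddMeas f) (hg : IsBddMeas g) :
    P.cintegral J (fun z => f z + g z) = P.cintegral J f + P.cintegral J g := by
  simp only [cintegral, Complex.add_re, Complex.add_im]
  rw [integral_add hf.re hg.re, integral_add hf.im hg.im, add_mul]
  abel

theorem cintegral_const (c : ℂ) : P.cintegral J (fun _ => c) = c.re • 1 + c.im • J := by
  rw [cintegral, integral_const, integral_const, smul_mul_assoc, one_mul]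

theorem IsImaginaryUnit.mul_integral (hJ : P.IsImaginaryUnit J) {h : Ω → ℝ}
    (hh : RealBddMeas h) : J * P.integral h = P.integral h * J :=
  mul_integral_comm hJ.comm hh

/-- Since `J` commutes with every real integral and `J² = -1`, the real and imaginary parts multiply
as in `ℂ`. -/
theorem cintegral_mul (hJ : P.IsImaginaryUnit J) (hf : IsBddMeas f) (hg : IsBddMeas g) :
    P.cintegral J (fun z => f z * g z) = P.cintegral J f * P.cintegral J g := by
  simp only [cintegral, Complex.mul_re, Complex.mul_im]
  rw [integral_sub (hf.re.mul hg.re) (hf.im.mul hg.im), integral_mul hf.re hg.re,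
    integral_mul hf.im hg.im, integral_add (hf.re.mul hg.im) (hf.im.mul hg.re),
    integral_mul hf.re hg.im, integral_mul hf.im hg.re]
  have h1 := hJ.mul_integral hg.re
  have h2 := hJ.mul_integral hg.im
  have h3 : P.integral (fun z => (f z).im) * J * (P.integral (fun z => (g z).im) * J) =
      -(P.integral (fun z => (f z).im) * P.integral (fun z => (g z).im)) := by
    rw [mul_assoc, ← mul_assoc J, h2, mul_assoc _ J J, hJ.mul_self]
    simp
  have h4 : P.integral (fun z => (f z).im) * J * P.integral (fun z => (g z).re) =
      P.integral (fun z => (f z).im) * P.integral (fun z => (g z).re) * J := by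
    rw [mul_assoc, h1, mul_assoc]
  simp only [add_mul, mul_add]
  rw [h3, h4, mul_assoc (P.integral fun z => (f z).re)]
  abel

theorem star_cintegral (hJ : P.IsImaginaryUnit J) (hf : IsBddMeas f) :
    star (P.cintegral J f) = P.cintegral J fun z => star (f z) := by
  have h1 : (fun z => (star (f z)).re) = fun z => (f z).re := rfl
  have h2 : (fun z => (star (f z)).im) = fun z => -(f z).im := rfl
  rw [cintegral, cintegral, h1, h2, integral_neg hf.im, star_add, star_mul,
    (isSelfAdjoint_integral hf.re).star_eq, (isSelfAdjoint_integral hf.im).star_eq, hJ.star_eq,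
    neg_mul, hJ.mul_integral hf.im, neg_mul]

/-- Source of all norm formulas: the product is a real integral, free of `J`. -/
theorem star_mul_cintegral (hJ : P.IsImaginaryUnit J) (hf : IsBddMeas f) :
    star (P.cintegral J f) * P.cintegral J f = P.integral fun z => ‖f z‖ ^ 2 := by
  rw [star_cintegral hJ hf, ← cintegral_mul hJ hf.star hf, ← cintegral_ofReal (J := J)]
  congr 1
  ext z
  rw [Complex.star_def, Complex.conj_mul']
  push_cast
  rfl

theorem norm_sq_cintegral_apply (hJ : P.IsImaginaryUnit J) (hf : IsBddMeas f) (x : K) :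
    ‖P.cintegral J f x‖ ^ 2 = inner ℝ (P.integral (fun z => ‖f z‖ ^ 2) x) x := by
  rw [← star_mul_cintegral hJ hf, ← real_inner_self_eq_norm_sq,
    ContinuousLinearMap.star_eq_adjoint]
  exact (ContinuousLinearMap.adjoint_inner_left _ _ _).symm

theorem norm_cintegral_le (hJ : P.IsImaginaryUnit J) (hf : IsBddMeas f) {C : ℝ} (hC0 : 0 ≤ C)
    (hC : ∀ z, ‖f z‖ ≤ C) : ‖P.cintegral J f‖ ≤ C := by
  refine ContinuousLinearMap.opNorm_le_bound _ hC0 fun x => ?_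
  have h1 := inner_integral_mono (P := P) hf.norm_sq (RealBddMeas.const (C ^ 2))
    (fun z => pow_le_pow_left₀ (norm_nonneg _) (hC z) 2) x
  rw [← norm_sq_cintegral_apply hJ hf, integral_const, smul_apply, one_apply_eq_self,
    inner_smul_left, real_inner_self_eq_norm_sq] at h1
  refine le_of_sq_le_sq ?_ (by positivity)
  rw [mul_pow]
  exact h1

theorem norm_cintegral_le_of_ae (hJ : P.IsImaginaryUnit J) (hf : IsBddMeas f) {C : ℝ} (hC0 : 0 ≤ C)
    {N : Set Ω} (hN : MeasurableSet N) (hN0 : P N = 0) (hC : ∀ z, z ∉ N → ‖f z‖ ≤ C) :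
    ‖P.cintegral J f‖ ≤ C := by
  rw [cintegral_congr hN hN0 hf (hf.indicator hN.compl) fun z hz => by simp [hz]]
  refine norm_cintegral_le hJ (hf.indicator hN.compl) hC0 fun z => ?_
  by_cases hz : z ∈ N <;> simp [hz, hC, hC0]

/-- The modulus of `f` is almost everywhere at most the norm of the integral. -/
theorem apply_setOf_norm_lt (hJ : P.IsImaginaryUnit J) (hf : IsBddMeas f) :
    P {z | ‖P.cintegral J f‖ < ‖f z‖} = 0 := by
  -- An upper bound for `|f|²` is a lower bound for `-|f|²`.
  have h1 := apply_setOf_lt_eq_zero (P := P) hf.norm_sq.neg (c := -‖P.cintegral J f‖ ^ 2)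
    fun x => by
      rw [integral_neg hf.norm_sq, neg_apply, inner_neg_left, ← norm_sq_cintegral_apply hJ hf,
        neg_mul, neg_le_neg_iff, ← mul_pow]
      exact pow_le_pow_left₀ (norm_nonneg _) ((P.cintegral J f).le_opNorm x) 2
  convert h1 using 2
  ext z
  rw [Set.mem_ofPred_eq, Set.mem_ofPred_eq, neg_lt_neg_iff]
  exact (pow_lt_pow_iff_left₀ (norm_nonneg _) (norm_nonneg _) two_ne_zero).symm

/-- If the integral of `f` is bounded below, then so is `f`, almost everywhere. -/
theorem exists_bounded_below (hJ : P.IsImaginaryUnit J) (hf : IsBddMeas f) {C : ℝ}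
    (h : ∀ x, ‖x‖ ≤ C * ‖P.cintegral J f x‖) :
    ∃ c : ℝ, 0 < c ∧ P {z | ‖f z‖ < c} = 0 := by
  -- The given constant may be zero or negative; enlarging it makes `D⁻¹` a positive lower bound.
  set D := |C| + 1 with hD
  have hD0 : 0 < D := by positivity
  have hCD : C ≤ D := (le_abs_self C).trans (by linarith)
  refine ⟨D⁻¹, inv_pos.2 hD0, ?_⟩
  have h1 := apply_setOf_lt_eq_zero (P := P) hf.norm_sq (c := D⁻¹ ^ 2) fun x => by
    rw [← norm_sq_cintegral_apply hJ hf, ← mul_pow]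
    refine pow_le_pow_left₀ (by positivity) ?_ 2
    rw [inv_mul_le_iff₀ hD0]
    exact (h x).trans (mul_le_mul_of_nonneg_right hCD (norm_nonneg _))
  convert h1 using 2
  ext z
  rw [Set.mem_ofPred_eq, Set.mem_ofPred_eq]
  exact (pow_lt_pow_iff_left₀ (norm_nonneg _) (inv_nonneg.2 hD0.le) two_ne_zero).symm

theorem tendsto_cintegral {F : ℕ → Ω → ℂ} (hF : ∀ j, IsBddMeas (F j)) (hf : IsBddMeas f)
    {C : ℝ} (hC0 : 0 ≤ C) (hC : ∀ j z, ‖F j z‖ ≤ C) {N : Set Ω} (hN : MeasurableSet N)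
    (hN0 : P N = 0) (h : ∀ z, z ∉ N → Tendsto (fun j => F j z) atTop (𝓝 (f z))) (x : K) :
    Tendsto (fun j => P.cintegral J (F j) x) atTop (𝓝 (P.cintegral J f x)) := by
  have e : ∀ {g : Ω → ℂ}, IsBddMeas g →
      P.cintegral J g = P.cintegral J (Nᶜ.indicator g) := fun hg =>
    cintegral_congr hN hN0 hg (hg.indicator hN.compl) fun z hz => by simp [hz]
  have hlim : ∀ z, Tendsto (fun j => Nᶜ.indicator (F j) z) atTop (𝓝 (Nᶜ.indicator f z)) := by
    intro z
    by_cases hz : z ∈ N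
    · simp [hz]
    · simpa [hz] using h z hz
  have hb : ∀ j z, ‖Nᶜ.indicator (F j) z‖ ≤ C := by
    intro j z
    by_cases hz : z ∈ N <;> simp [hz, hC0, hC]
  simp only [e hf, e (hF _)]
  refine (tendsto_integral (fun j => ((hF j).indicator hN.compl).re.1)
    (fun j z => (Complex.abs_re_le_norm _).trans (hb j z))
    (fun z => (Complex.continuous_re.tendsto _).comp (hlim z)) x).add
    (tendsto_integral (fun j => ((hF j).indicator hN.compl).im.1)
    (fun j z => (Complex.abs_im_le_norm _).trans (hb j z))
    (fun z => (Complex.continuous_im.tendsto _).comp (hlim z)) (J x))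

/-- Two measures that commute with imaginary operators are equal after transport to the plane, if
the integrals of the real parts and of the squares of the imaginary parts agree, the imaginary
parts being nonnegative. -/
theorem apply_preimage_eq_of_sq {Ω' : Type*} [MeasurableSpace Ω'] {P' : ProjMeasure Ω' K}
    {g : Ω' → ℂ} (hf : IsBddMeas f) (hg : IsBddMeas g)
    {N : Set Ω} (hN : MeasurableSet N) (hN0 : P N = 0) (hfp : ∀ z, z ∉ N → 0 ≤ (f z).im)
    (hgp : ∀ z, 0 ≤ (g z).im)
    (hre : P.integral (fun z => (f z).re) = P'.integral fun z => (g z).re)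
    (him : P.integral (fun z => (f z).im * (f z).im) =
      P'.integral fun z => (g z).im * (g z).im)
    {M : Set ℂ} (hM : MeasurableSet M) : P (f ⁻¹' M) = P' (g ⁻¹' M) := by
  -- Squaring the imaginary part is undone by `r` on the upper half plane. The hypotheses say that
  -- the images under `q ∘ f` and `q ∘ g` have the same coordinate integrals, so they agree by
  -- `intertwine` with `W = 1`; testing them on `r⁻¹(M)` returns to `f` and `g`.
  set q : ℂ → ℂ := fun w => ⟨w.re, w.im * w.im⟩ with hq
  set r : ℂ → ℂ := fun w => ⟨w.re, √w.im⟩ with hr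
  have hqm : Measurable q := by
    have : Continuous q := Complex.equivRealProdCLM.symm.continuous.comp
      (Complex.continuous_re.prodMk (Complex.continuous_im.mul Complex.continuous_im))
    exact this.measurable
  have hrm : Measurable r := by
    have : Continuous r := Complex.equivRealProdCLM.symm.continuous.comp
      (Complex.continuous_re.prodMk Complex.continuous_im.sqrt)
    exact this.measurable
  have hrq : ∀ w : ℂ, 0 ≤ w.im → r (q w) = w := fun w hw => by
    simp [hq, hr, Real.sqrt_mul_self hw]
  have hbound : ∀ {w : ℂ} {C : ℝ}, 0 ≤ C → ‖w‖ ≤ C → ‖q w‖ ≤ C + C * C := by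
    intro w C hC0 hC
    have h2 := (Complex.abs_im_le_norm w).trans hC
    refine (Complex.norm_le_abs_re_add_abs_im _).trans (add_le_add
      ((Complex.abs_re_le_norm w).trans hC) ?_)
    change |w.im * w.im| ≤ _
    rw [abs_mul]
    exact mul_le_mul h2 h2 (abs_nonneg _) hC0
  obtain ⟨C, hC0, hC⟩ := hf.exists_bound
  obtain ⟨D, hD0, hD⟩ := hg.exists_bound
  have h1 := intertwine (P₁ := P) (P₂ := P') (W := 1) (f₁ := fun z => q (f z))
    (f₂ := fun z => q (g z)) (R := max C D + max C D * max C D) (hqm.comp hf.1) (hqm.comp hg.1)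
    (fun z => hbound (le_max_of_le_left hC0) ((hC z).trans (le_max_left _ _)))
    (fun z => hbound (le_max_of_le_left hC0) ((hD z).trans (le_max_right _ _)))
    (by rw [one_mul, mul_one]; exact hre) (by rw [one_mul, mul_one]; exact him) (hrm hM)
  rw [one_mul, mul_one] at h1
  have h2 : (fun z => q (g z)) ⁻¹' (r ⁻¹' M) = g ⁻¹' M := by
    ext z
    simp only [Set.mem_preimage, hrq _ (hgp z)]
  rw [← h2, ← h1]
  refine apply_congr hN hN0 (hf.1 hM) (hqm.comp hf.1 (hrm hM)) fun z hz => ?_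
  simp only [Set.mem_preimage, hrq _ (hfp z hz)]

end ProjMeasure

end Complex

/-! ### Uniqueness of the components `A`, `B` in `A + J B` -/

/-- If `A + J B = A' + B' J`, where `A`, `B`, `J` commute, then `A' = A` and `B' = B`. -/
theorem cartesian_unique {R : Type*} [Ring R] [StarRing R] [Module ℝ R]
    (hR : ∀ D : R, IsSelfAdjoint D → D * D = 0 → D = 0) {J A B A' B' : R} (hJs : star J = -J)
    (hJJ : J * J = -1) (hA : IsSelfAdjoint A) (hB : IsSelfAdjoint B) (hA' : IsSelfAdjoint A')
    (hB' : IsSelfAdjoint B') (hAB : A * B = B * A) (hAJ : A * J = J * A) (hBJ : B * J = J * B)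
    (hAB' : A' * B' = B' * A') (h : A + J * B = A' + B' * J) : A' = A ∧ B' = B := by
  -- Taking adjoints changes the sign of the imaginary parts. It also reverses the order on the
  -- right, where `B'` is not yet known to commute with `J`; this reversal makes `D = B' - B`
  -- anticommute with `J`.
  have h2 : A - J * B = A' - J * B' := by
    have e := congrArg star h
    rw [star_add, star_add, star_mul, star_mul, hA.star_eq, hB.star_eq, hA'.star_eq, hB'.star_eq,
      hJs, mul_neg, neg_mul, hBJ] at e
    rwa [sub_eq_add_neg, sub_eq_add_neg]
  obtain ⟨C, rfl⟩ : ∃ C, A' = A + C := ⟨A' - A, by abel⟩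
  obtain ⟨D, rfl⟩ : ∃ D, B' = B + D := ⟨B' - B, by abel⟩
  have hD : IsSelfAdjoint D := by simpa using hB'.sub hB
  have h3 : C = -(D * J) := by
    rw [add_mul, ← hBJ] at h
    have e := sub_eq_zero.2 h.symm
    rw [eq_neg_iff_add_eq_zero, ← e]
    abel
  have h4 : C = J * D := by
    rw [mul_add] at h2
    have e := sub_eq_zero.2 h2.symm
    rw [← sub_eq_zero, ← e]
    abel
  have hDJ : D * J = -(J * D) := by rw [← h4, h3, neg_neg]
  have h5 := sub_eq_zero.2 hAB'
  rw [h4] at h5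
  have hDJ' : ∀ x, D * (J * x) = -(J * (D * x)) := fun x => by
    rw [← mul_assoc, hDJ, neg_mul, mul_assoc]
  have hAJ' : ∀ x, A * (J * x) = J * (A * x) := fun x => by rw [← mul_assoc, hAJ, mul_assoc]
  have hBJ' : ∀ x, B * (J * x) = J * (B * x) := fun x => by rw [← mul_assoc, hBJ, mul_assoc]
  have hJJ' : ∀ x, J * (J * x) = -x := fun x => by rw [← mul_assoc, hJJ, neg_one_mul]
  -- The commutator `X` of `A' = A + J D` and `B' = B + D` is zero. In `J X + X J` the terms `[A,
  -- D]` and `[J D, B]` cancel because they anticommute with `J`, while `[J D, D] = 2 J D²`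
  -- contributes `-4 D²`.
  have h6 : D * D + D * D + (D * D + D * D) = 0 := by
    have e : J * ((A + J * D) * (B + D) - (B + D) * (A + J * D)) +
        ((A + J * D) * (B + D) - (B + D) * (A + J * D)) * J = 0 := by
      rw [h5, mul_zero, zero_mul, add_zero]
    simp only [mul_add, add_mul, mul_sub, sub_mul, mul_assoc, neg_mul, hDJ, hDJ', hAJ, hAJ', hBJ, hBJ', hJJ',
      mul_neg, hAB, neg_neg] at e
    rw [← neg_eq_zero, ← e]
    abel
  have h7 : D = 0 := by
    refine hR D hD ?_
    rw [← two_smul ℝ (D * D), ← two_smul ℝ ((2 : ℝ) • (D * D)), smul_smul] at h6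
    exact (smul_eq_zero.1 h6).resolve_left (by norm_num)
  exact ⟨by rw [h4, h7, mul_zero, add_zero], by rw [h7, add_zero]⟩

theorem mul_self_eq_neg_one {R : Type*} [Ring R] {J : R} (h : J * -J = 1) : J * J = -1 := by
  rw [mul_neg] at h
  rw [← h, neg_neg]

/-- For large `r` the term `r²` dominates, and the operator is `r² (1 - S)` with `‖S‖ < 1`. This
bounds the `S`-spectrum, so that the coordinates are bounded functions on it. -/
theorem isUnit_quadratic {K : Type*} [NormedAddCommGroup K] [InnerProductSpace ℝ K]
    [CompleteSpace K] (T : K →L[ℝ] K) {u r : ℝ} (hu : |u| ≤ r) (hr : 3 * ‖T‖ + 1 < r) :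
    IsUnit (T ^ 2 - (2 * u) • T + (r ^ 2) • 1) := by
  have ht := norm_nonneg T
  have hr0 : 0 < r := by linarith
  set S := (r ^ 2)⁻¹ • ((2 * u) • T - T ^ 2) with hS
  have hSn : ‖S‖ < 1 := by
    have e1 : ‖(2 * u) • T - T ^ 2‖ ≤ 2 * r * ‖T‖ + ‖T‖ ^ 2 := by
      refine (norm_sub_le _ _).trans (add_le_add ?_ (norm_pow_le' _ two_pos))
      rw [norm_smul, Real.norm_eq_abs, abs_mul, abs_two]
      gcongr
    rw [hS, norm_smul, norm_inv, norm_pow, Real.norm_eq_abs, abs_of_pos hr0,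
      inv_mul_lt_iff₀ (by positivity), mul_one]
    nlinarith
  have e : T ^ 2 - (2 * u) • T + (r ^ 2) • 1 = (r ^ 2) • (1 - S) := by
    rw [hS, smul_sub, smul_smul, mul_inv_cancel₀ (by positivity), one_smul]
    abel
  rw [e]
  exact (isUnit_one_sub_of_norm_lt_one hSn).smul (Units.mk0 (r ^ 2) (by positivity))

/-! ### Right linear operators and the resolvent set -/

section NotComplete

variable {n : ℕ} {H : Type*} [NormedAddCommGroup H] [InnerProductSpace ℝ H]

/-- Right linearity is a family of closed conditions, so norm limits of spectral integrals of simple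
functions remain right linear. -/
theorem isClosed_bop : IsClosed (BOp n H : Set (CModule n H →L[ℝ] CModule n H)) := by
  have h : (BOp n H : Set (CModule n H →L[ℝ] CModule n H)) =
      ⋂ a : Cl n, ⋂ x : CModule n H, {T | T (rmul a x) = rmul a (T x)} := by
    ext T
    simp only [Set.mem_iInter]
    rfl
  rw [h]
  refine isClosed_iInter fun a => isClosed_iInter fun x => ?_
  exact isClosed_eq (ContinuousLinearMap.apply ℝ _ (rmul a x)).continuous
    ((rmul a).continuous.comp (ContinuousLinearMap.apply ℝ _ x).continuous)

theorem coe_Qop (T : BOp n H) (s : EuclideanSpace ℝ (Fin (n + 1))) :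
    (Qop T s).1 = T.1 ^ 2 - (2 * s 0) • T.1 + (‖s‖ ^ 2) • 1 := rfl

theorem IsImaginary.mul_self {J : BOp n H} (hJ : IsImaginary J) : J.1 * J.1 = -1 := by
  have h : J.1 * -J.1 = 1 := congrArg Subtype.val hJ.2.1
  exact mul_self_eq_neg_one h

theorem mem_sResolventSet_of_isUnit {T : BOp n H} {s : EuclideanSpace ℝ (Fin (n + 1))}
    (h : IsUnit (Qop T s).1) : s ∈ sResolventSet T := by
  obtain ⟨u, hu⟩ := h
  have h1 : ∀ x, u⁻¹.1 ((Qop T s).1 x) = x := fun x => by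
    rw [← hu]
    exact congrArg (fun S : CModule n H →L[ℝ] CModule n H => S x) u.inv_mul
  have h2 : ∀ x, (Qop T s).1 (u⁻¹.1 x) = x := fun x => by
    rw [← hu]
    exact congrArg (fun S : CModule n H →L[ℝ] CModule n H => S x) u.mul_inv
  refine ⟨fun x hx => ?_, Function.Surjective.denseRange fun x => ⟨_, h2 x⟩,
    ‖u⁻¹.1‖, fun x => ?_⟩
  · rw [← h1 x, hx, map_zero]
  · conv_lhs => rw [← h1 x]
    exact ContinuousLinearMap.le_opNorm _ _

end NotComplete

/-! ### From Clifford spectral measures to real projection-valued measures -/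

section Transfer

variable {n : ℕ} {H : Type*} [NormedAddCommGroup H] [InnerProductSpace ℝ H] [CompleteSpace H]

theorem eq_zero_of_mul_self_eq_zero {K : Type*} [NormedAddCommGroup K] [InnerProductSpace ℝ K]
    [CompleteSpace K] (D : K →L[ℝ] K) (hD : IsSelfAdjoint D) (h : D * D = 0) : D = 0 := by
  ext x
  have := norm_sq_apply_of_isSelfAdjoint hD x
  rw [h, zero_apply, inner_zero_left] at this
  simpa using this

theorem IsImaginary.star_eq {J : BOp n H} (hJ : IsImaginary J) : star J.1 = -J.1 :=
  (isAdjointOf_iff_star.1 hJ.1).symm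

namespace SpectralMeasure

variable {Ω : Type*} [MeasurableSpace Ω]

/-- A spectral measure, seen as a projection-valued measure in a real Hilbert space. -/
def toProj (E : SpectralMeasure n H Ω) : ProjMeasure Ω (CModule n H) where
  toFun M := (E M).1
  selfAdj M hM := isSelfAdj_iff.1 (E.selfAdj M hM)
  idem M hM := congrArg Subtype.val (E.idem M hM)
  univ := congrArg Subtype.val E.univ
  iUnion := E.iUnion

variable (E : SpectralMeasure n H Ω) (J : BOp n H) {f : Ω → ℂ}

theorem toProj_apply (M : Set Ω) : E.toProj M = (E M).1 := rfl

theorem apply_eq_zero_iff {M : Set Ω} : E M = 0 ↔ E.toProj M = 0 := by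
  rw [toProj_apply, ← ZeroMemClass.coe_zero (BOp n H), Subtype.coe_inj]

theorem coe_simpleIntegral (s : SimpleFunc Ω ℂ) :
    (E.simpleIntegral J s).1 =
      E.toProj.simple (s.map Complex.re) + E.toProj.simple (s.map Complex.im) * J.1 := by
  rw [ProjMeasure.simple_map, ProjMeasure.simple_map, Finset.sum_mul, ← Finset.sum_add_distrib,
    simpleIntegral, AddSubmonoidClass.coe_finsetSum]
  refine Finset.sum_congr rfl fun c _ => ?_
  rw [smul_mul_assoc]
  rfl

theorem tendsto_simpleIntegral (hf : IsBddMeas f) {s : ℕ → SimpleFunc Ω ℂ}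
    (hs : TendstoUniformly (fun k z => s k z) f atTop) :
    Tendsto (fun k => (E.simpleIntegral J (s k)).1) atTop (𝓝 (E.toProj.cintegral J.1 f)) := by
  simp only [coe_simpleIntegral]
  have h1 : TendstoUniformly (fun k z => (s k z).re) (fun z => (f z).re) atTop :=
    Complex.reCLM.uniformContinuous.comp_tendstoUniformly hs
  have h2 : TendstoUniformly (fun k z => (s k z).im) (fun z => (f z).im) atTop :=
    Complex.imCLM.uniformContinuous.comp_tendstoUniformly hs
  exact (ProjMeasure.tendsto_simple_integral hf.re (s := fun k => (s k).map Complex.re) h1).add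
    ((ProjMeasure.tendsto_simple_integral hf.im
      (s := fun k => (s k).map Complex.im) h2).mul_const _)

theorem exists_tendstoUniformly (hf : IsBddMeas f) :
    ∃ s : ℕ → SimpleFunc Ω ℂ, TendstoUniformly (fun k z => s k z) f atTop := by
  obtain ⟨s, hs⟩ := hf.re.exists_simpleFunc
  obtain ⟨t, ht⟩ := hf.im.exists_simpleFunc
  refine ⟨fun k => ((s k).pair (t k)).map fun p => (p.1 : ℂ) + p.2 * Complex.I, ?_⟩
  rw [Metric.tendstoUniformly_iff]
  intro ε hε
  have h0 := (tendsto_one_div_add_atTop_nhds_zero_nat (𝕜 := ℝ)).const_mul 2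
  rw [mul_zero] at h0
  filter_upwards [h0.eventually (gt_mem_nhds hε)] with k hk z
  rw [dist_comm, dist_eq_norm]
  refine ((Complex.norm_le_abs_re_add_abs_im _).trans ?_).trans_lt hk
  have e1 : ((((s k).pair (t k)).map fun p => (p.1 : ℂ) + p.2 * Complex.I) z - f z).re =
      s k z - (f z).re := by simp
  have e2 : ((((s k).pair (t k)).map fun p => (p.1 : ℂ) + p.2 * Complex.I) z - f z).im =
      t k z - (f z).im := by simp
  rw [e1, e2, two_mul]
  exact add_le_add (hs k z) (ht k z)

/-- The limit computed in the real Hilbert space lies in `BOp n H` by closedness, which shows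
existence; one approximating sequence then identifies the chosen value. -/
theorem integral_spec (hf : IsBddMeas f) : E.IsIntegral J f (E.integral J f) ∧
    (E.integral J f).1 = E.toProj.cintegral J.1 f := by
  obtain ⟨s, hs⟩ := exists_tendstoUniformly hf
  have hmem : E.toProj.cintegral J.1 f ∈ BOp n H :=
    isClosed_bop.mem_of_tendsto (E.tendsto_simpleIntegral J hf hs)
      (Eventually.of_forall fun k => (E.simpleIntegral J (s k)).2)
  have hex : ∃ L, E.IsIntegral J f L :=
    ⟨⟨_, hmem⟩, fun t ht => tendsto_subtype_rng.2 (E.tendsto_simpleIntegral J hf ht)⟩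
  have h1 : E.IsIntegral J f (E.integral J f) := by
    rw [integral, dif_pos hex]
    exact hex.choose_spec
  exact ⟨h1, tendsto_nhds_unique (tendsto_subtype_rng.1 (h1 s hs))
    (E.tendsto_simpleIntegral J hf hs)⟩

theorem coe_integral (hf : IsBddMeas f) : (E.integral J f).1 = E.toProj.cintegral J.1 f :=
  (E.integral_spec J hf).2

theorem coe_integral_ofReal {h : Ω → ℝ} (hh : RealBddMeas h) :
    (E.integral J fun z => (h z : ℂ)).1 = E.toProj.integral h := by
  rw [E.coe_integral J (.ofReal hh), ProjMeasure.cintegral_ofReal]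

theorem innerMeasure_eq (W : BOp n H) (x y : CModule n H) (γ : Finset (Fin n)) :
    E.innerMeasure W x y γ = E.toProj.signedMeasure ((compInner y γ).comp W.1) x := by
  refine VectorMeasure.ext fun M hM => ?_
  rw [ProjMeasure.signedMeasure_apply _ _ _ hM]
  refine (if_pos hM).trans ?_
  rw [← compInner_apply]
  rfl

theorem clIntegral_innerMeasure {h : Ω → ℝ} (hh : RealBddMeas h) (W : BOp n H)
    (x y : CModule n H) :
    clIntegral h (E.innerMeasure W x y) = cinner (W.1 (E.toProj.integral h x)) y := by
  rw [clIntegral]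
  conv_rhs => rw [← (clBasis n).sum_repr (cinner (W.1 (E.toProj.integral h x)) y)]
  refine Finset.sum_congr rfl fun γ _ => ?_
  rw [innerMeasure_eq, ProjMeasure.signedIntegral_eq hh, ← compInner_apply]
  rfl

end SpectralMeasure

/-! ### The `S`-spectrum -/

/-- The `S`-spectrum is bounded. -/
theorem norm_le_of_mem_specPlus {T : BOp n H} {I : EuclideanSpace ℝ (Fin (n + 1))}
    (hI : I ∈ unitSphere n) {z : ℂ} (hz : z ∈ specPlus T I) : ‖z‖ ≤ 3 * ‖T.1‖ + 1 := by
  by_contra hcon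
  push Not at hcon
  refine hz.2 (mem_sResolventSet_of_isUnit ?_)
  have hns : ‖slice I z‖ ^ 2 = ‖z‖ ^ 2 := by
    rw [norm_sq_slice hI, Complex.sq_norm, Complex.normSq_apply]; ring
  rw [coe_Qop, slice_zero hI, hns]
  exact isUnit_quadratic T.1 (Complex.abs_re_le_norm z) hcon

theorem isBddMeas_coe {S : Set ℂ} {C : ℝ} (hS : ∀ z ∈ S, ‖z‖ ≤ C) :
    IsBddMeas fun z : S => (z : ℂ) := ⟨measurable_subtype_coe, C, fun z => hS z z.2⟩

/-- Boundedness of `S` makes the coordinates integrable, so that the representation becomes one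
complex integral of the identity function. -/
theorem represents_iff {S : Set ℂ} {C : ℝ} (hS : ∀ z ∈ S, ‖z‖ ≤ C) (G : SpectralMeasure n H S)
    (T J : BOp n H) :
    Represents G T J ↔ T.1 = G.toProj.cintegral J.1 fun z : S => (z : ℂ) := by
  have hb := isBddMeas_coe hS
  rw [Represents, ← Subtype.coe_inj]
  change T.1 = (G.integral J _).1 + (G.integral J _).1 * J.1 ↔ _
  rw [G.coe_integral_ofReal J hb.re, G.coe_integral_ofReal J hb.im]
  rfl

end Transfer

/-! ### Image measures and identities in the functional calculus -/

section Push

variable {Ω Ω' K : Type*} [MeasurableSpace Ω] [MeasurableSpace Ω'] [NormedAddCommGroup K]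
  [InnerProductSpace ℝ K] [CompleteSpace K]

namespace ProjMeasure

/-- The image of a projection-valued measure under a measurable map. -/
def map (P : ProjMeasure Ω K) {F : Ω → Ω'} (hF : Measurable F) : ProjMeasure Ω' K where
  toFun M := P (F ⁻¹' M)
  selfAdj M hM := P.selfAdj _ (hF hM)
  idem M hM := P.idem _ (hF hM)
  univ := P.univ
  iUnion M hM hd x := by
    rw [Set.preimage_iUnion]
    exact P.iUnion _ (fun i => hF (hM i)) (fun i j hij => (hd hij).preimage F) x

theorem simple_mapMeasure (P : ProjMeasure Ω K) {F : Ω → Ω'} (hF : Measurable F)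
    (s : SimpleFunc Ω' ℝ) : (P.map hF).simple s = P.simple (s.comp F hF) := by
  rw [simple, simple]
  -- Values of `s` that `s ∘ F` omits contribute the projection of the empty set.
  refine (Finset.sum_subset (SimpleFunc.range_comp_subset_range s hF) fun c _ hc => ?_).symm
  have h : F ⁻¹' (s ⁻¹' {c}) = ∅ := by
    rw [Set.eq_empty_iff_forall_notMem]
    intro z hz
    exact hc (SimpleFunc.mem_range.2 ⟨z, hz⟩)
  change c • P (F ⁻¹' (s ⁻¹' {c})) = 0
  rw [h, P.apply_empty, smul_zero]

theorem integral_map (P : ProjMeasure Ω K) {F : Ω → Ω'} (hF : Measurable F) {h : Ω' → ℝ}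
    (hh : RealBddMeas h) : (P.map hF).integral h = P.integral fun z => h (F z) := by
  obtain ⟨s, hs, hs'⟩ := exists_tendsto_simple (P.map hF) hh
  have hh' : RealBddMeas fun z => h (F z) := by
    obtain ⟨hm, C, hC⟩ := hh
    exact ⟨hm.comp hF, C, fun z => hC (F z)⟩
  refine tendsto_nhds_unique hs' ?_
  simp only [simple_mapMeasure]
  exact tendsto_simple_integral hh' (tendstoUniformly_of_abs_sub_le (c := 1)
    fun k z => by simpa using hs k (F z))

/-- The largest open set with null preimage. -/
theorem exists_isOpen_null (P : ProjMeasure Ω K) {f : Ω → ℂ} (hf : Measurable f) :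
    ∃ V : Set ℂ, IsOpen V ∧ P (f ⁻¹' V) = 0 ∧ ∀ U, IsOpen U → P (f ⁻¹' U) = 0 → U ⊆ V := by
  -- Null members of a countable base suffice: their union is a countable union of null sets, and it
  -- contains every null open set.
  let 𝓑 : Set (Set ℂ) := {B ∈ TopologicalSpace.countableBasis ℂ | P (f ⁻¹' B) = 0}
  have hb := TopologicalSpace.isBasis_countableBasis ℂ
  have hc : Countable 𝓑 :=
    ((TopologicalSpace.countable_countableBasis ℂ).mono fun _ h => h.1).to_subtype
  have ho : ∀ B : 𝓑, IsOpen (B : Set ℂ) := fun B => hb.isOpen B.2.1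
  refine ⟨⋃ B : 𝓑, B, isOpen_iUnion ho, ?_, fun U hU hU0 w hw => ?_⟩
  · rw [Set.preimage_iUnion]
    exact apply_iUnion_null (fun B => hf (ho B).measurableSet) fun B => B.2.2
  · obtain ⟨B, hB, hwB, hBU⟩ := hb.exists_subset_of_mem_open hw hU
    exact Set.mem_iUnion.2 ⟨⟨B, hB, apply_mono_null (hf (hb.isOpen hB).measurableSet)
      (hf hU.measurableSet) (Set.preimage_mono hBU) hU0⟩, hwB⟩

variable {P : ProjMeasure Ω K} {J : K →L[ℝ] K} {f : Ω → ℂ}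

/-- Together with the squared difference below, this expresses the real part and the square of the
imaginary part without `J`. -/
theorem cintegral_add_star (hJ : P.IsImaginaryUnit J) (hf : IsBddMeas f) :
    P.cintegral J f + star (P.cintegral J f) = (2 : ℝ) • P.integral fun z => (f z).re := by
  rw [star_cintegral hJ hf, ← cintegral_add hf hf.star, ← integral_smul 2 hf.re,
    ← cintegral_ofReal (J := J)]
  congr 1
  ext z
  rw [Complex.star_def, Complex.add_conj]

theorem cintegral_sub_star_mul_self (hJ : P.IsImaginaryUnit J) (hf : IsBddMeas f) :
    (P.cintegral J f - star (P.cintegral J f)) * (P.cintegral J f - star (P.cintegral J f)) =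
      (-4 : ℝ) • P.integral fun z => (f z).im * (f z).im := by
  have h1 : P.cintegral J f - star (P.cintegral J f) =
      P.cintegral J fun z => f z + (-1 : ℂ) * star (f z) := by
    rw [star_cintegral hJ hf, cintegral_add hf ((IsBddMeas.const _).mul hf.star),
      cintegral_mul hJ (.const _) hf.star, cintegral_const]
    simp [sub_eq_add_neg]
  have hb := hf.add ((IsBddMeas.const (-1)).mul hf.star)
  rw [h1, ← cintegral_mul hJ hb hb, ← integral_smul (-4) (hf.im.mul hf.im),
    ← cintegral_ofReal (J := J)]
  congr 1
  ext z
  rw [neg_one_mul, ← sub_eq_add_neg, Complex.star_def, Complex.sub_conj]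
  push_cast
  linear_combination 4 * ((f z).im : ℂ) ^ 2 * Complex.I_sq

/-- The real quadratic polynomial of the `S`-resolvent factors over the slice as `(f - w)(f - w̄)`.
-/
theorem cintegral_quadratic (hJ : P.IsImaginaryUnit J) (hf : IsBddMeas f) (w : ℂ) :
    P.cintegral J f ^ 2 - (2 * w.re) • P.cintegral J f + (w.re ^ 2 + w.im ^ 2) • 1 =
      P.cintegral J fun z => (f z - w) * (f z - star w) := by
  have h1 : (fun z => (f z - w) * (f z - star w)) = fun z => f z * f z +
      (((-(2 * w.re) : ℝ) : ℂ) * f z + ((w.re ^ 2 + w.im ^ 2 : ℝ) : ℂ)) := by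
    ext z
    have e1 : w + star w = ((2 * w.re : ℝ) : ℂ) := Complex.add_conj w
    have e2 : w * star w = ((w.re ^ 2 + w.im ^ 2 : ℝ) : ℂ) := by
      rw [Complex.star_def, Complex.mul_conj, Complex.normSq_apply]
      push_cast
      ring
    rw [← e2, Complex.ofReal_neg, ← e1]
    ring
  rw [h1, cintegral_add (hf.mul hf) (((IsBddMeas.const _).mul hf).add (.const _)),
    cintegral_add ((IsBddMeas.const _).mul hf) (.const _), cintegral_mul hJ hf hf,
    cintegral_mul hJ (.const _) hf, cintegral_const, cintegral_const, Complex.ofReal_re,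
    Complex.ofReal_im, Complex.ofReal_re, Complex.ofReal_im, zero_smul, add_zero, add_zero,
    smul_mul_assoc, one_mul, neg_smul, pow_two (P.cintegral J f)]
  abel

end ProjMeasure

/-- A measurable map that takes values in a measurable subset of `S` off a null set agrees there
with a measurable map into `S`. -/
theorem exists_measurable_into {f : Ω → ℂ} (hf : Measurable f) {Q S : Set ℂ}
    (hQ : MeasurableSet Q) (hQS : Q ⊆ S) (hS : S.Nonempty) :
    ∃ F : Ω → S, Measurable F ∧ ∀ z, f z ∈ Q → (F z : ℂ) = f z := by
  classical
  obtain ⟨s, hs⟩ := hS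
  have hmem : ∀ z, (if f z ∈ Q then f z else s) ∈ S := fun z => by
    split_ifs with h
    · exact hQS h
    · exact hs
  refine ⟨fun z => ⟨if f z ∈ Q then f z else s, hmem z⟩,
    (Measurable.ite (hf hQ) hf measurable_const).subtype_mk, fun z hz => ?_⟩
  simp [hz]

end Push

/-! ### Spectral measures that represent a spectral integral -/

section Spec

variable {n : ℕ} {H : Type*} [NormedAddCommGroup H] [InnerProductSpace ℝ H] [CompleteSpace H]
  {Ω : Type*} [MeasurableSpace Ω]

namespace SpectralMeasure

/-- The image of a spectral measure under a measurable map. -/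
def map {Ω' : Type*} [MeasurableSpace Ω'] (E : SpectralMeasure n H Ω) {F : Ω → Ω'}
    (hF : Measurable F) : SpectralMeasure n H Ω' where
  toFun M := E (F ⁻¹' M)
  selfAdj M hM := E.selfAdj _ (hF hM)
  idem M hM := E.idem _ (hF hM)
  univ := E.univ
  iUnion M hM hd x := by
    rw [Set.preimage_iUnion]
    exact E.iUnion _ (fun i => hF (hM i)) (fun i j hij => (hd hij).preimage F) x

variable (E : SpectralMeasure n H Ω) {J : BOp n H} {f : Ω → ℂ}

/-- The spectral integral of `f` is represented by an image measure on every bounded set that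
contains almost all values of `f`. -/
theorem exists_represents (hf : IsBddMeas f) {Q S : Set ℂ} (hQ : MeasurableSet Q) (hQS : Q ⊆ S)
    (hQ0 : E.toProj (f ⁻¹' Qᶜ) = 0) {C : ℝ} (hS : ∀ z ∈ S, ‖z‖ ≤ C) :
    ∃ G : SpectralMeasure n H S, Represents G (E.integral J f) J := by
  -- If `S` is empty, then so is `Q`, the whole space is null, and `1 = 0`: the module is trivial
  -- and the zero measure works.
  rcases S.eq_empty_or_nonempty with rfl | hne
  · have h0 : (1 : CModule n H →L[ℝ] CModule n H) = 0 := by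
      rw [Set.subset_empty_iff.1 hQS, Set.compl_empty, Set.preimage_univ] at hQ0
      rw [← hQ0]
      exact E.toProj.univ.symm
    have hz : ∀ S T : BOp n H, S = T := fun S T => Subtype.ext <| ContinuousLinearMap.ext fun x => by
      have hx : ∀ y : CModule n H, y = 0 := fun y =>
        congrArg (fun S : CModule n H →L[ℝ] CModule n H => S y) h0
      rw [hx (S.1 x), hx (T.1 x)]
    exact ⟨⟨fun _ => 0, fun _ _ => hz (E Set.univ) 0 ▸ E.selfAdj _ .univ, fun _ _ => hz _ _,
      hz _ _, fun _ _ _ x => by simp⟩, hz _ _⟩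
  · obtain ⟨F, hF, hFf⟩ := exists_measurable_into hf.1 hQ hQS hne
    refine ⟨E.map hF, ?_⟩
    have hb := isBddMeas_coe hS
    have hbF : IsBddMeas fun z => (F z : ℂ) :=
      ⟨measurable_subtype_coe.comp hF, C, fun z => hS _ (F z).2⟩
    have h1 : (E.map hF).toProj = E.toProj.map hF := rfl
    rw [represents_iff hS, E.coe_integral J hf, h1,
      ProjMeasure.cintegral_congr (hf.1 hQ.compl) hQ0 hf hbF fun z hz => ?_]
    · rw [ProjMeasure.cintegral, ProjMeasure.cintegral, ProjMeasure.integral_map _ hF hb.re,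
        ProjMeasure.integral_map _ hF hb.im]
    · exact (hFf z (by simpa using hz)).symm

/-- Points off the `S`-spectrum of the spectral integral of `f` have a neighbourhood that `f`
avoids almost everywhere. -/
theorem exists_isOpen_of_notMem_specPlus {I : EuclideanSpace ℝ (Fin (n + 1))}
    (hI : I ∈ unitSphere n) (hJ : E.toProj.IsImaginaryUnit J.1) (hf : IsBddMeas f)
    (him : E.AE fun z => 0 ≤ (f z).im) {w : ℂ} (hw : w ∉ specPlus (E.integral J f) I) :
    ∃ U : Set ℂ, IsOpen U ∧ w ∈ U ∧ E.toProj (f ⁻¹' U) = 0 := by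
  by_cases hw0 : 0 ≤ w.im
  · have hres : slice I w ∈ sResolventSet (E.integral J f) := by
      by_contra hcon
      exact hw ⟨hw0, hcon⟩
    obtain ⟨-, -, C, hC⟩ := hres
    have hq : (Qop (E.integral J f) (slice I w)).1 =
        E.toProj.cintegral J.1 fun z => (f z - w) * (f z - star w) := by
      rw [coe_Qop, slice_zero hI, norm_sq_slice hI, E.coe_integral J hf,
        ProjMeasure.cintegral_quadratic hJ hf]
    rw [hq] at hC
    have hb : IsBddMeas fun z => (f z - w) * (f z - star w) := by
      simp only [sub_eq_add_neg]
      exact (hf.add (.const _)).mul (hf.add (.const _))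
    obtain ⟨c, hc, hc0⟩ := ProjMeasure.exists_bounded_below hJ hb hC
    -- The product vanishes at `v = w`, so this set is a neighbourhood of `w`. Only the lower bound
    -- of the resolvent condition is needed.
    refine ⟨{v | ‖(v - w) * (v - star w)‖ < c}, isOpen_lt (by fun_prop) continuous_const, ?_, hc0⟩
    simpa using hc
  · obtain ⟨N, hN, hN0, hNim⟩ := him
    have ho : IsOpen {v : ℂ | v.im < 0} := isOpen_lt Complex.continuous_im continuous_const
    refine ⟨{v | v.im < 0}, ho, not_le.1 hw0, ?_⟩
    refine ProjMeasure.apply_mono_null (hf.1 ho.measurableSet) hN (fun z hz => ?_)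
      (E.apply_eq_zero_iff.1 hN0)
    by_contra hcon
    exact absurd (hNim z hcon) (not_le.2 hz)

end SpectralMeasure

/-- If `J` is admissible for an operator represented by `G` and `J`, then `J` commutes with `G`. -/
theorem isImaginaryUnit_of_represents (hn : n ≠ 0) {S : Set ℂ} {C : ℝ} (hS : ∀ z ∈ S, ‖z‖ ≤ C)
    {G : SpectralMeasure n H S} {T J : BOp n H} (hJ : IsImaginaryFor J T)
    (hG : Represents G T J) : G.toProj.IsImaginaryUnit J.1 := by
  obtain ⟨hJi, A, B, hA, hB, hAB, hAJ, hBJ, rfl⟩ := hJ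
  have hb := isBddMeas_coe hS
  obtain ⟨h1, h2⟩ := cartesian_unique (J := J.1) (A := A.1) (B := B.1) eq_zero_of_mul_self_eq_zero
    hJi.star_eq hJi.mul_self (isSelfAdj_iff.1 hA) (isSelfAdj_iff.1 (hB.isSelfAdj hn))
    (ProjMeasure.isSelfAdjoint_integral (P := G.toProj) hb.re)
    (ProjMeasure.isSelfAdjoint_integral (P := G.toProj) hb.im) (congrArg Subtype.val hAB)
    (congrArg Subtype.val hAJ) (congrArg Subtype.val hBJ)
    (ProjMeasure.integral_commute hb.re hb.im) ((represents_iff hS G _ J).1 hG)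
  refine ⟨hJi.star_eq, hJi.mul_self, fun M hM => ?_⟩
  obtain ⟨M', hM', rfl⟩ := hM
  -- Intertwining `G` with itself through `J` is the commutation relation; the coordinate integrals
  -- are `A` and `B`, which commute with `J` by admissibility.
  refine ProjMeasure.intertwine (P₁ := G.toProj) (P₂ := G.toProj) (f₁ := fun z : S => (z : ℂ))
    (f₂ := fun z : S => (z : ℂ)) measurable_subtype_coe measurable_subtype_coe
    (fun z => hS z z.2) (fun z => hS z z.2) ?_ ?_ hM'
  · rw [h1]
    exact (congrArg Subtype.val hAJ).symm
  · rw [h2]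
    exact (congrArg Subtype.val hBJ).symm

end Spec

/-! ### Spectral integrals -/

theorem eq_of_smul_eq {V : Type*} [AddCommGroup V] [Module ℝ V] {c : ℝ} (hc : c ≠ 0) {S T : V}
    (h : c • S = c • T) : S = T := by
  rw [← inv_smul_smul₀ hc S, h, inv_smul_smul₀ hc]

section SpectralIntegral

variable {n : ℕ} {H : Type*} [NormedAddCommGroup H] [InnerProductSpace ℝ H] [CompleteSpace H]
  {Ω : Type*} [MeasurableSpace Ω]

namespace SpectralMeasure

variable {E : SpectralMeasure n H Ω} {J : BOp n H} {f g : Ω → ℂ} {p q : Ω → Prop}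

theorem AE.and (hp : E.AE p) (hq : E.AE q) : E.AE fun z => p z ∧ q z := by
  obtain ⟨N, hN, hN0, hNp⟩ := hp
  obtain ⟨N', hN', hN0', hNq⟩ := hq
  refine ⟨N ∪ N', hN.union hN', ?_, fun z hz => ⟨hNp z fun h => hz (Or.inl h),
    hNq z fun h => hz (Or.inr h)⟩⟩
  rw [E.apply_eq_zero_iff] at *
  rw [← Set.union_sdiff_self, ProjMeasure.apply_union _ hN (hN'.diff hN)
    Set.disjoint_sdiff_right, hN0, ProjMeasure.apply_mono_null (hN'.diff hN) hN'
    Set.sdiff_subset hN0', add_zero]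

theorem AE.mono (hp : E.AE p) (h : ∀ z, p z → q z) : E.AE q := by
  obtain ⟨N, hN, hN0, hNp⟩ := hp
  exact ⟨N, hN, hN0, fun z hz => h z (hNp z hz)⟩

theorem integral_congr_ae (hf : IsBddMeas f) (hg : IsBddMeas g) (h : E.AE fun z => f z = g z) :
    E.integral J f = E.integral J g := by
  obtain ⟨N, hN, hN0, h⟩ := h
  refine Subtype.ext ?_
  rw [E.coe_integral J hf, E.coe_integral J hg,
    ProjMeasure.cintegral_congr hN (E.apply_eq_zero_iff.1 hN0) hf hg h]

theorem integral_one : E.integral J (fun _ => 1) = 1 := by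
  refine Subtype.ext ?_
  rw [E.coe_integral J (.const 1), ProjMeasure.cintegral_const, Complex.one_re, Complex.one_im,
    one_smul, zero_smul, add_zero]
  rfl

theorem integral_I : E.integral J (fun _ => Complex.I) = J := by
  refine Subtype.ext ?_
  rw [E.coe_integral J (.const _), ProjMeasure.cintegral_const, Complex.I_re, Complex.I_im,
    one_smul, zero_smul, zero_add]

theorem isSelfAdj_integral_ofReal {h : Ω → ℝ} (hh : RealBddMeas h) :
    IsSelfAdj (E.integral J fun z => (h z : ℂ)) := by
  rw [isSelfAdj_iff, E.coe_integral_ofReal J hh]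
  exact ProjMeasure.isSelfAdjoint_integral hh

theorem isAdjointOf_integral (hJ : E.toProj.IsImaginaryUnit J.1) (hf : IsBddMeas f) :
    IsAdjointOf (E.integral J fun z => star (f z)) (E.integral J f) := by
  rw [isAdjointOf_iff_star, E.coe_integral J hf, E.coe_integral J hf.star,
    ProjMeasure.star_cintegral hJ hf]

theorem integral_mul (hJ : E.toProj.IsImaginaryUnit J.1) (hf : IsBddMeas f) (hg : IsBddMeas g) :
    E.integral J (fun z => f z * g z) = E.integral J f * E.integral J g := by
  refine Subtype.ext ?_
  rw [E.coe_integral J (hf.mul hg), ProjMeasure.cintegral_mul hJ hf hg, ← E.coe_integral J hf,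
    ← E.coe_integral J hg]
  rfl

theorem isNormalOp_integral (hJ : E.toProj.IsImaginaryUnit J.1) (hf : IsBddMeas f) :
    IsNormalOp (E.integral J f) := by
  refine ⟨_, isAdjointOf_integral hJ hf, ?_⟩
  rw [← integral_mul hJ hf hf.star, ← integral_mul hJ hf.star hf]
  simp only [mul_comm]

theorem integral_const_mul_add (hJ : E.toProj.IsImaginaryUnit J.1) (c : ℂ) (hf : IsBddMeas f)
    (hg : IsBddMeas g) : E.integral J (fun z => c * f z + g z) =
      (c.re • (1 : BOp n H) + c.im • J) * E.integral J f + E.integral J g := by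
  refine Subtype.ext ?_
  rw [E.coe_integral J (((IsBddMeas.const c).mul hf).add hg),
    ProjMeasure.cintegral_add ((IsBddMeas.const c).mul hf) hg,
    ProjMeasure.cintegral_mul hJ (.const c) hf, ProjMeasure.cintegral_const,
    ← E.coe_integral J hf, ← E.coe_integral J hg]
  rfl

theorem coe_integral_apply (hJ : E.toProj.IsImaginaryUnit J.1) (hf : IsBddMeas f)
    (x : CModule n H) : (E.integral J f).1 x = E.toProj.integral (fun z => (f z).re) x +
      J.1 (E.toProj.integral (fun z => (f z).im) x) := by
  rw [E.coe_integral J hf, ProjMeasure.cintegral, ← hJ.mul_integral hf.im]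
  rfl

theorem cinner_integral (hJ : E.toProj.IsImaginaryUnit J.1) (hf : IsBddMeas f)
    (x y : CModule n H) : cinner ((E.integral J f).1 x) y =
      clIntegral (fun z => (f z).re) (E.innerMeasure 1 x y) +
        clIntegral (fun z => (f z).im) (E.innerMeasure J x y) := by
  rw [clIntegral_innerMeasure _ hf.re, clIntegral_innerMeasure _ hf.im,
    coe_integral_apply hJ hf, cinner_add_left]
  rfl

theorem norm_sq_integral_apply (hJ : E.toProj.IsImaginaryUnit J.1) (hf : IsBddMeas f)
    (x : CModule n H) : ‖(E.integral J f).1 x‖ ^ 2 =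
      signedIntegral (fun z => ‖f z‖ ^ 2) (E.innerMeasure 1 x x ∅) := by
  rw [innerMeasure_eq, ProjMeasure.signedIntegral_eq hf.norm_sq, E.coe_integral J hf,
    ProjMeasure.norm_sq_cintegral_apply hJ hf, ← clRe_cinner, clRe_apply, ← compInner_apply]
  rfl

theorem norm_integral (hJ : E.toProj.IsImaginaryUnit J.1) (hf : IsBddMeas f) :
    ‖E.integral J f‖ ≤ supNorm f ∧ E.EssBdd f ∧ ‖E.integral J f‖ = E.essNorm f := by
  have hnorm : ‖E.integral J f‖ = ‖E.toProj.cintegral J.1 f‖ :=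
    congrArg (fun S : CModule n H →L[ℝ] CModule n H => ‖S‖) (E.coe_integral J hf)
  obtain ⟨C, hC0, hC⟩ := hf.exists_bound
  have h0 : E ∅ = 0 := E.apply_eq_zero_iff.2 (ProjMeasure.apply_empty _)
  rw [hnorm]
  refine ⟨?_, ⟨C, ∅, .empty, h0, fun z _ => hC z⟩, le_antisymm ?_ ?_⟩
  -- On an empty space the real supremum is `0`, so nonnegativity holds without a point.
  · refine ProjMeasure.norm_cintegral_le hJ hf (Real.iSup_nonneg fun z => norm_nonneg _)
      fun z => le_ciSup (f := fun z => ‖f z‖) ⟨C, ?_⟩ z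
    rintro _ ⟨z, rfl⟩
    exact hC z
  · refine le_csInf ⟨C, hC0, ∅, .empty, h0, fun z _ => hC z⟩ ?_
    rintro D ⟨hD0, N, hN, hN0, hD⟩
    exact ProjMeasure.norm_cintegral_le_of_ae hJ hf hD0 hN (E.apply_eq_zero_iff.1 hN0) hD
  · refine csInf_le ⟨0, fun D hD => hD.1⟩ ⟨norm_nonneg _, _, ?_, E.apply_eq_zero_iff.2
      (ProjMeasure.apply_setOf_norm_lt hJ hf), fun z hz => not_lt.1 hz⟩
    exact measurableSet_lt measurable_const hf.1.norm

theorem tendsto_integral_apply {F : ℕ → Ω → ℂ} (hf : IsBddMeas f) (hF : ∀ j, IsBddMeas (F j))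
    (h : E.AE fun z => Tendsto (fun j => F j z) atTop (𝓝 (f z))) {κ : ℝ} (hκ : 0 < κ)
    (hFκ : ∀ j z, ‖F j z‖ ≤ κ) (x : CModule n H) :
    Tendsto (fun j => (E.integral J (F j)).1 x) atTop (𝓝 ((E.integral J f).1 x)) := by
  obtain ⟨N, hN, hN0, h⟩ := h
  simp only [E.coe_integral J hf, E.coe_integral J (hF _)]
  exact ProjMeasure.tendsto_cintegral hF hf hκ.le hFκ hN (E.apply_eq_zero_iff.1 hN0) h x

/-- On the plus space `J` acts as right multiplication by `I`, which right linearity moves out of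
the inner product as a factor on the right. On the minus space `I` changes sign, and this conjugates
`f`. -/
theorem cinner_integral_eq_clIntegralRight (hJi : IsImaginary J)
    {I : EuclideanSpace ℝ (Fin (n + 1))} (hI : I ∈ unitSphere n) (hf : IsBddMeas f)
    (x y : CModule n H) : cinner ((E.integral J f).1 x) y =
      clIntegralRight I (E.innerMeasure 1 ((plusSpace J I).starProjection x) y) f +
        clIntegralRight I (E.innerMeasure 1 ((minusSpace J I).starProjection x) y)
          (fun z => star (f z)) := by
  have hlin : ∀ (a : Cl n) (x : CModule n H), E.toProj.integral (fun z => (f z).im) (rmul a x) =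
      rmul a (E.toProj.integral (fun z => (f z).im) x) := by
    rw [← E.coe_integral_ofReal J hf.im]
    exact (E.integral J fun z => ((f z).im : ℂ)).2
  have happ : ∀ x, (E.integral J f).1 x = E.toProj.integral (fun z => (f z).re) x +
      E.toProj.integral (fun z => (f z).im) (J.1 x) := fun x => by
    rw [E.coe_integral J hf]; rfl
  have h1 : (fun z => (star (f z)).re) = fun z => (f z).re := rfl
  have h2 : (fun z => (star (f z)).im) = fun z => -(f z).im := rfl
  conv_lhs => rw [← starProjection_add_starProjection hJi hI x]
  rw [map_add, cinner_add_left, happ, happ, map_starProjection_plusSpace,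
    map_starProjection_minusSpace, hlin, hlin, cinner_add_left, cinner_add_left,
    cinner_rmul_left, cinner_rmul_left, clIntegralRight, clIntegralRight, h1, h2,
    clIntegral_innerMeasure _ hf.re, clIntegral_innerMeasure _ hf.im,
    clIntegral_innerMeasure _ hf.re, clIntegral_innerMeasure _ hf.im.neg,
    ProjMeasure.integral_neg hf.im]
  change _ = cinner _ y + cinner _ y * toCl I + (cinner _ y +
    cinner (-(E.toProj.integral (fun z => (f z).im) _)) y * toCl I)
  rw [cinner_neg_left, mul_neg, neg_mul]
  rfl

/-- Almost everywhere `f` is the square of `√(Re f)`, so the integral is `S²` with `S` self-adjoint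
and `⟨S² x, x⟩ = ⟨S x, S x⟩`. -/
theorem isPositiveOp_integral (hJ : E.toProj.IsImaginaryUnit J.1) (hf : IsBddMeas f)
    (h : E.AE fun z => (f z).im = 0 ∧ 0 ≤ (f z).re) : IsPositiveOp (E.integral J f) := by
  have hm : RealBddMeas fun z => √(f z).re := hf.re.sqrt
  refine isPositiveOp_of_eq_mul_self (isSelfAdj_integral_ofReal (E := E) (J := J) hm) ?_
  rw [← integral_mul hJ (.ofReal hm) (.ofReal hm)]
  refine integral_congr_ae hf ((IsBddMeas.ofReal hm).mul (.ofReal hm)) (h.mono fun z hz => ?_)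
  rw [← Complex.ofReal_mul, Real.mul_self_sqrt hz.2]
  exact Complex.ext rfl hz.1

theorem integral_mul_eq_one (hJ : E.toProj.IsImaginaryUnit J.1) (hf : IsBddMeas f)
    (hg : IsBddMeas g) (h : E.AE fun z => f z ≠ 0) (hfg : E.AE fun z => g z = (f z)⁻¹) :
    E.integral J f * E.integral J g = 1 ∧ E.integral J g * E.integral J f = 1 := by
  have h1 : E.AE fun z => f z * g z = 1 :=
    (h.and hfg).mono fun z hz => by rw [hz.2, mul_inv_cancel₀ hz.1]
  rw [← integral_mul hJ hf hg, ← integral_mul hJ hg hf, ← integral_one (E := E) (J := J)]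
  exact ⟨integral_congr_ae (hf.mul hg) (.const 1) h1, integral_congr_ae (hg.mul hf) (.const 1)
    (h1.mono fun z hz => by rw [mul_comm, hz])⟩

theorem exists_isBddMeas_inv (hf : IsBddMeas f) (h : E.EssBdd fun z => (f z)⁻¹) :
    ∃ g : Ω → ℂ, IsBddMeas g ∧ E.AE fun z => g z = (f z)⁻¹ := by
  obtain ⟨C, N, hN, hN0, hC⟩ := h
  refine ⟨Nᶜ.indicator fun z => (f z)⁻¹, ⟨hf.1.inv.indicator hN.compl, |C|, fun z => ?_⟩,
    N, hN, hN0, fun z hz => by simp [hz]⟩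
  by_cases hz : z ∈ N
  · simp [hz]
  · simpa [hz] using (hC z hz).trans (le_abs_self C)

theorem ae_of_isUnit_integral (hJ : E.toProj.IsImaginaryUnit J.1) (hf : IsBddMeas f)
    (h : IsUnit (E.integral J f)) : (E.AE fun z => f z ≠ 0) ∧ E.EssBdd fun z => (f z)⁻¹ := by
  obtain ⟨S, hS⟩ := h.exists_left_inv
  have h1 : ∀ x, ‖x‖ ≤ ‖S.1‖ * ‖E.toProj.cintegral J.1 f x‖ := fun x => by
    have h2 : S.1 ((E.integral J f).1 x) = x := congrArg (fun S : BOp n H => S.1 x) hS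
    rw [← E.coe_integral J hf]
    conv_lhs => rw [← h2]
    exact ContinuousLinearMap.le_opNorm _ _
  obtain ⟨c, hc, hc0⟩ := ProjMeasure.exists_bounded_below hJ hf h1
  have hm : MeasurableSet {z | ‖f z‖ < c} := measurableSet_lt hf.1.norm measurable_const
  refine ⟨⟨_, hm, E.apply_eq_zero_iff.2 hc0, fun z hz hz0 => hz ?_⟩,
    c⁻¹, _, hm, E.apply_eq_zero_iff.2 hc0, fun z hz => ?_⟩
  · rw [Set.mem_ofPred_eq, hz0, norm_zero]
    exact hc
  · change ‖(f z)⁻¹‖ ≤ c⁻¹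
    rw [norm_inv]
    exact inv_anti₀ hc (not_lt.1 hz)

/-- An inverse bounds `𝕀(f)` from below, hence `|f|` from below almost everywhere; conversely a
bounded representative of `1/f` integrates to the inverse. Since `0⁻¹ = 0`, boundedness of the
inverse alone would not exclude zeros of `f`. -/
theorem isUnit_integral_iff (hJ : E.toProj.IsImaginaryUnit J.1) (hf : IsBddMeas f) :
    IsUnit (E.integral J f) ↔ (E.AE fun z => f z ≠ 0) ∧ E.EssBdd fun z => (f z)⁻¹ := by
  refine ⟨ae_of_isUnit_integral hJ hf, fun ⟨h1, h2⟩ => ?_⟩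
  obtain ⟨g, hg, hfg⟩ := exists_isBddMeas_inv hf h2
  obtain ⟨h3, h4⟩ := integral_mul_eq_one hJ hf hg h1 hfg
  exact ⟨⟨_, _, h3, h4⟩, rfl⟩

theorem isImaginaryFor_integral (hJ : E.toProj.IsImaginaryUnit J.1) (hJi : IsImaginary J)
    (hf : IsBddMeas f) (h : E.AE fun z => 0 ≤ (f z).im) :
    IsImaginaryFor J (E.integral J f) := by
  have hA := E.coe_integral_ofReal J hf.re
  have hB := E.coe_integral_ofReal J hf.im
  refine ⟨hJi, E.integral J fun z => ((f z).re : ℂ), E.integral J fun z => ((f z).im : ℂ),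
    isSelfAdj_integral_ofReal (E := E) (J := J) hf.re,
    isPositiveOp_integral hJ (.ofReal hf.im) (h.mono fun z hz => ⟨rfl, hz⟩), Subtype.ext ?_,
    Subtype.ext ?_, Subtype.ext ?_, Subtype.ext ?_⟩
  · change (E.integral J _).1 * (E.integral J _).1 = (E.integral J _).1 * (E.integral J _).1
    rw [hA, hB, ProjMeasure.integral_commute hf.re hf.im]
  · change (E.integral J _).1 * J.1 = J.1 * (E.integral J _).1
    rw [hA, hJ.mul_integral hf.re]
  · change (E.integral J _).1 * J.1 = J.1 * (E.integral J _).1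
    rw [hB, hJ.mul_integral hf.im]
  · change (E.integral J f).1 = (E.integral J _).1 + J.1 * (E.integral J _).1
    rw [hA, hB, E.coe_integral J hf, ProjMeasure.cintegral, hJ.mul_integral hf.im]

/-- The spectral measure of the spectral integral of a function with values in the upper half
plane exists. -/
theorem exists_represents_specPlus (hJ : E.toProj.IsImaginaryUnit J.1)
    {I : EuclideanSpace ℝ (Fin (n + 1))} (hI : I ∈ unitSphere n)
    (hf : IsBddMeas f) (h : E.AE fun z => 0 ≤ (f z).im) :
    ∃ G : SpectralMeasure n H (specPlus (E.integral J f) I), Represents G (E.integral J f) J := by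
  -- The complement of `V` is the essential range of `f`. It carries the image measure, and it lies
  -- in the spectrum because points outside have null neighbourhoods.
  obtain ⟨V, hV, hV0, hVmax⟩ := ProjMeasure.exists_isOpen_null E.toProj hf.1
  refine exists_represents E hf hV.measurableSet.compl (fun w hw => ?_) (by rwa [compl_compl])
    fun z hz => norm_le_of_mem_specPlus hI hz
  by_contra hcon
  obtain ⟨U, hU, hwU, hU0⟩ := exists_isOpen_of_notMem_specPlus E hI hJ hf h hcon
  exact hw (hVmax U hU hU0 hwU)

/-- The spectral measure of the spectral integral of a function with values in the upper half
plane is unique. -/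
theorem apply_preimage_of_represents_specPlus (hJ : E.toProj.IsImaginaryUnit J.1)
    {I : EuclideanSpace ℝ (Fin (n + 1))} (hI : I ∈ unitSphere n)
    (hf : IsBddMeas f) (h : E.AE fun z => 0 ≤ (f z).im) {L J' : BOp n H}
    (hL : L = E.integral J f) {G : SpectralMeasure n H (specPlus L I)}
    (hJ' : IsImaginaryFor J' L) (hG : Represents G L J') {M : Set ℂ} (hM : MeasurableSet M) :
    G ((↑) ⁻¹' M) = E (f ⁻¹' M) := by
  have hS : ∀ z ∈ specPlus L I, ‖z‖ ≤ 3 * ‖L.1‖ + 1 := fun z hz => norm_le_of_mem_specPlus hI hz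
  have hGu := isImaginaryUnit_of_represents (ne_zero_of_mem_unitSphere hI) hS hJ' hG
  have hb := isBddMeas_coe hS
  have e : E.toProj.cintegral J.1 f = G.toProj.cintegral J'.1 fun z => (z : ℂ) := by
    rw [← (represents_iff hS G L J').1 hG, hL, E.coe_integral J hf]
  obtain ⟨N, hN, hN0, hNim⟩ := h
  refine Subtype.ext (ProjMeasure.apply_preimage_eq_of_sq (P := E.toProj) (P' := G.toProj)
    (g := fun z => (z : ℂ)) hf hb hN (E.apply_eq_zero_iff.1 hN0) hNim (fun z => z.2.1) ?_ ?_ hM).symm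
  -- `J` and `J'` may differ, so only combinations of the operator and its adjoint in which the
  -- imaginary operator has disappeared are compared.
  · have h1 := ProjMeasure.cintegral_add_star hJ hf
    rw [e, ProjMeasure.cintegral_add_star hGu hb] at h1
    exact (eq_of_smul_eq two_ne_zero h1).symm
  · have h1 := ProjMeasure.cintegral_sub_star_mul_self hJ hf
    rw [e, ProjMeasure.cintegral_sub_star_mul_self hGu hb] at h1
    exact (eq_of_smul_eq (by norm_num) h1).symm

/-- A measure on a bounded set that represents the spectral integral of `f`, with the same
imaginary operator, is the image measure. -/
theorem apply_preimage_of_represents (hJ : E.toProj.IsImaginaryUnit J.1) (hf : IsBddMeas f)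
    {S : Set ℂ} {C : ℝ} (hS : ∀ z ∈ S, ‖z‖ ≤ C) (hC : ∀ z, ‖f z‖ ≤ C)
    {G : SpectralMeasure n H S} (hG : Represents G (E.integral J f) J) {M : Set ℂ}
    (hM : MeasurableSet M) : G ((↑) ⁻¹' M) = E (f ⁻¹' M) := by
  have hb := isBddMeas_coe hS
  have e := (represents_iff hS G _ J).1 hG
  rw [E.coe_integral J hf, ProjMeasure.cintegral, ← hJ.mul_integral hf.im] at e
  obtain ⟨h1, h2⟩ := cartesian_unique eq_zero_of_mul_self_eq_zero hJ.star_eq hJ.mul_self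
    (ProjMeasure.isSelfAdjoint_integral hf.re) (ProjMeasure.isSelfAdjoint_integral hf.im)
    (ProjMeasure.isSelfAdjoint_integral hb.re) (ProjMeasure.isSelfAdjoint_integral hb.im)
    (ProjMeasure.integral_commute hf.re hf.im) (hJ.mul_integral hf.re).symm
    (hJ.mul_integral hf.im).symm (ProjMeasure.integral_commute hb.re hb.im) e
  have h3 := ProjMeasure.intertwine (P₁ := G.toProj) (P₂ := E.toProj) (W := 1)
    (f₁ := fun z : S => (z : ℂ)) hb.1 hf.1 (fun z => hS z z.2) hC
    (by rw [h1, one_mul, mul_one]) (by rw [h2, one_mul, mul_one]) hM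
  rw [one_mul, mul_one] at h3
  exact Subtype.ext h3

end SpectralMeasure

end SpectralIntegral

end CliffordSpectral

end

/-! ### Functional calculus of a normal operator -/

theorem mainTheorem4 {n : ℕ} {H : Type*} [NormedAddCommGroup H] [InnerProductSpace ℝ H]
    [CompleteSpace H] (T J : BOp n H) (hT : IsNormalOp T) (hJ : IsImaginaryFor J T)
    (I : EuclideanSpace ℝ (Fin (n + 1))) (hI : I ∈ unitSphere n)
    (E : SpectralMeasure n H (specPlus T I)) (hE : Represents E T J) :
    -- the spectral integrals are well defined normal operators
    (∀ f : specPlus T I → ℂ, IsBddMeas f →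
      E.IsIntegral J f (E.integral J f) ∧ IsNormalOp (E.integral J f)) ∧
    -- adjoints
    (∀ f : specPlus T I → ℂ, IsBddMeas f →
      IsAdjointOf (E.integral J fun z => star (f z)) (E.integral J f)) ∧
    -- products
    (∀ f g : specPlus T I → ℂ, IsBddMeas f → IsBddMeas g →
      E.integral J (fun z => f z * g z) = E.integral J f * E.integral J g) ∧
    -- the constant function `I`, and linearity
    E.integral J (fun _ => Complex.I) = J ∧
    (∀ (c : ℂ) (f g : specPlus T I → ℂ), IsBddMeas f → IsBddMeas g →
      E.integral J (fun z => c * f z + g z) =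
        (c.re • (1 : BOp n H) + c.im • J) * E.integral J f + E.integral J g) ∧
    -- matrix elements
    (∀ f : specPlus T I → ℂ, IsBddMeas f → ∀ x y : CModule n H,
      cinner ((E.integral J f).1 x) y =
        clIntegral (fun z => (f z).re) (E.innerMeasure 1 x y) +
          clIntegral (fun z => (f z).im) (E.innerMeasure J x y)) ∧
    -- norms of vectors
    (∀ f : specPlus T I → ℂ, IsBddMeas f → ∀ x : CModule n H,
      ‖(E.integral J f).1 x‖ ^ 2 =
        signedIntegral (fun z => ‖f z‖ ^ 2) (E.innerMeasure 1 x x ∅)) ∧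
    -- operator norm
    (∀ f : specPlus T I → ℂ, IsBddMeas f →
      ‖E.integral J f‖ ≤ supNorm f ∧ E.EssBdd f ∧ ‖E.integral J f‖ = E.essNorm f) ∧
    -- bounded strong convergence
    (∀ (f : specPlus T I → ℂ) (F : ℕ → specPlus T I → ℂ), IsBddMeas f →
      (∀ j, IsBddMeas (F j)) → E.AE (fun z => Tendsto (fun j => F j z) atTop (𝓝 (f z))) →
      (∃ κ : ℝ, 0 < κ ∧ ∀ j z, ‖F j z‖ ≤ κ) → ∀ x : CModule n H,
        Tendsto (fun j => (E.integral J (F j)).1 x) atTop (𝓝 ((E.integral J f).1 x))) ∧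
    -- splitting along the two eigenspaces of `J`
    (∀ f : specPlus T I → ℂ, IsBddMeas f → ∀ x y : CModule n H,
      cinner ((E.integral J f).1 x) y =
        clIntegralRight I (E.innerMeasure 1 ((plusSpace J I).starProjection x) y) f +
          clIntegralRight I (E.innerMeasure 1 ((minusSpace J I).starProjection x) y)
            (fun z => star (f z))) ∧
    -- positivity
    (∀ f : specPlus T I → ℂ, IsBddMeas f → E.AE (fun z => (f z).im = 0 ∧ 0 ≤ (f z).re) →
      IsPositiveOp (E.integral J f)) ∧
    -- invertibility
    (∀ f : specPlus T I → ℂ, IsBddMeas f →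
      (IsUnit (E.integral J f) ↔
        E.AE (fun z => f z ≠ 0) ∧ E.EssBdd (fun z => (f z)⁻¹)) ∧
      (IsUnit (E.integral J f) →
        (∃ g : specPlus T I → ℂ, IsBddMeas g ∧ E.AE (fun z => g z = (f z)⁻¹)) ∧
        ∀ g : specPlus T I → ℂ, IsBddMeas g → E.AE (fun z => g z = (f z)⁻¹) →
          E.integral J f * E.integral J g = 1 ∧ E.integral J g * E.integral J f = 1)) ∧
    -- the spectral measure of `𝕀(f)`, when `f` has values in the upper half plane
    (∀ f : specPlus T I → ℂ, IsBddMeas f → E.AE (fun z => 0 ≤ (f z).im) →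
      IsImaginaryFor J (E.integral J f) ∧
      (∃ G : SpectralMeasure n H (specPlus (E.integral J f) I),
        Represents G (E.integral J f) J) ∧
      ∀ (K : BOp n H) (G : SpectralMeasure n H (specPlus (E.integral J f) I)),
        IsImaginaryFor K (E.integral J f) → Represents G (E.integral J f) K →
        ∀ M : Set ℂ, MeasurableSet M → G ((↑) ⁻¹' M) = E (f ⁻¹' M)) ∧
    -- the measure on a disc that represents `𝕀(f)`, for arbitrary `f`
    (∀ f : specPlus T I → ℂ, IsBddMeas f → ∀ R : ℝ, (∀ z, ‖f z‖ ≤ R) →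
      (∃ G : SpectralMeasure n H (Metric.closedBall (0 : ℂ) R),
        Represents G (E.integral J f) J) ∧
      ∀ G : SpectralMeasure n H (Metric.closedBall (0 : ℂ) R),
        Represents G (E.integral J f) J →
        ∀ M : Set ℂ, MeasurableSet M → G ((↑) ⁻¹' M) = E (f ⁻¹' M)) := by
  have hn := ne_zero_of_mem_unitSphere hI
  have hS : ∀ z ∈ specPlus T I, ‖z‖ ≤ _ := fun z hz => norm_le_of_mem_specPlus hI hz
  -- All multiplicative assertions rest on this commutation of `J` with `E`.
  have hJu := isImaginaryUnit_of_represents hn hS hJ hE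
  refine ⟨fun f hf => ⟨(E.integral_spec J hf).1, SpectralMeasure.isNormalOp_integral hJu hf⟩,
    fun f hf => SpectralMeasure.isAdjointOf_integral hJu hf,
    fun f g hf hg => SpectralMeasure.integral_mul hJu hf hg, SpectralMeasure.integral_I,
    fun c f g hf hg => SpectralMeasure.integral_const_mul_add hJu c hf hg,
    fun f hf x y => SpectralMeasure.cinner_integral hJu hf x y,
    fun f hf x => SpectralMeasure.norm_sq_integral_apply hJu hf x,
    fun f hf => SpectralMeasure.norm_integral hJu hf,
    fun f F hf hF h ⟨κ, hκ, hFκ⟩ x =>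
      SpectralMeasure.tendsto_integral_apply hf hF h hκ hFκ x,
    fun f hf x y => SpectralMeasure.cinner_integral_eq_clIntegralRight hJ.1 hI hf x y,
    fun f hf h => SpectralMeasure.isPositiveOp_integral hJu hf h,
    fun f hf => ⟨SpectralMeasure.isUnit_integral_iff hJu hf, fun hu => ?_⟩,
    fun f hf h => ⟨SpectralMeasure.isImaginaryFor_integral hJu hJ.1 hf h,
      SpectralMeasure.exists_represents_specPlus hJu hI hf h, fun K G hK hG M hM =>
      SpectralMeasure.apply_preimage_of_represents_specPlus hJu hI hf h rfl hK hG hM⟩,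
    fun f hf R hR => ?_⟩
  · obtain ⟨h1, h2⟩ := SpectralMeasure.ae_of_isUnit_integral hJu hf hu
    exact ⟨SpectralMeasure.exists_isBddMeas_inv hf h2, fun g hg hfg =>
      SpectralMeasure.integral_mul_eq_one hJu hf hg h1 hfg⟩
  · have hD : ∀ z ∈ Metric.closedBall (0 : ℂ) R, ‖z‖ ≤ R := fun z hz => mem_closedBall_zero_iff.1 hz
    refine ⟨SpectralMeasure.exists_represents E hf Metric.isClosed_closedBall.measurableSet
      subset_rfl ?_ hD, fun G hG M hM =>
      SpectralMeasure.apply_preimage_of_represents hJu hf hD hR hG hM⟩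
    -- The closed disc contains every value of `f`, so the exceptional set is empty and not merely
    -- null.
    rw [show f ⁻¹' (Metric.closedBall (0 : ℂ) R)ᶜ = ∅ from
      Set.eq_empty_of_forall_notMem fun z hz => hz (mem_closedBall_zero_iff.2 (hR z))]
    exact ProjMeasure.apply_empty _
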